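/- Let $S$ be a finite set of at least two items, $\bot$ a symbol that is not an item, $p$ a number of processes and $\varphi\ge 1$ an integer. The algorithm DMTF represents $S$ by a doubly linked list. Each node has fields $item$ (never changed), $next$, $prev$, $old$, $new$. A compare-and-swap (CAS) object $Head$ holds pointers to the first and second nodes of the list, and each process $p_i$ has a CAS object $A[i]$ holding a pair. $\mathrm{CAS}(O,x,y)$ atomically replaces the value of $O$ by $y$ if it equals $x$, and returns the value that $O$ had immediately before. Initially the list has exactly one node for each item of $S$, in some order and correctly linked, $old=\mathrm{DONE}$ and $new=\mathrm{NULL}$ in each of them, $A[i]=(\mathrm{NULL},\bot)$ for all $i$, and no process is performing an operation. The $p$ processes run asynchronously; each step makes at most one access to shared memory, steps are interleaved arbitrarily, processes may crash (stop for ever), and each process may at any time when it is not performing an operation invoke $\mathrm{SEARCH}(e)$ for any item $e$, in $S$ or not. Allocated nodes are always new. The code is as follows. $\mathrm{SEARCH}(e)$ by $p_i$: 1. Let $g$ point to a newly allocated node with $item=e$ and all other fields $\mathrm{NULL}$. $\mathrm{CAS}(A[i],(\mathrm{NULL},\bot),(g,e))$. $(h_1,h)\leftarrow Head$. 2. If $h_1.item=e$: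 $(a,b)\leftarrow \mathrm{CAS}(A[i],(g,e),(\mathrm{NULL},\bot))$; if $b=\bot$ then $\mathrm{CAS}(A[i],(a,b),(\mathrm{NULL},\bot))$; return $h_1$. 3. $c\leftarrow 0$. While $h\ne\mathrm{NULL}$: (i) if $h.item=e$: $(a,b)\leftarrow A[i]$; if $b=\bot$ then $\mathrm{CAS}(A[i],(a,b),(\mathrm{NULL},\bot))$ and return $a$; otherwise $\mathrm{CAS}(g.old,\mathrm{NULL},h)$; $\mathrm{CAS}(h.new,\mathrm{NULL},g)$; $g'\leftarrow h.new$; if $g'\ne\mathrm{GONE}$ then MOVE-TO-FRONT$(g')$; $(a,b)\leftarrow A[i]$; $\mathrm{CAS}(A[i],(a,b),(\mathrm{NULL},\bot))$; return $a$; (ii) $c\leftarrow (c+1)\bmod\varphi$; if $c=0$: $(a,b)\leftarrow A[i]$, and if $b=\bot$ then $\mathrm{CAS}(A[i],(a,b),(\mathrm{NULL},\bot))$ and return $a$; (iii) $h\leftarrow h.next$. 4. $(a,b)\leftarrow A[i]$; $\mathrm{CAS}(A[i],(a,b),(\mathrm{NULL},\bot))$; if $b=\bot$ return $a$, else return NOT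 PRESENT. MOVE-TO-FRONT$(g')$: while $g'.old\ne\mathrm{DONE}$: $(h_1,h_2)\leftarrow Head$; $h'\leftarrow h_1.old$. If $h'=\mathrm{DONE}$: if $g'.old\ne\mathrm{DONE}$ then $\mathrm{CAS}(Head,(h_1,h_2),(g',h_1))$. Otherwise: $\mathrm{CAS}(h_1.next,\mathrm{NULL},h_2)$; $\mathrm{CAS}(h_2.prev,\mathrm{NULL},h_1)$; $e'\leftarrow h_1.item$; for every process index $j$: $(a,b)\leftarrow A[j]$, and if $b=e'$ and $h_1.old\ne\mathrm{DONE}$ then $\mathrm{CAS}(A[j],(a,b),(h_1,\bot))$; then $pred\leftarrow h'.prev$; $succ\leftarrow h'.next$; $\mathrm{CAS}(pred.next,h',succ)$; if $succ\ne\mathrm{NULL}$ then $\mathrm{CAS}(succ.prev,h',pred)$; $\mathrm{CAS}(h'.new,h_1,\mathrm{GONE})$; $\mathrm{CAS}(h_1.old,h',\mathrm{DONE})$. Theorem. DMTF is linearizable: for every (finite or infinite) execution one can assign distinct linearization points to all completed operations and to some subset of the incomplete ones such that the point of each such operation lies after its invocation and, if it is completed, before its return, and the result of every completed operation (a pointer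 to a node containing the item, or NOT PRESENT) is the same as if the linearized operations were performed sequentially, in the order of their points, on a move-to-front list of the items of $S$. Moreover, the points can be chosen so that for every linearized operation $\mathrm{SEARCH}(e)$: if $e\in S$, then at its linearization point the first node of the list (the one to which the first component of $Head$ points) contains $e$, and the operation, if it returns, returns a pointer to this node; if $e\notin S$, the operation, if it returns, returns NOT PRESENT. A $\mathrm{SEARCH}(e)$ with $e\notin S$ does return NOT PRESENT if its process does not crash, i.e. keeps taking steps. In every reachable configuration each process that is performing an operation has a next step (it never dereferences $\mathrm{NULL}$). -/

import Mathlib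

/-!
Shared-memory model of DMTF, a list-based implementation of a static set by `p` asynchronous
processes that communicate through registers and compare-and-swap (CAS) objects.

Every step of a process performs at most one access to the shared memory, followed by local
computation. Any process may be scheduled at any time and may stop for ever (crash) at any time.
-/

namespace DMTF

/-- Memory addresses of nodes. -/
abbrev Addr := ℕ

/-- A pointer to a node, or `NULL` (`none`). -/
abbrev Ptr := Option Addr

/-- Contents of the fields `old` and `new`: a pointer (possibly `NULL`), or a special mark, which
is read as `DONE` in the field `old` and as `GONE` in the field `new`. -/
inductive Link where
  | ptr (a : Ptr)
  | mark
  deriving DecidableEq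

/-- The mark `DONE` of a field `old`. -/
abbrev Link.DONE : Link := Link.mark

/-- The mark `GONE` of a field `new`. -/
abbrev Link.GONE : Link := Link.mark

/-- Nodes of the doubly linked list. -/
structure Node (Item : Type*) where
  item : Item
  next : Ptr
  prev : Ptr
  old : Link
  new : Link

/-- What a `SEARCH` returns: a pointer or NOT PRESENT. -/
inductive Result where
  | pointer (a : Ptr)
  | notPresent

/-- Program counter. The code of each position is given in `Step`. -/
inductive PC where
  -- positions in `SEARCH`
  | allocate | announce | getHead | testFront | unannFront1 | unannFront2
  | loop | testItem | readAnn1 | unannOther1 | setOld | setNew | getNew | readAnn2 | unannPostMTF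
  | readAnn3 | unannOther2 | next | readAnn4 | unannEnd | ret
  -- positions in `MOVE-TO-FRONT`
  | outer | getHead2 | getOld | testPrepend | prepend | setNext | setPrev | getItem
  | readAnn | testInform | inform | getPrev | getNext | remove1 | remove2 | gone | done

/-- Local variables of a process that is performing `SEARCH(e)`. -/
structure Loc (Item : Type*) (p : ℕ) where
  pc : PC
  /-- the item searched for -/
  e : Item
  /-- the replacement node allocated for this search -/
  g : Ptr := none
  /-- first node of the list, as read at the start of the search -/
  h1 : Ptr := none
  /-- current node of the traversal -/
  h : Ptr := none
  c : ℕ := 0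
  a : Ptr := none
  b : Option Item := none
  /-- parameter of `MOVE-TO-FRONT` -/
  g' : Ptr := none
  /-- the variables `h₁`, `h₂` of `MOVE-TO-FRONT` -/
  k1 : Ptr := none
  k2 : Ptr := none
  h' : Ptr := none
  e' : Item := e
  /-- process indices still to be treated in the loop that informs all processes -/
  todo : Finset (Fin p) := ∅
  /-- the process index treated at present in that loop -/
  j : Option (Fin p) := none
  pred : Ptr := none
  succ : Ptr := none
  res : Result := .notPresent

/-- A configuration: the shared memory and the local states of all processes. -/
structure Config (Item : Type*) (p : ℕ) where
  /-- the nodes allocated so far -/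
  heap : Addr → Option (Node Item)
  /-- pointers to the first and to the second node of the list -/
  head : Ptr × Ptr
  /-- the announcement array `A`; the value `none` in the second component is `⊥` -/
  ann : Fin p → Ptr × Option Item
  /-- `none` if the process is not performing `SEARCH` -/
  proc : Fin p → Option (Loc Item p)

variable {Item : Type*} {p : ℕ}

/-- Process `i` continues with local state `l`. -/
def Config.setLoc (s : Config Item p) (i : Fin p) (l : Loc Item p) : Config Item p :=
  { s with proc := Function.update s.proc i (some l) }

/-- Process `i` is no longer performing an operation. -/
def Config.setIdle (s : Config Item p) (i : Fin p) : Config Item p :=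
  { s with proc := Function.update s.proc i none }

/-- Store node `v` at address `x`. -/
def Config.setNode (s : Config Item p) (x : Addr) (v : Node Item) : Config Item p :=
  { s with heap := Function.update s.heap x (some v) }

/-- `CAS(Head, exp, val)`. -/
def Config.casHead (s : Config Item p) (exp val : Ptr × Ptr) : Config Item p :=
  if s.head = exp then { s with head := val } else s

/-- `CAS(A[j], exp, val)`. -/
def Config.casAnn [DecidableEq Item] (s : Config Item p) (j : Fin p)
    (exp val : Ptr × Option Item) : Config Item p :=
  if s.ann j = exp then { s with ann := Function.update s.ann j val } else s

/-- `CAS(x.next, exp, val)`, where `v` is the node at address `x`; similarly below. -/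
def Config.casNext (s : Config Item p) (x : Addr) (v : Node Item) (exp val : Ptr) :
    Config Item p :=
  if v.next = exp then s.setNode x { v with next := val } else s

def Config.casPrev (s : Config Item p) (x : Addr) (v : Node Item) (exp val : Ptr) :
    Config Item p :=
  if v.prev = exp then s.setNode x { v with prev := val } else s

def Config.casOld (s : Config Item p) (x : Addr) (v : Node Item) (exp val : Link) :
    Config Item p :=
  if v.old = exp then s.setNode x { v with old := val } else s

def Config.casNew (s : Config Item p) (x : Addr) (v : Node Item) (exp val : Link) :
    Config Item p :=
  if v.new = exp then s.setNode x { v with new := val } else s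

/-- Process `i` is performing an operation, has local state `l` and is at position `q`. -/
def Config.At (s : Config Item p) (i : Fin p) (l : Loc Item p) (q : PC) : Prop :=
  s.proc i = some l ∧ l.pc = q

/-- `a` points to the node `v`, stored at address `x`. -/
def Config.Pts (s : Config Item p) (a : Ptr) (x : Addr) (v : Node Item) : Prop :=
  a = some x ∧ s.heap x = some v

/-- `a` is a pointer to a node that contains the item `e`. -/
def Config.Contains (s : Config Item p) (a : Ptr) (e : Item) : Prop :=
  ∃ x v, s.Pts a x v ∧ v.item = e

/-- Labels of steps: process `i` invokes `SEARCH(e)`, takes a step inside `SEARCH`, or returns. -/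
inductive Label (Item : Type*) (p : ℕ) where
  | inv (i : Fin p) (e : Item)
  | tau (i : Fin p)
  | ret (i : Fin p) (r : Result)

/-- The process that takes the step. -/
def Label.proc : Label Item p → Fin p
  | .inv i _ => i
  | .tau i => i
  | .ret i _ => i

/-- The steps of DMTF, where a process looks at its announcement after every `φ` nodes.
A step that accesses a field of a node through a pointer `a` requires `s.Pts a x v`: a process that
dereferences `NULL` has no step. -/
inductive Step [DecidableEq Item] (φ : ℕ) :
    Config Item p → Label Item p → Config Item p → Prop
  -- SEARCH(e)
  | invoke (s : Config Item p) (i : Fin p) (e : Item) (h : s.proc i = none) :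
      Step φ s (.inv i e) (s.setLoc i { pc := .allocate, e := e })
  /-- `g ← allocate(node); g.item ← e; g.prev ← g.next ← g.old ← g.new ← NULL`: the address is an
  arbitrary one that has never been in use. No other process has a pointer to the new node before
  the announcement, so its initialization is part of the same step. -/
  | allocate (s : Config Item p) (i : Fin p) (l : Loc Item p) (x : Addr)
      (hl : s.At i l .allocate) (hx : s.heap x = none) :
      Step φ s (.tau i) ((s.setNode x ⟨l.e, none, none, .ptr none, .ptr none⟩).setLoc i
        { l with g := some x, pc := .announce })
  /-- `CAS(A[i], (NULL, ⊥), (g, e))` -/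
  | announce (s : Config Item p) (i : Fin p) (l : Loc Item p) (hl : s.At i l .announce) :
      Step φ s (.tau i) ((s.casAnn i (none, none) (l.g, some l.e)).setLoc i
        { l with pc := .getHead })
  /-- `(h₁, h) ← Head` -/
  | getHead (s : Config Item p) (i : Fin p) (l : Loc Item p) (hl : s.At i l .getHead) :
      Step φ s (.tau i) (s.setLoc i { l with h1 := s.head.1, h := s.head.2, pc := .testFront })
  /-- `if h₁.item = e then … else c ← 0` -/
  | testFront (s : Config Item p) (i : Fin p) (l : Loc Item p) (x : Addr) (v : Node Item)
      (hl : s.At i l .testFront) (hx : s.Pts l.h1 x v) :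
      Step φ s (.tau i) (s.setLoc i
        (if v.item = l.e then { l with pc := .unannFront1 } else { l with c := 0, pc := .loop }))
  /-- `(a, b) ← CAS(A[i], (g, e), (NULL, ⊥)); if b = ⊥ then …`:
  CAS returns the value that the object had immediately before. -/
  | unannFront1 (s : Config Item p) (i : Fin p) (l : Loc Item p) (hl : s.At i l .unannFront1) :
      Step φ s (.tau i) ((s.casAnn i (l.g, some l.e) (none, none)).setLoc i
        { l with
          a := (s.ann i).1, b := (s.ann i).2, res := .pointer l.h1
          pc := if (s.ann i).2 = none then .unannFront2 else .ret })
  /-- `CAS(A[i], (a, b), (NULL, ⊥)); return h₁` -/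
  | unannFront2 (s : Config Item p) (i : Fin p) (l : Loc Item p) (hl : s.At i l .unannFront2) :
      Step φ s (.tau i) ((s.casAnn i (l.a, l.b) (none, none)).setLoc i
        { l with res := .pointer l.h1, pc := .ret })
  /-- `while h ≠ NULL do` -/
  | loop (s : Config Item p) (i : Fin p) (l : Loc Item p) (hl : s.At i l .loop) :
      Step φ s (.tau i) (s.setLoc i { l with pc := if l.h = none then .readAnn4 else .testItem })
  /-- `if h.item = e then … else c ← (c + 1) mod φ; if c = 0 then …` -/
  | testItem (s : Config Item p) (i : Fin p) (l : Loc Item p) (x : Addr) (v : Node Item)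
      (hl : s.At i l .testItem) (hx : s.Pts l.h x v) :
      Step φ s (.tau i) (s.setLoc i
        (if v.item = l.e then { l with pc := .readAnn1 }
          else { l with c := (l.c + 1) % φ
                        pc := if (l.c + 1) % φ = 0 then .readAnn3 else .next }))
  /-- `(a, b) ← A[i]; if b = ⊥ then …` -/
  | readAnn1 (s : Config Item p) (i : Fin p) (l : Loc Item p) (hl : s.At i l .readAnn1) :
      Step φ s (.tau i) (s.setLoc i
        { l with
          a := (s.ann i).1, b := (s.ann i).2
          pc := if (s.ann i).2 = none then .unannOther1 else .setOld })
  /-- `CAS(A[i], (a, b), (NULL, ⊥)); return a` -/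
  | unannOther1 (s : Config Item p) (i : Fin p) (l : Loc Item p) (hl : s.At i l .unannOther1) :
      Step φ s (.tau i) ((s.casAnn i (l.a, l.b) (none, none)).setLoc i
        { l with res := .pointer l.a, pc := .ret })
  /-- `CAS(g.old, NULL, h)` -/
  | setOld (s : Config Item p) (i : Fin p) (l : Loc Item p) (x : Addr) (v : Node Item)
      (hl : s.At i l .setOld) (hx : s.Pts l.g x v) :
      Step φ s (.tau i) ((s.casOld x v (.ptr none) (.ptr l.h)).setLoc i { l with pc := .setNew })
  /-- `CAS(h.new, NULL, g)` -/
  | setNew (s : Config Item p) (i : Fin p) (l : Loc Item p) (x : Addr) (v : Node Item)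
      (hl : s.At i l .setNew) (hx : s.Pts l.h x v) :
      Step φ s (.tau i) ((s.casNew x v (.ptr none) (.ptr l.g)).setLoc i { l with pc := .getNew })
  /-- `g' ← h.new`, in the case `g' = GONE` -/
  | getNewGone (s : Config Item p) (i : Fin p) (l : Loc Item p) (x : Addr) (v : Node Item)
      (hl : s.At i l .getNew) (hx : s.Pts l.h x v) (hv : v.new = .GONE) :
      Step φ s (.tau i) (s.setLoc i { l with pc := .readAnn2 })
  /-- `g' ← h.new`, in the case `g' ≠ GONE`, and call of `MOVE-TO-FRONT(g')` -/
  | getNew (s : Config Item p) (i : Fin p) (l : Loc Item p) (x : Addr) (v : Node Item) (a : Ptr)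
      (hl : s.At i l .getNew) (hx : s.Pts l.h x v) (hv : v.new = .ptr a) :
      Step φ s (.tau i) (s.setLoc i { l with g' := a, pc := .outer })
  /-- `(a, b) ← A[i]` -/
  | readAnn2 (s : Config Item p) (i : Fin p) (l : Loc Item p) (hl : s.At i l .readAnn2) :
      Step φ s (.tau i) (s.setLoc i
        { l with a := (s.ann i).1, b := (s.ann i).2, pc := .unannPostMTF })
  /-- `CAS(A[i], (a, b), (NULL, ⊥)); return a` -/
  | unannPostMTF (s : Config Item p) (i : Fin p) (l : Loc Item p) (hl : s.At i l .unannPostMTF) :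
      Step φ s (.tau i) ((s.casAnn i (l.a, l.b) (none, none)).setLoc i
        { l with res := .pointer l.a, pc := .ret })
  /-- `(a, b) ← A[i]; if b = ⊥ then …` -/
  | readAnn3 (s : Config Item p) (i : Fin p) (l : Loc Item p) (hl : s.At i l .readAnn3) :
      Step φ s (.tau i) (s.setLoc i
        { l with
          a := (s.ann i).1, b := (s.ann i).2
          pc := if (s.ann i).2 = none then .unannOther2 else .next })
  /-- `CAS(A[i], (a, b), (NULL, ⊥)); return a` -/
  | unannOther2 (s : Config Item p) (i : Fin p) (l : Loc Item p) (hl : s.At i l .unannOther2) :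
      Step φ s (.tau i) ((s.casAnn i (l.a, l.b) (none, none)).setLoc i
        { l with res := .pointer l.a, pc := .ret })
  /-- `h ← h.next; end while` -/
  | next (s : Config Item p) (i : Fin p) (l : Loc Item p) (x : Addr) (v : Node Item)
      (hl : s.At i l .next) (hx : s.Pts l.h x v) :
      Step φ s (.tau i) (s.setLoc i { l with h := v.next, pc := .loop })
  /-- `(a, b) ← A[i]` -/
  | readAnn4 (s : Config Item p) (i : Fin p) (l : Loc Item p) (hl : s.At i l .readAnn4) :
      Step φ s (.tau i) (s.setLoc i
        { l with a := (s.ann i).1, b := (s.ann i).2, pc := .unannEnd })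
  /-- `CAS(A[i], (a, b), (NULL, ⊥)); if b = ⊥ then return a else return NOT PRESENT` -/
  | unannEnd (s : Config Item p) (i : Fin p) (l : Loc Item p) (hl : s.At i l .unannEnd) :
      Step φ s (.tau i) ((s.casAnn i (l.a, l.b) (none, none)).setLoc i
        { l with res := if l.b = none then .pointer l.a else .notPresent, pc := .ret })
  /-- the operation returns its result -/
  | ret (s : Config Item p) (i : Fin p) (l : Loc Item p) (hl : s.At i l .ret) :
      Step φ s (.ret i l.res) (s.setIdle i)
  -- MOVE-TO-FRONT(g')
  /-- `while g'.old ≠ DONE do` -/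
  | outer (s : Config Item p) (i : Fin p) (l : Loc Item p) (x : Addr) (v : Node Item)
      (hl : s.At i l .outer) (hx : s.Pts l.g' x v) :
      Step φ s (.tau i) (s.setLoc i
        { l with pc := if v.old = .DONE then .readAnn2 else .getHead2 })
  /-- `(h₁, h₂) ← Head` -/
  | getHead2 (s : Config Item p) (i : Fin p) (l : Loc Item p) (hl : s.At i l .getHead2) :
      Step φ s (.tau i) (s.setLoc i { l with k1 := s.head.1, k2 := s.head.2, pc := .getOld })
  /-- `h' ← h₁.old`, in the case `h' = DONE` -/
  | getOldDone (s : Config Item p) (i : Fin p) (l : Loc Item p) (x : Addr) (v : Node Item)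
      (hl : s.At i l .getOld) (hx : s.Pts l.k1 x v) (hv : v.old = .DONE) :
      Step φ s (.tau i) (s.setLoc i { l with pc := .testPrepend })
  /-- `h' ← h₁.old`, in the case `h' ≠ DONE` -/
  | getOld (s : Config Item p) (i : Fin p) (l : Loc Item p) (x : Addr) (v : Node Item) (a : Ptr)
      (hl : s.At i l .getOld) (hx : s.Pts l.k1 x v) (hv : v.old = .ptr a) :
      Step φ s (.tau i) (s.setLoc i { l with h' := a, pc := .setNext })
  /-- `if g'.old ≠ DONE then …` -/
  | testPrepend (s : Config Item p) (i : Fin p) (l : Loc Item p) (x : Addr) (v : Node Item)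
      (hl : s.At i l .testPrepend) (hx : s.Pts l.g' x v) :
      Step φ s (.tau i) (s.setLoc i { l with pc := if v.old = .DONE then .outer else .prepend })
  /-- `CAS(Head, (h₁, h₂), (g', h₁))` -/
  | prepend (s : Config Item p) (i : Fin p) (l : Loc Item p) (hl : s.At i l .prepend) :
      Step φ s (.tau i) ((s.casHead (l.k1, l.k2) (l.g', l.k1)).setLoc i { l with pc := .outer })
  /-- `CAS(h₁.next, NULL, h₂)` -/
  | setNext (s : Config Item p) (i : Fin p) (l : Loc Item p) (x : Addr) (v : Node Item)
      (hl : s.At i l .setNext) (hx : s.Pts l.k1 x v) :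
      Step φ s (.tau i) ((s.casNext x v none l.k2).setLoc i { l with pc := .setPrev })
  /-- `CAS(h₂.prev, NULL, h₁)` -/
  | setPrev (s : Config Item p) (i : Fin p) (l : Loc Item p) (x : Addr) (v : Node Item)
      (hl : s.At i l .setPrev) (hx : s.Pts l.k2 x v) :
      Step φ s (.tau i) ((s.casPrev x v none l.k1).setLoc i { l with pc := .getItem })
  /-- `e' ← h₁.item` -/
  | getItem (s : Config Item p) (i : Fin p) (l : Loc Item p) (x : Addr) (v : Node Item)
      (hl : s.At i l .getItem) (hx : s.Pts l.k1 x v) :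
      Step φ s (.tau i) (s.setLoc i
        { l with e' := v.item, todo := Finset.univ, pc := .readAnn })
  /-- `for every process index j do (a, b) ← A[j]; if b = e' …`: the indices are treated in an
  arbitrary order -/
  | readAnn (s : Config Item p) (i : Fin p) (l : Loc Item p) (j : Fin p)
      (hl : s.At i l .readAnn) (hj : j ∈ l.todo) :
      Step φ s (.tau i) (s.setLoc i
        { l with
          j := some j, todo := l.todo.erase j, a := (s.ann j).1, b := (s.ann j).2
          pc := if (s.ann j).2 = some l.e' then .testInform else .readAnn })
  /-- `… and h₁.old ≠ DONE then …` -/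
  | testInform (s : Config Item p) (i : Fin p) (l : Loc Item p) (x : Addr) (v : Node Item)
      (hl : s.At i l .testInform) (hx : s.Pts l.k1 x v) :
      Step φ s (.tau i) (s.setLoc i { l with pc := if v.old = .DONE then .readAnn else .inform })
  /-- `CAS(A[j], (a, b), (h₁, ⊥))` -/
  | inform (s : Config Item p) (i : Fin p) (l : Loc Item p) (j : Fin p)
      (hl : s.At i l .inform) (hj : l.j = some j) :
      Step φ s (.tau i) ((s.casAnn j (l.a, l.b) (l.k1, none)).setLoc i { l with pc := .readAnn })
  /-- end of the loop over all process indices -/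
  | informed (s : Config Item p) (i : Fin p) (l : Loc Item p)
      (hl : s.At i l .readAnn) (hj : l.todo = ∅) :
      Step φ s (.tau i) (s.setLoc i { l with pc := .getPrev })
  /-- `pred ← h'.prev` -/
  | getPrev (s : Config Item p) (i : Fin p) (l : Loc Item p) (x : Addr) (v : Node Item)
      (hl : s.At i l .getPrev) (hx : s.Pts l.h' x v) :
      Step φ s (.tau i) (s.setLoc i { l with pred := v.prev, pc := .getNext })
  /-- `succ ← h'.next` -/
  | getNext (s : Config Item p) (i : Fin p) (l : Loc Item p) (x : Addr) (v : Node Item)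
      (hl : s.At i l .getNext) (hx : s.Pts l.h' x v) :
      Step φ s (.tau i) (s.setLoc i { l with succ := v.next, pc := .remove1 })
  /-- `CAS(pred.next, h', succ)` -/
  | remove1 (s : Config Item p) (i : Fin p) (l : Loc Item p) (x : Addr) (v : Node Item)
      (hl : s.At i l .remove1) (hx : s.Pts l.pred x v) :
      Step φ s (.tau i) ((s.casNext x v l.h' l.succ).setLoc i { l with pc := .remove2 })
  /-- `if succ ≠ NULL …`, in the case `succ = NULL` -/
  | remove2Null (s : Config Item p) (i : Fin p) (l : Loc Item p)
      (hl : s.At i l .remove2) (hx : l.succ = none) :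
      Step φ s (.tau i) (s.setLoc i { l with pc := .gone })
  /-- `if succ ≠ NULL then CAS(succ.prev, h', pred)` -/
  | remove2 (s : Config Item p) (i : Fin p) (l : Loc Item p) (x : Addr) (v : Node Item)
      (hl : s.At i l .remove2) (hx : s.Pts l.succ x v) :
      Step φ s (.tau i) ((s.casPrev x v l.h' l.pred).setLoc i { l with pc := .gone })
  /-- `CAS(h'.new, h₁, GONE)` -/
  | gone (s : Config Item p) (i : Fin p) (l : Loc Item p) (x : Addr) (v : Node Item)
      (hl : s.At i l .gone) (hx : s.Pts l.h' x v) :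
      Step φ s (.tau i) ((s.casNew x v (.ptr l.k1) .GONE).setLoc i { l with pc := .done })
  /-- `CAS(h₁.old, h', DONE); end while` -/
  | done (s : Config Item p) (i : Fin p) (l : Loc Item p) (x : Addr) (v : Node Item)
      (hl : s.At i l .done) (hx : s.Pts l.k1 x v) :
      Step φ s (.tau i) ((s.casOld x v (.ptr l.h') .DONE).setLoc i { l with pc := .outer })

/-- Initial configurations: the list has one node for each member of `items`, in this order, no
other node is allocated, nothing is announced and no process is performing an operation. -/
def IsInit (items : List Item) (s : Config Item p) : Prop :=
  (∃ addrs : List Addr, addrs.Nodup ∧ addrs.length = items.length ∧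
    (∀ t x e, addrs[t]? = some x → items[t]? = some e →
      s.heap x = some
        { item := e
          next := addrs[t + 1]?
          prev := if t = 0 then none else addrs[t - 1]?
          old := .DONE
          new := .ptr none }) ∧
    (∀ x, x ∉ addrs → s.heap x = none) ∧
    s.head = (addrs[0]?, addrs[1]?)) ∧
  (∀ i, s.ann i = (none, none)) ∧
  (∀ i, s.proc i = none)

/-- Finite and infinite executions of DMTF by `p` processes: step number `k < len` leads from
configuration `cfg k` to configuration `cfg (k + 1)`. The values of `cfg` and `lab` beyond the length
of a finite execution are irrelevant. -/
structure Execution [DecidableEq Item] (p φ : ℕ) (items : List Item) where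
  len : ℕ∞
  cfg : ℕ → Config Item p
  lab : ℕ → Label Item p
  init : IsInit items (cfg 0)
  step : ∀ k : ℕ, (k : ℕ∞) < len → Step φ (cfg k) (lab k) (cfg (k + 1))

section

variable [DecidableEq Item] {φ : ℕ} {items : List Item}

/-- Step `k` is the invocation of `SEARCH(e)` by process `i`. The number `k` of its first step
identifies an operation. -/
def Execution.Invokes (X : Execution p φ items) (k : ℕ) (i : Fin p) (e : Item) : Prop :=
  (k : ℕ∞) < X.len ∧ X.lab k = .inv i e

/-- The operation invoked at step `k` is completed: it returns `r` at step `m`. -/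
def Execution.Returns (X : Execution p φ items) (k m : ℕ) (r : Result) : Prop :=
  ∃ i e, X.Invokes k i e ∧ k < m ∧ (m : ℕ∞) < X.len ∧ X.lab m = .ret i r ∧
    ∀ m' r', k < m' → m' < m → X.lab m' ≠ .ret i r'

/-- The item that the operation invoked at step `k` searches for. -/
def Execution.opItem (X : Execution p φ items) (k : ℕ) : Option Item :=
  match X.lab k with
  | .inv _ e => some e
  | _ => none

/-- Sequential specification, new state: `SEARCH(e)` moves `e` to the front of the list `L` if it
occurs there. -/
def seqState (e : Item) (L : List Item) : List Item :=
  if e ∈ L then e :: L.erase e else L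

/-- Sequential specification, response of `SEARCH(e)` in state `L`: the item found, or `none` for
NOT PRESENT. -/
def seqResponse (e : Item) (L : List Item) : Option Item :=
  if e ∈ L then some e else none

/-- The state after the operations on the items `es`, performed one after the other. -/
def seqRun (L : List Item) (es : List Item) : List Item :=
  es.foldl (fun L' e => seqState e L') L

/-- The result `r`, returned in configuration `s`, is the same as a response of the sequential
specification. -/
def SameResult (s : Config Item p) : Result → Option Item → Prop
  | .pointer a, some e => s.Contains a e
  | .notPresent, none => True
  | _, _ => False

/-- `pt` is a correct assignment of linearization points to the operations in `ops`.
The point `(t, c)` means: at the `c`-th instant of the time during which `cfg t` is the current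
configuration (so several points may lie between two consecutive steps). -/
structure Execution.IsLinearization (X : Execution p φ items) (ops : Set ℕ)
    (pt : ℕ → ℕ ×ₗ ℕ) : Prop where
  /-- only operations are linearized -/
  isOp : ∀ k ∈ ops, ∃ i e, X.Invokes k i e
  /-- every completed operation is linearized -/
  complete : ∀ k m r, X.Returns k m r → k ∈ ops
  /-- the points are distinct -/
  distinct : Set.InjOn pt ops
  /-- the points lie within the execution -/
  within : ∀ k ∈ ops, ((ofLex (pt k)).1 : ℕ∞) ≤ X.len
  /-- each operation is linearized after its invocation -/
  after : ∀ k ∈ ops, k < (ofLex (pt k)).1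
  /-- each completed operation is linearized before its return step -/
  before : ∀ k m r, X.Returns k m r → (ofLex (pt k)).1 ≤ m
  /-- the result of each completed operation is the one that it has if the linearized operations
  are performed sequentially in the order of their points; `prior` lists the earlier ones -/
  legal : ∀ k m i e r, X.Invokes k i e → X.Returns k m r →
    ∃ prior : List ℕ, prior.Pairwise (fun a b => pt a < pt b) ∧
      (∀ a, a ∈ prior ↔ a ∈ ops ∧ pt a < pt k) ∧
      SameResult (X.cfg m) r (seqResponse e (seqRun items (prior.filterMap X.opItem)))

end

end DMTF

/-! A search for an item of $S$ returns either the front node that it read itself or the node that a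
helper wrote into its announcement. Both were at the front at some moment of the search. The answer
of the sequential list depends only on membership, which never changes, so such a moment is a legal
linearization point. Completed searches for other items are placed right after their invocation,
incomplete ones are left out, and ties are broken by operation number. What has to be shown is that
a search for $e\in S$ that does not see $e$ at the front has been informed before it returns.

Each node that enters the list gets a ghost rank, which grows with the time of prepending and never
changes afterwards; `next` pointers decrease it. A node is protected (`View.Prot`) if it is the
newest node with its item, or if the front node is replacing it and some uninformed search for its
item is running. The central invariant is `noskip`: no `next` pointer of a node that ever was in the
list, removed or not, jumps over a protected node; only the `next` of a front node just prepended
may still be `NULL`. Hence an uninformed traversal always has a protected node with $e$ at its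
position or ahead (`trav`). It cannot reach the end, and the node with $e$ that it meets is the
protected one (`View.Glob.eq_of_prot`). When it then sees GONE there, or DONE in the replacement,
protection has ended, so it has been informed.

Protection does not end too early. When $g$ with $g.old=v$ is prepended, $v$ stays protected for the
running searches for its item. Helpers unlink $v$, mark it GONE and set $g.old$ to DONE only after
going through all announcements (`informing`, `allInformed`); a search that reads $Head$ in the
meantime sees its item at the front and needs no protection. Late helpers do no harm: the announced
node is fresh for each search, so a successful CAS on an announcement concerns the very search that
was running when $h_1.old\ne\mathrm{DONE}$ was tested, and at that test $h_1$ was at the front.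
Likewise no node comes to the front twice, so the CAS on $Head$ cannot be deceived.

Exact double linking is not needed: `prev` only has to lead to a node that was in the list, since
redirecting any pointer from an unprotected node to its successor preserves `noskip`. A successor
read earlier remains suitable, because no node already in the list becomes protected again.

The argument is of rely-guarantee type. `View.Glob` concerns the shared memory, `View.Local` one
process, and `View.Evolves` is what the other processes may rely on during a step;
`View.Local.evolve` and `Inv.step` combine them. The local invariants also exclude dereferencing
`NULL`. A search for an absent item ends because the rank of its current node decreases, and nodes
prepended later do not affect that rank. -/

namespace DMTF

/-! ### Ghost ranks, protected nodes and the shared-memory invariant -/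

variable {Item : Type*} {p : ℕ}

/-- What the invariant says about a configuration is expressed through these data: the fields of
the nodes as functions of their addresses (`item x = none` if `x` is not allocated), `Head`, the
announcements, and
* `seeks i e`: process `i` searches for `e`, did not find it at the front, and has not been informed;
* `priv x`: the node `x` is allocated but not yet announced;
* `rank x`: `0` if `x` has never been in the list, otherwise larger the later `x` was prepended. -/
@[ext]
structure View (Item : Type*) (p : ℕ) where
  item : Addr → Option Item
  next : Addr → Ptr
  prev : Addr → Ptr
  old : Addr → Link
  new : Addr → Link
  head : Ptr × Ptr
  ann : Fin p → Ptr × Option Item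
  seeks : Fin p → Item → Prop
  priv : Addr → Prop
  rank : Addr → ℕ

/-- The view of a configuration, given the ranks of the nodes. -/
def Config.view (s : Config Item p) (ρ : Addr → ℕ) : View Item p where
  item x := (s.heap x).map Node.item
  next x := (s.heap x).bind Node.next
  prev x := (s.heap x).bind Node.prev
  old x := (s.heap x).elim (.ptr none) Node.old
  new x := (s.heap x).elim (.ptr none) Node.new
  head := s.head
  ann := s.ann
  -- Since `h1` is set when `Head` is read, a process starts to seek at that step and not at its
  -- announcement; if it is informed between the two, it never seeks.
  seeks i e := ∃ l a, s.proc i = some l ∧ l.e = e ∧ l.h1 = some a ∧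
    (s.heap a).map Node.item ≠ some e ∧ (s.ann i).2 = some e
  priv x := ∃ i l, s.proc i = some l ∧ l.pc = .announce ∧ l.g = some x
  rank := ρ

/-- `w` is the node that contained the item of `x` when `x` was prepended. -/
def View.PrevOcc (V : View Item p) (w x : Addr) : Prop :=
  0 < V.rank w ∧ V.item w = V.item x ∧ V.rank w < V.rank x ∧
    ∀ z, V.item z = V.item x → V.rank z < V.rank x → V.rank z ≤ V.rank w

/-- A traversal must not miss `w`: it is the newest node with its item, or it is being replaced and
some process that searches for its item has not been informed. -/
def View.Prot (V : View Item p) (w : Addr) : Prop :=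
  0 < V.rank w ∧ ((∀ z, V.item z = V.item w → V.rank z ≤ V.rank w) ∨
    ∃ a e i, V.head.1 = some a ∧ V.old a = .ptr (some w) ∧ V.item w = some e ∧ V.seeks i e)

/-- The invariant about the shared memory. -/
structure View.Glob (V : View Item p) (items : List Item) : Prop where
  inj : ∀ x y, 0 < V.rank x → V.rank x = V.rank y → x = y
  itm : ∀ x, 0 < V.rank x → ∃ e ∈ items, V.item x = some e
  cov : ∀ e ∈ items, ∃ x, 0 < V.rank x ∧ V.item x = some e
  hd : ∃ a b, V.head = (some a, some b) ∧ 0 < V.rank b ∧ V.rank b < V.rank a ∧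
    V.item a ≠ V.item b ∧ ∀ z, z ≠ a → V.rank z ≤ V.rank b
  old : ∀ x, 0 < V.rank x → V.old x = .mark ∨ V.head.1 = some x ∧
    ∃ w, V.old x = .ptr (some w) ∧ V.PrevOcc w x ∧ (V.new w = .ptr (some x) ∨ V.new w = .mark)
  nxt : ∀ x y, 0 < V.rank x → V.next x = some y → 0 < V.rank y ∧ V.rank y < V.rank x
  -- This includes nodes already removed, on which a slow traversal may still stand. The exception
  -- is a front node whose `next` no helper has set yet; traversals start at the second node and
  -- never meet it.
  noskip : ∀ x w, 0 < V.rank x → V.Prot w → V.rank w < V.rank x →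
    (∃ y, V.next x = some y ∧ V.rank w ≤ V.rank y) ∨
      (V.head.1 = some x ∧ V.old x ≠ .mark ∧ V.next x = none)
  prv : ∀ x y, 0 < V.rank x → V.prev x = some y → 0 < V.rank y
  -- Only the front node, and the second one until the replacement is DONE, may lack `prev`. A node
  -- about to be removed is neither, so its `pred` can be dereferenced.
  prvSome : ∀ x, 0 < V.rank x → V.head.1 ≠ some x →
    (V.head.2 = some x → ∀ a, V.head.1 = some a → V.old a = .mark) → V.prev x ≠ none
  newPtr : ∀ x g, 0 < V.rank x → V.new x = .ptr (some g) →
    V.item g = V.item x ∧ V.head.1 ≠ some x ∧ (0 < V.rank g → V.rank x < V.rank g) ∧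
      (V.rank g = 0 → V.old g = .ptr (some x))
  newLater : ∀ x z, 0 < V.rank x → V.rank x < V.rank z → V.item z = V.item x →
    V.new x ≠ .ptr none ∧ ∀ g, V.new x = .ptr (some g) → 0 < V.rank g
  newGone : ∀ x, V.new x = .mark → ¬ V.Prot x
  fresh : ∀ x, V.rank x = 0 → V.next x = none ∧ V.prev x = none ∧ V.new x = .ptr none
  annAlloc : ∀ j x, (V.ann j).1 = some x → V.item x ≠ none ∧ ¬ V.priv x

/-! ### Classes of program positions -/

namespace PC

/-- The process has not announced its search, or has withdrawn the announcement. -/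
def quiet : PC → Bool
  | .allocate | .announce | .ret => true
  | _ => false

/-- `Head` has not been read yet. -/
def early : PC → Bool
  | .allocate | .announce | .getHead => true
  | _ => false

/-- The node `g` has been allocated and no process can reach it from the list. -/
def unlinked : PC → Bool
  | .announce | .getHead | .testFront | .unannFront1 | .unannFront2 | .loop | .testItem
  | .readAnn1 | .setOld | .setNew | .readAnn3 | .next | .readAnn4 => true
  | _ => false

/-- Moreover, `g.old` has not been set. -/
def oldNull : PC → Bool
  | .setNew => false
  | q => q.unlinked

/-- The item was found at the front. -/
def front : PC → Bool
  | .unannFront1 | .unannFront2 => true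
  | _ => false

/-- Positions in `MOVE-TO-FRONT`. -/
def moving : PC → Bool
  | .outer | .getHead2 | .getOld | .testPrepend | .prepend | .setNext | .setPrev | .getItem
  | .readAnn | .testInform | .inform | .getPrev | .getNext | .remove1 | .remove2 | .gone
  | .done => true
  | _ => false

/-- `h` contains the item. -/
def found : PC → Bool
  | .readAnn1 | .setOld | .setNew | .getNew => true
  | q => q.moving

/-- `h` does not contain the item. -/
def notFound : PC → Bool
  | .readAnn3 | .next => true
  | _ => false

/-- The item was not found at the front, and the search goes on. -/
def searching : PC → Bool
  | .loop | .testItem | .readAnn4 => true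
  | q => q.found || q.notFound

/-- `h` is not `NULL`. -/
def onNode : PC → Bool
  | .testItem => true
  | q => q.found || q.notFound

/-- `Head` has been read in `MOVE-TO-FRONT`. -/
def gotHead : PC → Bool
  | .outer | .getHead2 => false
  | q => q.moving

/-- The front node is prepended but its predecessor was seen not to be removed. -/
def helping : PC → Bool
  | .setNext | .setPrev | .getItem | .readAnn | .testInform | .inform | .getPrev | .getNext
  | .remove1 | .remove2 | .gone | .done => true
  | _ => false

/-- `next` of the front node has been set. -/
def nextSet : PC → Bool
  | .setNext => false
  | q => q.helping

/-- `prev` of the second node has been set. -/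
def prevSet : PC → Bool
  | .setNext | .setPrev => false
  | q => q.helping

/-- Positions in the loop that informs all processes. -/
def informing : PC → Bool
  | .readAnn | .testInform | .inform => true
  | _ => false

/-- The announcement of some process has been read in this loop. -/
def informingOne : PC → Bool
  | .testInform | .inform => true
  | _ => false

/-- All processes have been informed. -/
def allInformed : PC → Bool
  | .getPrev | .getNext | .remove1 | .remove2 | .gone | .done => true
  | _ => false

/-- `pred` has been read. -/
def gotPrev : PC → Bool
  | .getNext | .remove1 | .remove2 => true
  | _ => false

/-- `succ` has been read. -/
def gotNext : PC → Bool
  | .remove1 | .remove2 => true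
  | _ => false

/-- The process has been informed and is about to withdraw its announcement. -/
def withdrawing : PC → Bool
  | .unannFront2 | .unannOther1 | .unannOther2 | .unannPostMTF => true
  | _ => false

end PC

/-! ### Local invariants and their stability under interference -/

/-- The invariant about the local state `l` of process `i`. The addresses in `seen j` were at the
front of the list at some time during the current operation of process `j`. -/
structure View.Local (V : View Item p) (items : List Item) (seen : Fin p → Addr → Prop)
    (i : Fin p) (l : Loc Item p) : Prop where
  gItem : ∀ x, l.g = some x → V.item x = some l.e
  gSome : l.pc ≠ .allocate → l.g ≠ none
  h1Mem : ∀ x, l.h1 = some x → 0 < V.rank x ∧ seen i x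
  hMem : ∀ x, l.h = some x → 0 < V.rank x ∧ V.head.1 ≠ some x
  quiet : l.pc.quiet → V.ann i = (none, none)
  announced : l.pc.quiet = false → V.ann i = (l.g, some l.e) ∨
    ∃ x, V.ann i = (some x, none) ∧ seen i x ∧ V.item x = some l.e ∧ 0 < V.rank x
  unlinked : l.pc.unlinked → ∀ x, l.g = some x →
    V.rank x = 0 ∧ ∀ y, 0 < V.rank y → V.new y ≠ .ptr (some x)
  gOld : l.pc.oldNull → ∀ x, l.g = some x → V.old x = .ptr none
  setNew : l.pc = .setNew → ∀ x, l.g = some x → V.old x = .ptr l.h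
  early : l.pc.early → l.h1 = none
  testFront : l.pc = .testFront → l.h1 ≠ none
  front : l.pc.front → ∃ a, l.h1 = some a ∧ V.item a = some l.e
  searching : l.pc.searching → ∃ a, l.h1 = some a ∧ V.item a ≠ some l.e
  onNode : l.pc.onNode → l.h ≠ none
  found : l.pc.found → ∀ x, l.h = some x → V.item x = some l.e
  notFound : l.pc.notFound → ∀ x, l.h = some x → V.item x ≠ some l.e
  -- The witness `v` lies at or after the current node, so the traversal of an uninformed search
  -- cannot be at its end.
  trav : V.seeks i l.e → l.e ∈ items → ∃ x v, l.h = some x ∧ V.Prot v ∧ V.item v = some l.e ∧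
    V.head.1 ≠ some v ∧ V.rank v ≤ V.rank x
  getNew : l.pc = .getNew → ∀ x, l.h = some x → V.new x ≠ .ptr none
  moving : l.pc.moving → ∃ x y, l.h = some x ∧ l.g' = some y ∧ V.item y ≠ none ∧
    (V.new x = .ptr (some y) ∨ V.new x = .mark ∧ 0 < V.rank y)
  gotHead : l.pc.gotHead → ∃ x y, l.k1 = some x ∧ l.k2 = some y ∧ 0 < V.rank y ∧
    V.rank y < V.rank x ∧ ∀ z, V.rank z < V.rank x → V.rank z ≤ V.rank y
  oldDone : l.pc = .testPrepend ∨ l.pc = .prepend → ∀ x, l.k1 = some x → V.old x = .mark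
  prepend : l.pc = .prepend → V.head.1 = l.k1 → ∀ y, l.g' = some y → V.rank y = 0
  helping : l.pc.helping → ∃ x w, l.k1 = some x ∧ l.h' = some w ∧ V.PrevOcc w x ∧
    (V.old x = .mark ∨ V.old x = .ptr (some w))
  nextSet : l.pc.nextSet → ∀ x, l.k1 = some x → V.head.1 = some x → V.next x ≠ none
  prevSet : l.pc.prevSet → ∀ y, l.k2 = some y → V.prev y ≠ none
  -- A helper whose front node has been superseded or is DONE has no obligation left; otherwise each
  -- uninformed searcher is still to be treated, or is the one whose announcement was just read and
  -- has not changed since.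
  informing : l.pc.informing → ∀ x, l.k1 = some x → V.item x = some l.e' ∧
    (V.head.1 = some x → V.old x ≠ .mark → ∀ j, V.seeks j l.e' →
      j ∈ l.todo ∨ l.pc ≠ .readAnn ∧ l.j = some j ∧ V.ann j = (l.a, l.b))
  informingOne : l.pc.informingOne → ∃ j, l.j = some j ∧ l.b = some l.e' ∧
    ∀ x, l.a = some x → V.item x ≠ none ∧ ¬ V.priv x
  -- The CAS may come after `k1` has ceased to be the front. It succeeds only for the operation of
  -- `j` that was running when `k1.old` was tested, and this operation has seen `k1` at the front.
  inform : l.pc = .inform → ∀ j x, l.j = some j → V.ann j = (l.a, l.b) → l.k1 = some x → seen j x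
  allInformed : l.pc.allInformed → ∀ x, l.k1 = some x → V.head.1 = some x → V.old x ≠ .mark →
    ∀ j e, V.item x = some e → ¬ V.seeks j e
  gotPrev : l.pc.gotPrev → ∃ y, l.pred = some y ∧ 0 < V.rank y
  gotNext : l.pc.gotNext → ∀ w, l.h' = some w →
    (∀ u, l.succ = some u → 0 < V.rank u ∧ V.rank u < V.rank w) ∧
    ∀ z, V.Prot z → V.rank z < V.rank w → ∃ u, l.succ = some u ∧ V.rank z ≤ V.rank u
  readAnn2 : l.pc = .readAnn2 → (V.ann i).2 = none
  withdrawing : l.pc.withdrawing → V.ann i = (l.a, l.b) ∧ l.b = none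
  unannEnd : l.pc = .unannEnd → V.ann i = (l.a, l.b) ∧ (l.b = none ∨ l.e ∉ items)
  readAnn4 : l.pc = .readAnn4 → l.h = none
  ret : l.pc = .ret → (l.e ∈ items →
      ∃ x, l.res = .pointer (some x) ∧ seen i x ∧ V.item x = some l.e) ∧
    (l.e ∉ items → l.res = .notPresent)

/-- Facts about a step from `V` to `V'` on which the invariants of the processes in `J` rely. -/
structure View.Evolves (V V' : View Item p) (items : List Item) (seen : Fin p → Addr → Prop)
    (proc : Fin p → Option (Loc Item p)) (J : Fin p → Prop) : Prop where
  item : ∀ x, V.item x ≠ none → V'.item x = V.item x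
  rank : ∀ x, V'.rank x = V.rank x ∨
    V.rank x = 0 ∧ V'.head.1 = some x ∧ V.item x ≠ none ∧ ∀ z, V.rank z < V'.rank x
  head : ∀ x, 0 < V.rank x → V'.head.1 = some x → V.head.1 = some x
  old : ∀ x, 0 < V.rank x → V'.old x = V.old x ∨ V'.old x = .mark
  next : ∀ x, 0 < V.rank x → V'.head.1 = some x → V.next x ≠ none → V'.next x ≠ none
  prev : ∀ x, V.prev x ≠ none → V'.prev x ≠ none
  new : ∀ x, 0 < V.rank x → V'.new x = V.new x ∨
    (∃ g, V.new x = .ptr none ∧ V'.new x = .ptr (some g)) ∨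
    (∃ g, V.new x = .ptr (some g) ∧ 0 < V'.rank g ∧ V'.new x = .mark)
  unlinked : ∀ j l x, J j → proc j = some l → l.g = some x → V.rank x = 0 →
    (∀ y, 0 < V.rank y → V.new y ≠ .ptr (some x)) →
    V'.rank x = 0 ∧ (∀ y, 0 < V'.rank y → V'.new y ≠ .ptr (some x)) ∧ V'.old x = V.old x
  prot : ∀ w, 0 < V.rank w → V'.Prot w → V.Prot w
  protSeeks : ∀ j e v, V'.seeks j e → V.seeks j e → V.item v = some e → V.head.1 ≠ some v →
    V.Prot v → V'.Prot v
  seeks : ∀ j e, V'.seeks j e → V.seeks j e ∨ ∃ a, V.head.1 = some a ∧ V.item a ≠ some e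
  seeksOwn : ∀ j e, J j → V'.seeks j e → V.seeks j e
  seeksAnn : ∀ j e, V'.seeks j e → V'.ann j = V.ann j
  ann : ∀ j l, J j → proc j = some l → V'.ann j = V.ann j ∨
    V.ann j = (l.g, some l.e) ∧ l.e ∈ items ∧
      ∃ x, V'.ann j = (some x, none) ∧ seen j x ∧ V'.item x = some l.e ∧ 0 < V'.rank x
  -- An announcement that appears in a step uses a node that was private until then. This excludes
  -- the ABA problem for the CAS of a helper on `A[j]`.
  annSome : ∀ j x e, V'.ann j = (x, some e) →
    V.ann j = (x, some e) ∨ ∃ y, x = some y ∧ V.priv y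
  priv : ∀ x, V'.priv x → V.priv x ∨ V.item x = none

theorem View.Local.gAlloc {V : View Item p} {items : List Item} {seen : Fin p → Addr → Prop}
    {i : Fin p} {l : Loc Item p} (L : V.Local items seen i l) (x : Addr) (hx : l.g = some x) :
    V.item x ≠ none := by
  rw [L.gItem x hx]; simp

/-- As time passes, `seen` persists only for processes that are still in the same operation. The
invariant of `i` uses it only for `i` itself and for processes with a pending announcement, neither
of which is idle. -/
theorem View.Local.of_seen {V : View Item p} {items : List Item} {seen seen' : Fin p → Addr → Prop}
    {i : Fin p} {l : Loc Item p} (L : V.Local items seen i l)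
    (h : ∀ j x, j = i ∨ (V.ann j).2 ≠ none → seen j x → seen' j x) :
    V.Local items seen' i l := by
  obtain ⟨a1,a2,a3,a4,a5,a6,a7,a8,b8,a0,a9,a10,a11,a12,a13,a14,a15,a16,a17,a18,a19,a20,a21,a22,a23,a24,
    a25,a26,a27,a28,a29,a30,a31,a32,a33,a34⟩ := L
  refine ⟨a1,a2,?_,a4,a5,?_,a7,a8,b8,a0,a9,a10,a11,a12,a13,a14,a15,a16,a17,a18,a19,a20,a21,a22,a23,a24,
    a25,?_,a27,a28,a29,a30,a31,a32,a33,?_⟩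
  · grind
  · grind
  · intro hp j x hj ha hk
    obtain ⟨j', h1, h2, -⟩ := a25 (by rw [hp]; rfl)
    exact h j x (.inr (by rw [ha, h2]; simp)) (a26 hp j x hj ha hk)
  · grind

/-- Stability under interference: ranks and items of listed nodes are fixed, listed nodes never
return to the front, and protection is not gained by listed nodes, nor lost while a searcher depends
on it. -/
theorem View.Local.evolve {V V' : View Item p} {items : List Item} {seen : Fin p → Addr → Prop}
    {proc : Fin p → Option (Loc Item p)} {J : Fin p → Prop} {i : Fin p} {l : Loc Item p}
    (G : V.Glob items) (E : V.Evolves V' items seen proc J)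
    (hi : J i) (hl : proc i = some l) (L : V.Local items seen i l) :
    V'.Local items seen i l := by
  have hM : ∀ x, 0 < V.rank x → V'.rank x = V.rank x := by
    intro x hx; rcases E.rank x with h | h <;> omega
  have hM' : ∀ x, 0 < V.rank x → 0 < V'.rank x := fun x hx => by rw [hM x hx]; exact hx
  have hI : ∀ x, 0 < V.rank x → V'.item x = V.item x := by
    intro x hx; obtain ⟨e, -, h⟩ := G.itm x hx; exact E.item x (by simp [h])
  have hIe : ∀ x e, V.item x = some e → V'.item x = some e := by
    intro x e hx; rw [E.item x (by simp [hx])]; exact hx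
  have hPO : ∀ w x, 0 < V.rank x → V.PrevOcc w x → V'.PrevOcc w x := by
    rintro w x hx ⟨h1, h2, h3, h4⟩
    refine ⟨hM' w h1, by rw [hI w h1, hI x hx, h2], by rw [hM w h1, hM x hx]; exact h3, ?_⟩
    intro z hz hr
    rcases E.rank z with h | ⟨h, -, -, h'⟩
    · rcases Nat.eq_zero_or_pos (V.rank z) with h0 | h0
      · omega
      · rw [hI z h0, hI x hx] at hz
        rw [h, hM x hx] at hr
        rw [h, hM w h1]; exact h4 z hz hr
    · have := h' x; rw [hM x hx] at hr; omega
  refine ⟨?_,L.gSome,?_,?_,?_,?_,?_,?_,?_,L.early,L.testFront,?_,?_,L.onNode,?_,?_,?_,?_,?_,?_,?_,?_,?_,?_,?_,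
    ?_,?_,?_,?_,?_,?_,?_,?_,?_,L.readAnn4,?_⟩
  · intro x hx; exact hIe _ _ (L.gItem x hx)
  · intro x hx; have := L.h1Mem x hx; exact ⟨hM' x this.1, this.2⟩
  · intro x hx; have := L.hMem x hx; exact ⟨hM' x this.1, fun h => this.2 (E.head x this.1 h)⟩
  · intro hq
    have := L.quiet hq
    rcases E.ann i l hi hl with h | h
    · rw [h, this]
    · rw [this] at h; simp at h
  · intro hq
    rcases E.ann i l hi hl with h | ⟨-, -, x, h1, h2, h3, h4⟩
    · rw [h]
      rcases L.announced hq with h | ⟨x, h1, h2, h3, h4⟩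
      · exact .inl h
      · exact .inr ⟨x, h1, h2, hIe _ _ h3, hM' x h4⟩
    · exact .inr ⟨x, h1, h2, h3, h4⟩
  · intro hq x hx
    have h := L.unlinked hq x hx
    have := E.unlinked i l x hi hl hx h.1 h.2
    exact ⟨this.1, this.2.1⟩
  · intro hq x hx
    have h := L.unlinked (by revert hq; cases l.pc <;> decide) x hx
    rw [(E.unlinked i l x hi hl hx h.1 h.2).2.2]
    exact L.gOld hq x hx
  · intro hq x hx
    have h := L.unlinked (by rw [hq]; rfl) x hx
    rw [(E.unlinked i l x hi hl hx h.1 h.2).2.2]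
    exact L.setNew hq x hx
  · intro hq; obtain ⟨a, h1, h2⟩ := L.front hq; exact ⟨a, h1, hIe _ _ h2⟩
  · intro hq; obtain ⟨a, h1, h2⟩ := L.searching hq
    exact ⟨a, h1, by rw [hI a (L.h1Mem a h1).1]; exact h2⟩
  · intro hq x hx; exact hIe _ _ (L.found hq x hx)
  · intro hq x hx; rw [hI x (L.hMem x hx).1]; exact L.notFound hq x hx
  · intro hs he
    have hs' := E.seeksOwn i l.e hi hs
    obtain ⟨x, v, h1, h2, h3, h4, h5⟩ := L.trav hs' he
    refine ⟨x, v, h1, E.protSeeks i l.e v hs hs' h3 h4 h2, hIe _ _ h3, fun h => h4 (E.head v h2.1 h), ?_⟩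
    rw [hM v h2.1, hM x (L.hMem x h1).1]; exact h5
  · intro hq x hx
    have := L.getNew hq x hx
    rcases E.new x (L.hMem x hx).1 with h | ⟨g, h, h'⟩ | ⟨g, h, h', h''⟩
    · rwa [h]
    · rw [h']; simp
    · rw [h'']; simp
  · intro hq
    obtain ⟨x, y, h1, h2, h3, h4⟩ := L.moving hq
    refine ⟨x, y, h1, h2, by rw [E.item y h3]; exact h3, ?_⟩
    rcases E.new x (L.hMem x h1).1 with h | ⟨g, h, h'⟩ | ⟨g, h, h', h''⟩
    · rw [h]; rcases h4 with h4 | h4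
      · exact .inl h4
      · exact .inr ⟨h4.1, hM' y h4.2⟩
    · rw [h] at h4; simp at h4
    · rw [h] at h4; simp at h4; subst h4; exact .inr ⟨h'', h'⟩
  · intro hq
    obtain ⟨x, y, h1, h2, h3, h4, h5⟩ := L.gotHead hq
    refine ⟨x, y, h1, h2, hM' y h3, by rw [hM y h3, hM x (by omega)]; exact h4, ?_⟩
    intro z hz
    rw [hM x (by omega)] at hz
    rw [hM y h3]
    rcases E.rank z with h | ⟨h, -, -, h'⟩
    · rw [h] at hz ⊢; exact h5 z hz
    · have := h' x; omega
  · intro hq x hx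
    have := L.oldDone hq x hx
    obtain ⟨x', y, h1, h2, h3, h4, h5⟩ := L.gotHead (by rcases hq with h | h <;> rw [h] <;> rfl)
    rw [hx] at h1; cases h1
    rcases E.old x (by omega) with h | h
    · rw [h]; exact this
    · exact h
  · intro hq hk y hy
    obtain ⟨x, y', h1, h2, h3, h4, h5⟩ := L.gotHead (by rw [hq]; rfl)
    -- A listed node is never put to the front again, so `k1` was at the front before the step as
    -- well.
    have hh := E.head x (by omega) (by rw [hk, h1])
    have := L.prepend hq (by rw [h1, hh]) y hy
    rcases E.rank y with h | ⟨h, h', -⟩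
    · omega
    · rw [hk, h1] at h'; cases h'; omega
  · intro hq
    obtain ⟨x, w, h1, h2, h3, h4⟩ := L.helping hq
    have hx : 0 < V.rank x := by have := h3.2.2.1; omega
    refine ⟨x, w, h1, h2, hPO w x hx h3, ?_⟩
    rcases E.old x hx with h | h
    · rw [h]; exact h4
    · exact .inl h
  · intro hq x hx hh
    obtain ⟨x', w, h1, h2, h3, h4⟩ := L.helping (by revert hq; cases l.pc <;> decide)
    rw [hx] at h1; cases h1
    have hx0 : 0 < V.rank x := by have := h3.2.2.1; omega
    exact E.next x hx0 hh (L.nextSet hq x hx (E.head x hx0 hh))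
  · intro hq y hy; exact E.prev y (L.prevSet hq y hy)
  · intro hq x hx
    obtain ⟨x', w, h1, h2, h3, h4⟩ := L.helping (by revert hq; cases l.pc <;> decide)
    rw [hx] at h1; cases h1
    have hx0 : 0 < V.rank x := by have := h3.2.2.1; omega
    obtain ⟨h5, h6⟩ := L.informing hq x hx
    refine ⟨hIe _ _ h5, fun hh ho j hs => ?_⟩
    have hh' := E.head x hx0 hh
    -- A process that starts to seek in this step has read a front node without its item; here the
    -- front node contains `e'`, so no searcher for `e'` is added.
    have hs' : V.seeks j l.e' := by
      rcases E.seeks j _ hs with h | ⟨a, ha, ha'⟩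
      · exact h
      · rw [hh'] at ha; cases ha; exact absurd h5 ha'
    have ho' : V.old x ≠ .mark := by
      intro h; rcases E.old x hx0 with h' | h'
      · exact ho (h'.trans h)
      · exact ho h'
    rw [E.seeksAnn j _ hs]
    exact h6 hh' ho' j hs'
  · intro hq
    obtain ⟨j, h1, h2, h3⟩ := L.informingOne hq
    refine ⟨j, h1, h2, fun x hx => ?_⟩
    have := h3 x hx
    refine ⟨by rw [E.item x this.1]; exact this.1, fun h => ?_⟩
    rcases E.priv x h with h | h
    · exact this.2 h
    · exact this.1 h
  · intro hq j x hj ha hx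
    obtain ⟨j', h1, h2, h3⟩ := L.informingOne (by rw [hq]; rfl)
    refine L.inform hq j x hj ?_ hx
    -- The pair read earlier cannot reappear: a new announcement has a node that was private, and
    -- `l.a` is not.
    rw [h2] at ha ⊢
    rcases E.annSome j _ _ ha with h | ⟨y, h, h'⟩
    · exact h
    · exact absurd h' (h3 y h).2
  · intro hq x hx hh ho j e he hs
    obtain ⟨x', w, h1, h2, h3, h4⟩ := L.helping (by revert hq; cases l.pc <;> decide)
    rw [hx] at h1; cases h1
    have hx0 : 0 < V.rank x := by have := h3.2.2.1; omega
    have hh' := E.head x hx0 hh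
    have ho' : V.old x ≠ .mark := by
      intro h; rcases E.old x hx0 with h' | h'
      · exact ho (h'.trans h)
      · exact ho h'
    rw [hI x hx0] at he
    refine L.allInformed hq x hx hh' ho' j e he ?_
    rcases E.seeks j _ hs with h | ⟨a, ha, ha'⟩
    · exact h
    · rw [hh'] at ha; cases ha; exact absurd he ha'
  · intro hq; obtain ⟨y, h1, h2⟩ := L.gotPrev hq; exact ⟨y, h1, hM' y h2⟩
  · intro hq w hw
    obtain ⟨x', w', h1, h2, h3, h4⟩ := L.helping (by revert hq; cases l.pc <;> decide)
    rw [hw] at h2; cases h2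
    have hw0 := h3.1
    obtain ⟨h5, h6⟩ := L.gotNext hq w hw
    refine ⟨fun u hu => ?_, fun z hz hr => ?_⟩
    · have := h5 u hu
      exact ⟨hM' u this.1, by rw [hM u this.1, hM w hw0]; exact this.2⟩
    · rw [hM w hw0] at hr
      have hz0 : 0 < V.rank z := by
        rcases E.rank z with h | ⟨h, -, -, h'⟩
        · have := hz.1; omega
        · have := h' w; omega
      rw [hM z hz0] at hr ⊢
      -- The field `next` of `w` may have changed since it was read. The old value still serves,
      -- since every node protected now was protected before.
      obtain ⟨u, hu, hu'⟩ := h6 z (E.prot z hz0 hz) hr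
      exact ⟨u, hu, by rw [hM u (h5 u hu).1]; exact hu'⟩
  · intro hq
    have := L.readAnn2 hq
    rcases E.ann i l hi hl with h | ⟨h, -⟩
    · rw [h]; exact this
    · rw [h] at this; simp at this
  · intro hq
    have := L.withdrawing hq
    rcases E.ann i l hi hl with h | ⟨h, -⟩
    · rw [h]; exact this
    · rw [h] at this; obtain ⟨h1, h2⟩ := this; rw [h2] at h1; simp at h1
  · intro hq
    have := L.unannEnd hq
    rcases E.ann i l hi hl with h | ⟨h, h', -⟩
    · rw [h]; exact this
    · rw [h] at this; obtain ⟨h1, h2 | h2⟩ := this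
      · rw [h2] at h1; simp at h1
      · exact absurd h' h2
  · intro hq
    obtain ⟨h1, h2⟩ := L.ret hq
    refine ⟨fun he => ?_, h2⟩
    obtain ⟨x, hx, hx', hx''⟩ := h1 he
    exact ⟨x, hx, hx', hIe _ _ hx''⟩

/-! ### Effect of each kind of memory update on the shared invariant -/

namespace View

variable {V : View Item p} {items : List Item} {seen : Fin p → Addr → Prop}
  {proc : Fin p → Option (Loc Item p)}

theorem Evolves.mono {V' : View Item p} {J J' : Fin p → Prop} (E : V.Evolves V' items seen proc J)
    (h : ∀ j, J' j → J j) : V.Evolves V' items seen proc J' :=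
  { E with
    unlinked := fun j l x hj => E.unlinked j l x (h j hj)
    seeksOwn := fun j e hj => E.seeksOwn j e (h j hj)
    ann := fun j l hj => E.ann j l (h j hj) }

theorem Glob.rank_le_head (G : V.Glob items) {a : Addr} (ha : V.head.1 = some a) (z : Addr) :
    V.rank z ≤ V.rank a := by
  obtain ⟨a', b, h1, h2, h3, h4, h5⟩ := G.hd
  rw [h1] at ha; cases ha
  rcases eq_or_ne z a with rfl | h
  · exact le_rfl
  · have := h5 z h; omega

theorem Glob.prot_second (G : V.Glob items) {b : Addr} (hb : V.head.2 = some b) : V.Prot b := by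
  obtain ⟨a, b', h1, h2, h3, h4, h5⟩ := G.hd
  rw [h1] at hb; cases hb
  refine ⟨h2, .inl fun z hz => h5 z ?_⟩
  rintro rfl; exact h4 hz

theorem Glob.not_latest {w x : Addr} (h : V.PrevOcc w x) :
    ¬ ∀ z, V.item z = V.item w → V.rank z ≤ V.rank w := by
  intro h'; have := h' x h.2.1.symm; have := h.2.2.1; omega

/-- If the next occurrence of `w` is `x`, then `w` has to be respected only while `x` is at the
front and some process has not been informed. -/
theorem Glob.not_prot (G : V.Glob items) {w x : Addr} (h : V.PrevOcc w x)
    (hx : V.head.1 = some x → V.old x ≠ .mark → ∀ j e, V.item x = some e → ¬ V.seeks j e) :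
    ¬ V.Prot w := by
  rintro ⟨hw, hp | ⟨a, e, i, h1, h2, h3, h4⟩⟩
  · exact Glob.not_latest h hp
  · have ha : 0 < V.rank a := by
      obtain ⟨a', b, h1', h2', h3', -⟩ := G.hd; rw [h1'] at h1; cases h1; omega
    rcases G.old a ha with h5 | ⟨-, w', h5, h6, -⟩
    · rw [h2] at h5; cases h5
    · rw [h2] at h5; cases h5
      -- Both `a` and `x` are the next node after `w` with its item, and such a node is unique.
      have hax : a = x := by
        have hx0 : 0 < V.rank x := by have := h.2.2.1; omega
        rcases lt_trichotomy (V.rank a) (V.rank x) with h7 | h7 | h7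
        · have := h.2.2.2 a (h6.2.1.symm.trans h.2.1) h7; have := h6.2.2.1; omega
        · exact G.inj _ _ ha h7
        · have := h6.2.2.2 x (h.2.1.symm.trans h6.2.1) h7; have := h.2.2.1; omega
      subst hax
      exact hx h1 (by rw [h2]; simp) i e (h6.2.1 ▸ h3) h4

section next

/-- This serves both for linking a new front node and for unlinking a replaced one: all that matters
is that the new pointer goes down in rank and jumps over no protected node. -/
theorem Glob.setNext (G : V.Glob items) {x : Addr} {y : Ptr} (hx : 0 < V.rank x)
    (hy : ∀ u, y = some u → 0 < V.rank u ∧ V.rank u < V.rank x)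
    (hs : ∀ w, V.Prot w → V.rank w < V.rank x → ∃ u, y = some u ∧ V.rank w ≤ V.rank u) :
    ({ V with next := Function.update V.next x y } : View Item p).Glob items := by
  refine { G with nxt := ?_, noskip := ?_, fresh := ?_ }
  · intro z u hz hu
    by_cases h : z = x
    · subst h; simp at hu; exact hy u hu
    · simp [h] at hu; exact G.nxt z u hz hu
  · intro z w hz hw hr
    by_cases h : z = x
    · subst h; left; simpa using hs w hw hr
    · simpa [h] using G.noskip z w hz hw hr
  · intro z hz
    have h : z ≠ x := by rintro rfl; dsimp at hz; omega
    simpa [h] using G.fresh z hz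

theorem Glob.evolves_setNext (G : V.Glob items) {x : Addr} {y : Ptr} (hx : 0 < V.rank x)
    (hs : ∀ w, V.Prot w → V.rank w < V.rank x → ∃ u, y = some u ∧ V.rank w ≤ V.rank u) :
    V.Evolves { V with next := Function.update V.next x y } items seen proc fun _ => True where
  item _ _ := rfl
  rank _ := .inl rfl
  head _ _ h := h
  old _ _ := .inl rfl
  next z hz ha hn := by
    by_cases h : z = x
    · subst h
      obtain ⟨a, b, h1, h2, h3, h4, h5⟩ := G.hd
      dsimp at ha
      rw [h1] at ha; cases ha
      -- The second node is protected and lies below the front, so the new pointer of the front is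
      -- not `NULL`.
      obtain ⟨u, hu, -⟩ := hs b (G.prot_second (by rw [h1])) h3
      simp [hu]
    · simpa [h] using hn
  prev _ h := h
  new _ _ := .inl rfl
  unlinked _ _ _ _ _ _ h h' := ⟨h, h', rfl⟩
  prot _ _ h := h
  protSeeks _ _ _ _ _ _ _ h := h
  seeks _ _ h := .inl h
  seeksOwn _ _ _ h := h
  seeksAnn _ _ _ := rfl
  ann _ _ _ _ := .inl rfl
  annSome _ _ _ h := .inl h
  priv _ h := .inl h

end next

section prev

theorem Glob.setPrev (G : V.Glob items) {x y : Addr} (hx : 0 < V.rank x) (hy : 0 < V.rank y) :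
    ({ V with prev := Function.update V.prev x (some y) } : View Item p).Glob items := by
  refine { G with prv := ?_, prvSome := ?_, fresh := ?_ }
  · intro z u hz hu
    by_cases h : z = x
    · subst h; simp at hu; exact hu ▸ hy
    · simp [h] at hu; exact G.prv z u hz hu
  · intro z hz h1 h2
    by_cases h : z = x
    · subst h; simp
    · simpa [h] using G.prvSome z hz h1 h2
  · intro z hz
    have h : z ≠ x := by rintro rfl; dsimp at hz; omega
    simpa [h] using G.fresh z hz

theorem evolves_setPrev (x y : Addr) :
    V.Evolves { V with prev := Function.update V.prev x (some y) } items seen proc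
      fun _ => True where
  item _ _ := rfl
  rank _ := .inl rfl
  head _ _ h := h
  old _ _ := .inl rfl
  next _ _ _ h := h
  prev z hz := by
    by_cases h : z = x
    · subst h; simp
    · simpa [h] using hz
  new _ _ := .inl rfl
  unlinked _ _ _ _ _ _ h h' := ⟨h, h', rfl⟩
  prot _ _ h := h
  protSeeks _ _ _ _ _ _ _ h := h
  seeks _ _ h := .inl h
  seeksOwn _ _ _ h := h
  seeksAnn _ _ _ := rfl
  ann _ _ _ _ := .inl rfl
  annSome _ _ _ h := .inl h
  priv _ h := .inl h

end prev

section new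

theorem Glob.setNew (G : V.Glob items) {x g : Addr} (hx : 0 < V.rank x) (hn : V.new x = .ptr none)
    (hxh : V.head.1 ≠ some x) (hg : V.rank g = 0) (hi : V.item g = V.item x)
    (ho : V.old g = .ptr (some x)) :
    ({ V with new := Function.update V.new x (.ptr (some g)) } : View Item p).Glob items := by
  refine { G with old := ?_, newPtr := ?_, newLater := ?_, newGone := ?_, fresh := ?_ }
  · intro z hz
    rcases G.old z hz with h | ⟨h1, w, h2, h3, h4⟩
    · exact .inl h
    · refine .inr ⟨h1, w, h2, h3, ?_⟩
      have : w ≠ x := by rintro rfl; rw [hn] at h4; simp at h4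
      simpa [this] using h4
  · intro z g' hz hg'
    by_cases h : z = x
    · subst h; simp at hg'; subst hg'
      exact ⟨hi, hxh, fun h => by dsimp at h; omega, fun _ => ho⟩
    · simp [h] at hg'; exact G.newPtr z g' hz hg'
  · intro z z' hz hr hi'
    have h := G.newLater z z' hz hr hi'
    have : z ≠ x := by rintro rfl; exact h.1 hn
    simpa [this] using h
  · intro z hz
    by_cases h : z = x
    · subst h; simp at hz
    · simp [h] at hz; exact G.newGone z hz
  · intro z hz
    have h : z ≠ x := by rintro rfl; dsimp at hz; omega
    simpa [h] using G.fresh z hz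

/-- After this update `g` can be reached from the list. Only its owner claims that it cannot, and
`hJ` leaves the owner out of `J`. -/
theorem evolves_setNew {x g : Addr} {J : Fin p → Prop} (hx : 0 < V.rank x)
    (hn : V.new x = .ptr none) (hJ : ∀ j l, J j → proc j = some l → l.g ≠ some g) :
    V.Evolves { V with new := Function.update V.new x (.ptr (some g)) } items seen proc J where
  item _ _ := rfl
  rank _ := .inl rfl
  head _ _ h := h
  old _ _ := .inl rfl
  next _ _ _ h := h
  prev _ h := h
  new z hz := by
    by_cases h : z = x
    · subst h; right; left; exact ⟨g, hn, by simp⟩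
    · left; simp [h]
  unlinked j l y hj hl hy h h' := by
    refine ⟨h, fun z hz => ?_, rfl⟩
    by_cases hzx : z = x
    · subst hzx; simp; rintro rfl; exact hJ j l hj hl hy
    · simpa [hzx] using h' z hz
  prot _ _ h := h
  protSeeks _ _ _ _ _ _ _ h := h
  seeks _ _ h := .inl h
  seeksOwn _ _ _ h := h
  seeksAnn _ _ _ := rfl
  ann _ _ _ _ := .inl rfl
  annSome _ _ _ h := .inl h
  priv _ h := .inl h

theorem Glob.setGone (G : V.Glob items) {x : Addr} (hx : 0 < V.rank x) (hp : ¬ V.Prot x) :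
    ({ V with new := Function.update V.new x .mark } : View Item p).Glob items := by
  refine { G with old := ?_, newPtr := ?_, newLater := ?_, newGone := ?_, fresh := ?_ }
  · intro z hz
    rcases G.old z hz with h | ⟨h1, w, h2, h3, h4⟩
    · exact .inl h
    · refine .inr ⟨h1, w, h2, h3, ?_⟩
      by_cases h : w = x
      · subst h; simp
      · simpa [h] using h4
  · intro z g' hz hg'
    by_cases h : z = x
    · subst h; simp at hg'
    · simp [h] at hg'; exact G.newPtr z g' hz hg'
  · intro z z' hz hr hi'
    have h := G.newLater z z' hz hr hi'
    by_cases h' : z = x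
    · subst h'; simp
    · simpa [h'] using h
  · intro z hz
    by_cases h : z = x
    · subst h; exact hp
    · simp [h] at hz; exact G.newGone z hz
  · intro z hz
    have h : z ≠ x := by rintro rfl; dsimp at hz; omega
    simpa [h] using G.fresh z hz

theorem evolves_setGone {x g : Addr} (hg : 0 < V.rank g) (hn : V.new x = .ptr (some g)) :
    V.Evolves { V with new := Function.update V.new x .mark } items seen proc fun _ => True where
  item _ _ := rfl
  rank _ := .inl rfl
  head _ _ h := h
  old _ _ := .inl rfl
  next _ _ _ h := h
  prev _ h := h
  new z hz := by
    by_cases h : z = x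
    · subst h; right; right; exact ⟨g, hn, hg, by simp⟩
    · left; simp [h]
  unlinked j l y hj hl hy h h' := by
    refine ⟨h, fun z hz => ?_, rfl⟩
    by_cases hzx : z = x
    · subst hzx; simp
    · simpa [hzx] using h' z hz
  prot _ _ h := h
  protSeeks _ _ _ _ _ _ _ h := h
  seeks _ _ h := .inl h
  seeksOwn _ _ _ h := h
  seeksAnn _ _ _ := rfl
  ann _ _ _ _ := .inl rfl
  annSome _ _ _ h := .inl h
  priv _ h := .inl h

end new

section old

theorem Glob.head_mem (G : V.Glob items) {a : Addr} (ha : V.head.1 = some a) : 0 < V.rank a := by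
  obtain ⟨a', b, h1, h2, h3, -⟩ := G.hd
  rw [h1] at ha; cases ha; omega

theorem Glob.prot_setOld (G : V.Glob items) {g : Addr} {y : Link} (hg : V.rank g = 0) (w : Addr) :
    ({ V with old := Function.update V.old g y } : View Item p).Prot w ↔ V.Prot w := by
  have : ∀ a, V.head.1 = some a → a ≠ g := by
    rintro a ha rfl; have := G.head_mem ha; omega
  unfold Prot
  dsimp only
  refine and_congr_right fun _ => or_congr_right ?_
  constructor
  · rintro ⟨a, e, i, h1, h2⟩
    rw [Function.update_of_ne (this a h1)] at h2; exact ⟨a, e, i, h1, h2⟩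
  · rintro ⟨a, e, i, h1, h2⟩
    refine ⟨a, e, i, h1, ?_⟩
    rw [Function.update_of_ne (this a h1)]; exact h2

theorem Glob.setOld (G : V.Glob items) {g : Addr} {y : Link} (hg : V.rank g = 0)
    (hn : ∀ x, 0 < V.rank x → V.new x ≠ .ptr (some g)) :
    ({ V with old := Function.update V.old g y } : View Item p).Glob items := by
  have hne : ∀ x, 0 < V.rank x → x ≠ g := by rintro x hx rfl; omega
  refine { G with old := ?_, noskip := ?_, prvSome := ?_, newPtr := ?_, newGone := ?_ }
  · intro z hz
    simpa [hne z hz, PrevOcc] using G.old z hz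
  · intro x w hx hw hr
    simpa [hne x hx] using G.noskip x w hx ((G.prot_setOld hg w).1 hw) hr
  · intro z hz h1 h2
    refine G.prvSome z hz h1 fun h3 a ha => ?_
    simpa [hne a (G.head_mem ha)] using h2 h3 a ha
  · intro x g' hx hg'
    have h : g' ≠ g := by rintro rfl; exact hn x hx hg'
    simpa [h] using G.newPtr x g' hx hg'
  · intro x hx; rw [G.prot_setOld hg x]; exact G.newGone x hx

theorem Glob.evolves_setOld (G : V.Glob items) {g : Addr} {y : Link} {J : Fin p → Prop}
    (hg : V.rank g = 0) (hJ : ∀ j l, J j → proc j = some l → l.g ≠ some g) :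
    V.Evolves { V with old := Function.update V.old g y } items seen proc J where
  item _ _ := rfl
  rank _ := .inl rfl
  head _ _ h := h
  old x hx := by
    have : x ≠ g := by rintro rfl; omega
    left; simp [this]
  next _ _ _ h := h
  prev _ h := h
  new _ _ := .inl rfl
  unlinked j l x hj hl hx h h' := by
    have : x ≠ g := by rintro rfl; exact hJ j l hj hl hx
    exact ⟨h, h', by simp [this]⟩
  prot w _ h := (G.prot_setOld hg w).1 h
  protSeeks _ _ w _ _ _ _ h := (G.prot_setOld hg w).2 h
  seeks _ _ h := .inl h
  seeksOwn _ _ _ h := h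
  seeksAnn _ _ _ := rfl
  ann _ _ _ _ := .inl rfl
  annSome _ _ _ h := .inl h
  priv _ h := .inl h

/-- Setting DONE at the front takes away the second reason for protection altogether and leaves the
first one untouched. -/
theorem prot_of_setDone {x : Addr} (hx : V.head.1 = some x) {w : Addr}
    (h : ({ V with old := Function.update V.old x .mark } : View Item p).Prot w) : V.Prot w := by
  obtain ⟨h0, h | ⟨a, e, i, h1, h2, h3⟩⟩ := h
  · exact ⟨h0, .inl h⟩
  · dsimp only at h1 h2; rw [hx] at h1; cases h1; simp at h2

theorem Glob.setDone (G : V.Glob items) {x : Addr} (hx : V.head.1 = some x)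
    (hn : V.next x ≠ none) (hp : ∀ b, V.head.2 = some b → V.prev b ≠ none) :
    ({ V with old := Function.update V.old x .mark } : View Item p).Glob items := by
  refine { G with old := ?_, noskip := ?_, prvSome := ?_, newPtr := ?_, newGone := ?_ }
  · intro z hz
    by_cases h : z = x
    · subst h; left; simp
    · simpa [h, PrevOcc] using G.old z hz
  · intro z w hz hw hr
    rcases G.noskip z w hz (prot_of_setDone hx hw) hr with h | ⟨h1, h2, h3⟩
    · exact .inl h
    · rw [hx] at h1; cases h1; exact absurd h3 hn
  · intro z hz h1 h2
    by_cases h : V.head.2 = some z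
    · exact hp z h
    · exact G.prvSome z hz h1 fun h3 => absurd h3 h
  · intro y g hy hg
    obtain ⟨h1, h2, h3, h4⟩ := G.newPtr y g hy hg
    refine ⟨h1, h2, h3, fun h => ?_⟩
    have : g ≠ x := by rintro rfl; have := G.head_mem hx; dsimp only at h; omega
    simpa [this] using h4 h
  · intro y hy h; exact G.newGone y hy (prot_of_setDone hx h)

/-- The only node that can lose protection is `x.old`, which has the item of `x`. By `hs` nobody
seeks this item any more, so no traversal depended on it. -/
theorem Glob.evolves_setDone (G : V.Glob items) {x : Addr} (hx : V.head.1 = some x)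
    (hs : V.old x ≠ .mark → ∀ j e, V.item x = some e → ¬ V.seeks j e) :
    V.Evolves { V with old := Function.update V.old x .mark } items seen proc fun _ => True where
  item _ _ := rfl
  rank _ := .inl rfl
  head _ _ h := h
  old y hy := by
    by_cases h : y = x
    · subst h; right; simp
    · left; simp [h]
  next _ _ _ h := h
  prev _ h := h
  new _ _ := .inl rfl
  unlinked j l y _ _ _ h h' := by
    have : y ≠ x := by rintro rfl; have := G.head_mem hx; omega
    exact ⟨h, h', by simp [this]⟩
  prot w _ h := prot_of_setDone hx h
  protSeeks j e v h1 h2 h3 h4 h5 := by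
    obtain ⟨h0, h | ⟨a, e', i, h6, h7, h8, h9⟩⟩ := h5
    · exact ⟨h0, .inl h⟩
    · rw [hx] at h6; cases h6
      rcases G.old x (G.head_mem hx) with h10 | ⟨-, w, h10, h11, -⟩
      · rw [h7] at h10; cases h10
      · rw [h7] at h10; cases h10
        exact absurd h2 (hs (by rw [h7]; simp) j e (h11.2.1 ▸ h3))
  seeks _ _ h := .inl h
  seeksOwn _ _ _ h := h
  seeksAnn _ _ _ := rfl
  ann _ _ _ _ := .inl rfl
  annSome _ _ _ h := .inl h
  priv _ h := .inl h

end old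

section ann

theorem Prot.of_seeks {V' : View Item p} {w : Addr} (hw : V'.Prot w) (h1 : V'.item = V.item)
    (h2 : V'.rank = V.rank) (h3 : V'.head = V.head) (h4 : V'.old = V.old)
    (h5 : ∀ j e, V'.seeks j e → V.seeks j e) : V.Prot w := by
  unfold Prot at *
  rw [h1, h2, h3, h4] at hw
  obtain ⟨h0, h | ⟨a, e, i, h⟩⟩ := hw
  · exact ⟨h0, .inl h⟩
  · exact ⟨h0, .inr ⟨a, e, i, h.1, h.2.1, h.2.2.1, h5 _ _ h.2.2.2⟩⟩

variable {ann' : Fin p → Ptr × Option Item} {seeks' : Fin p → Item → Prop} {priv' : Addr → Prop}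

theorem Glob.setAnn (G : V.Glob items) (hs : ∀ j e, seeks' j e → V.seeks j e)
    (ha : ∀ j x, (ann' j).1 = some x → V.item x ≠ none ∧ ¬ priv' x) :
    ({ V with ann := ann', seeks := seeks', priv := priv' } : View Item p).Glob items :=
  { G with
    noskip := fun x w hx hw => G.noskip x w hx (hw.of_seeks rfl rfl rfl rfl hs)
    newGone := fun x hx hw => G.newGone x hx (hw.of_seeks rfl rfl rfl rfl hs)
    annAlloc := ha }

theorem evolves_setAnn {J : Fin p → Prop} (hs : ∀ j e, seeks' j e → V.seeks j e ∧ ann' j = V.ann j)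
    (hp : ∀ x, priv' x → V.priv x)
    (hJ : ∀ j l, J j → proc j = some l → ann' j = V.ann j ∨
      V.ann j = (l.g, some l.e) ∧ l.e ∈ items ∧
        ∃ x, ann' j = (some x, none) ∧ seen j x ∧ V.item x = some l.e ∧ 0 < V.rank x)
    (ha : ∀ j x e, ann' j = (x, some e) → V.ann j = (x, some e) ∨ ∃ y, x = some y ∧ V.priv y) :
    V.Evolves { V with ann := ann', seeks := seeks', priv := priv' } items seen proc J where
  item _ _ := rfl
  rank _ := .inl rfl
  head _ _ h := h
  old _ _ := .inl rfl
  next _ _ _ h := h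
  prev _ h := h
  new _ _ := .inl rfl
  unlinked _ _ _ _ _ _ h h' := ⟨h, h', rfl⟩
  prot _ _ h := h.of_seeks rfl rfl rfl rfl (fun j e h => (hs j e h).1)
  protSeeks j e v h1 h2 h3 h4 h5 := by
    obtain ⟨h0, h | ⟨a, e', i, h6, h7, h8, h9⟩⟩ := h5
    · exact ⟨h0, .inl h⟩
    -- The searcher `i` that justified the protection may just have been informed or have withdrawn;
    -- `j`, which still seeks the same item, replaces it.
    · exact ⟨h0, .inr ⟨a, e, j, h6, h7, h3, h1⟩⟩
  seeks _ _ h := .inl (hs _ _ h).1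
  seeksOwn _ _ _ h := (hs _ _ h).1
  seeksAnn _ _ h := (hs _ _ h).2
  ann := hJ
  annSome := ha
  priv _ h := .inl (hp _ h)

end ann

section seeks

variable {seeks' : Fin p → Item → Prop}

/-- The node being replaced has the item of the front node, whereas a new searcher has just failed
to find its own item there. So newcomers protect no further node. -/
theorem Glob.prot_of_seek (G : V.Glob items)
    (hs : ∀ j e, seeks' j e → V.seeks j e ∨ ∃ a, V.head.1 = some a ∧ V.item a ≠ some e) {w : Addr}
    (hw : ({ V with seeks := seeks' } : View Item p).Prot w) : V.Prot w := by
  obtain ⟨h0, h | ⟨a, e, i, h1, h2, h3, h4⟩⟩ := hw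
  · exact ⟨h0, .inl h⟩
  · refine ⟨h0, .inr ⟨a, e, i, h1, h2, h3, ?_⟩⟩
    rcases hs i e h4 with h | ⟨a', h5, h6⟩
    · exact h
    · dsimp only at h1 h2 h3
      rw [h1] at h5; cases h5
      rcases G.old a (G.head_mem h1) with h7 | ⟨-, w', h7, h8, -⟩
      · rw [h2] at h7; cases h7
      · rw [h2] at h7; cases h7
        exact absurd (h8.2.1 ▸ h3) h6

theorem Glob.seek (G : V.Glob items)
    (hs : ∀ j e, seeks' j e → V.seeks j e ∨ ∃ a, V.head.1 = some a ∧ V.item a ≠ some e) :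
    ({ V with seeks := seeks' } : View Item p).Glob items :=
  { G with
    noskip := fun x w hx hw => G.noskip x w hx (G.prot_of_seek hs hw)
    newGone := fun x hx hw => G.newGone x hx (G.prot_of_seek hs hw) }

theorem Glob.evolves_seek (G : V.Glob items) {J : Fin p → Prop}
    (hs : ∀ j e, seeks' j e → V.seeks j e ∨ ∃ a, V.head.1 = some a ∧ V.item a ≠ some e)
    (hJ : ∀ j e, J j → seeks' j e → V.seeks j e) :
    V.Evolves { V with seeks := seeks' } items seen proc J where
  item _ _ := rfl
  rank _ := .inl rfl
  head _ _ h := h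
  old _ _ := .inl rfl
  next _ _ _ h := h
  prev _ h := h
  new _ _ := .inl rfl
  unlinked _ _ _ _ _ _ h h' := ⟨h, h', rfl⟩
  prot _ _ h := G.prot_of_seek hs h
  protSeeks j e v h1 h2 h3 h4 h5 := by
    obtain ⟨h0, h | ⟨a, e', i, h6, h7, h8, h9⟩⟩ := h5
    · exact ⟨h0, .inl h⟩
    · exact ⟨h0, .inr ⟨a, e, j, h6, h7, h3, h1⟩⟩
  seeks := hs
  seeksOwn := hJ
  seeksAnn _ _ _ := rfl
  ann _ _ _ _ := .inl rfl
  annSome _ _ _ h := .inl h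
  priv _ h := .inl h

end seeks

section allocate

variable {x : Addr} {e : Item} {priv' : Addr → Prop}

theorem Glob.item_eq_iff (G : V.Glob items) (hx : V.item x = none) {z w : Addr}
    (hz : 0 < V.rank z) (hw : 0 < V.rank w) :
    (Function.update V.item x (some e) z = Function.update V.item x (some e) w ↔
      V.item z = V.item w) := by
  have : ∀ z, 0 < V.rank z → z ≠ x := by
    rintro z hz rfl; obtain ⟨e, -, h⟩ := G.itm z hz; simp [hx] at h
  simp [this z hz, this w hw]

theorem Glob.prot_allocate (G : V.Glob items) (hx : V.item x = none) (w : Addr) :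
    ({ V with item := Function.update V.item x (some e), priv := priv' } : View Item p).Prot w ↔
      V.Prot w := by
  unfold Prot
  refine and_congr_right fun h0 => ?_
  dsimp only at *
  have hwx : w ≠ x := by
    rintro rfl; obtain ⟨e, -, h⟩ := G.itm _ h0; simp [hx] at h
  refine or_congr ⟨fun h z hz => ?_, fun h z hz => ?_⟩ (by simp [hwx])
  · rcases Nat.eq_zero_or_pos (V.rank z) with h1 | h1
    · omega
    · exact h z ((G.item_eq_iff hx h1 h0).2 hz)
  · rcases Nat.eq_zero_or_pos (V.rank z) with h1 | h1
    · omega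
    · exact h z ((G.item_eq_iff hx h1 h0).1 hz)

theorem Glob.allocate (G : V.Glob items) (hx : V.item x = none)
    (hp : ∀ y, priv' y → V.priv y ∨ y = x) :
    ({ V with item := Function.update V.item x (some e), priv := priv' } : View Item p).Glob
      items := by
  have hne : ∀ z, 0 < V.rank z → z ≠ x := by
    rintro z hz rfl; obtain ⟨e, -, h⟩ := G.itm z hz; simp [hx] at h
  refine { G with itm := ?_, cov := ?_, hd := ?_, old := ?_, noskip := ?_, newPtr := ?_,
                  newLater := ?_, newGone := ?_, annAlloc := ?_ }
  · intro z hz; simpa [hne z hz] using G.itm z hz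
  · intro e he
    obtain ⟨z, hz, h⟩ := G.cov e he
    exact ⟨z, hz, by simpa [hne z hz] using h⟩
  · obtain ⟨a, b, h1, h2, h3, h4, h5⟩ := G.hd
    refine ⟨a, b, h1, h2, h3, ?_, h5⟩
    rwa [Ne, G.item_eq_iff hx (by omega) h2]
  · intro z hz
    rcases G.old z hz with h | ⟨h1, w, h2, ⟨h3, h4, h5, h6⟩, h7⟩
    · exact .inl h
    · refine .inr ⟨h1, w, h2, ⟨h3, (G.item_eq_iff hx h3 hz).2 h4, h5, fun u hu hr => ?_⟩, h7⟩
      dsimp only at *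
      rcases Nat.eq_zero_or_pos (V.rank u) with h8 | h8
      · omega
      · exact h6 u ((G.item_eq_iff hx h8 hz).1 hu) hr
  · intro z w hz hw hr
    exact G.noskip z w hz ((G.prot_allocate hx w).1 hw) hr
  · intro z g hz hg
    obtain ⟨h1, h2⟩ := G.newPtr z g hz hg
    refine ⟨?_, h2⟩
    have : g ≠ x := by
      rintro rfl; obtain ⟨e, -, h⟩ := G.itm z hz; rw [hx, h] at h1; cases h1
    simpa [hne z hz, this] using h1
  · intro z z' hz hr hi
    exact G.newLater z z' hz hr ((G.item_eq_iff hx (by dsimp only at hr; omega) hz).1 hi)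
  · intro z hz; rw [G.prot_allocate hx z]; exact G.newGone z hz
  · intro j y hy
    obtain ⟨h1, h2⟩ := G.annAlloc j y hy
    have hyx : y ≠ x := by rintro rfl; exact h1 hx
    refine ⟨by simpa [hyx] using h1, fun h => ?_⟩
    rcases hp y h with h | h
    · exact h2 h
    · exact hyx h

theorem Glob.evolves_allocate (G : V.Glob items) {J : Fin p → Prop} (hx : V.item x = none)
    (hp : ∀ y, priv' y → V.priv y ∨ y = x) :
    V.Evolves { V with item := Function.update V.item x (some e), priv := priv' } items seen proc
      J where
  item y hy := by
    have : y ≠ x := by rintro rfl; exact hy hx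
    simp [this]
  rank _ := .inl rfl
  head _ _ h := h
  old _ _ := .inl rfl
  next _ _ _ h := h
  prev _ h := h
  new _ _ := .inl rfl
  unlinked _ _ _ _ _ _ h h' := ⟨h, h', rfl⟩
  prot w _ h := (G.prot_allocate hx w).1 h
  protSeeks _ _ w _ _ _ _ h := (G.prot_allocate hx w).2 h
  seeks _ _ h := .inl h
  seeksOwn _ _ _ h := h
  seeksAnn _ _ _ := rfl
  ann _ _ _ _ := .inl rfl
  annSome _ _ _ h := .inl h
  priv y h := by
    rcases hp y h with h | rfl
    · exact .inl h
    · exact .inr hx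

end allocate

/-! ### Prepending a node -/

section prepend

variable {a b x g : Addr}

/-- `View` after the node `g` has been prepended. -/
def prepend (V : View Item p) (a g : Addr) : View Item p :=
  { V with head := (some g, some a), rank := Function.update V.rank g (V.rank a + 1) }

/-- A node `x` with `x.new = g`, where `g` has not been prepended, is the newest with its item. -/
theorem Glob.latest_of_new (G : V.Glob items) (hx : 0 < V.rank x) (hg : V.rank g = 0)
    (hn : V.new x = .ptr (some g)) (z : Addr) (hz : V.item z = V.item x) : V.rank z ≤ V.rank x := by
  by_contra h
  have := (G.newLater x z hx (by omega) hz).2 g hn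
  omega

theorem rank_prepend_of_ne {z : Addr} (h : z ≠ g) : (V.prepend a g).rank z = V.rank z := by
  simp [prepend, h]

theorem rank_prepend_self : (V.prepend a g).rank g = V.rank a + 1 := by simp [prepend]

/-- After the step the only node being replaced is `g.old = x`, and `x` was protected before as the
newest node with its item. -/
theorem Glob.prot_of_prepend (G : V.Glob items) (hx : 0 < V.rank x) (hg : V.rank g = 0)
    (hn : V.new x = .ptr (some g)) {w : Addr} (hw : (V.prepend a g).Prot w) :
    w = g ∨ V.Prot w := by
  by_cases hwg : w = g
  · exact .inl hwg
  right
  obtain ⟨h0, h | ⟨a', e, i, h1, h2, h3, h4⟩⟩ := hw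
  · rw [rank_prepend_of_ne hwg] at *
    refine ⟨h0, .inl fun z hz => ?_⟩
    by_cases hzg : z = g
    · subst hzg; omega
    · simpa [rank_prepend_of_ne hzg] using h z hz
  · rw [rank_prepend_of_ne hwg] at h0
    simp only [prepend] at h1 h2
    cases h1
    have h5 := (G.newPtr x g hx hn).2.2.2 hg
    rw [h5] at h2
    cases h2
    exact ⟨h0, .inl (G.latest_of_new hx hg hn)⟩

/-- From `x.new = g` and rank 0 it follows that `g.old = x` and that `x`, which is not the front, is
the newest node with its item. Since `a` is DONE, its `next` is already as required and the
exception in `noskip` can pass from `a` to `g`. -/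
theorem Glob.prepend (G : V.Glob items) (hh : V.head = (some a, some b)) (ho : V.old a = .mark)
    (hx : 0 < V.rank x) (hg : V.rank g = 0) (hn : V.new x = .ptr (some g)) :
    (V.prepend a g).Glob items := by
  obtain ⟨hi, hxa, -, hgo⟩ := G.newPtr x g hx hn
  replace hgo := hgo hg
  have hx1 : x ≠ a := by rintro rfl; exact hxa (by rw [hh])
  obtain ⟨a', b', hd1, hd2, hd3, hd4, hd5⟩ := G.hd
  rw [hh] at hd1; cases hd1
  have hle : ∀ z, V.rank z ≤ V.rank a := G.rank_le_head (by rw [hh])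
  have hxb : V.rank x ≤ V.rank b := hd5 x hx1
  have hlat := G.latest_of_new hx hg hn
  have hne : ∀ z, 0 < V.rank z → z ≠ g := by rintro z hz rfl; omega
  have hr : ∀ z, 0 < V.rank z → (V.prepend a g).rank z = V.rank z :=
    fun z hz => rank_prepend_of_ne (hne z hz)
  have hrg : (V.prepend a g).rank g = V.rank a + 1 := rank_prepend_self
  have hmem : ∀ z, 0 < (V.prepend a g).rank z → z = g ∨ 0 < V.rank z ∧ z ≠ g := by
    intro z hz
    by_cases h : z = g
    · exact .inl h
    · rw [rank_prepend_of_ne h] at hz; exact .inr ⟨hz, h⟩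
  -- Otherwise `a`, which outranks `x`, would have the item of which `x` is the newest node.
  have hiag : V.item g ≠ V.item a := by
    intro h; have := hlat a (h.symm.trans hi); omega
  have hia : a ≠ g := hne a (by omega)
  have hprot : ∀ w, (V.prepend a g).Prot w → w ≠ g → V.Prot w := by
    intro w hw hwg
    exact (G.prot_of_prepend hx hg hn hw).resolve_left hwg
  constructor
  · intro y z hy hyz
    rcases hmem y hy with rfl | ⟨hy0, hyg⟩
    · by_contra h
      rw [hrg, rank_prepend_of_ne (Ne.symm h)] at hyz
      have := hle z; omega
    · rw [hr y hy0] at hyz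
      by_cases hzg : z = g
      · subst hzg; rw [hrg] at hyz; have := hle y; omega
      · rw [rank_prepend_of_ne hzg] at hyz; exact G.inj y z hy0 hyz
  · intro z hz
    rcases hmem z hz with rfl | ⟨hz0, -⟩
    · obtain ⟨e, he, h⟩ := G.itm x hx
      exact ⟨e, he, by rw [← h, ← hi]; rfl⟩
    · exact G.itm z hz0
  · intro e he
    obtain ⟨z, hz, h⟩ := G.cov e he
    exact ⟨z, by rw [hr z hz]; exact hz, h⟩
  · refine ⟨g, a, rfl, by rw [hr a (by omega)]; omega, by rw [hrg, hr a (by omega)]; omega, hiag, ?_⟩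
    intro z hz
    rw [rank_prepend_of_ne hz, hr a (by omega)]; exact hle z
  · intro z hz
    rcases hmem z hz with rfl | ⟨hz0, hzg⟩
    · refine .inr ⟨rfl, x, hgo, ⟨by rw [hr x hx]; exact hx, hi.symm, ?_, ?_⟩, .inl hn⟩
      · rw [hr x hx, hrg]; have := hle x; omega
      · intro u hu hru
        have : u ≠ z := by rintro rfl; omega
        rw [rank_prepend_of_ne this, hr x hx]
        exact hlat u (hu.trans hi)
    · left
      rcases G.old z hz0 with h | ⟨h1, w, h2, -⟩
      · exact h
      · rw [hh] at h1; cases h1; rw [ho] at h2; cases h2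
  · intro z y hz hy
    rcases hmem z hz with rfl | ⟨hz0, hzg⟩
    · have := (G.fresh z hg).1
      simp only [View.prepend] at hy; rw [this] at hy; cases hy
    · have := G.nxt z y hz0 hy
      rw [hr y this.1, hr z hz0]; exact this
  · intro z w hz hw hrk
    rcases hmem z hz with rfl | ⟨hz0, hzg⟩
    · refine .inr ⟨rfl, ?_, (G.fresh z hg).1⟩
      show V.old z ≠ _
      rw [hgo]; simp
    · have hwg : w ≠ g := by
        rintro rfl; rw [hrg, hr z hz0] at hrk; have := hle z; omega
      rw [rank_prepend_of_ne hwg, hr z hz0] at hrk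
      rcases G.noskip z w hz0 (hprot w hw hwg) hrk with ⟨y, h1, h2⟩ | ⟨h1, h2, -⟩
      · refine .inl ⟨y, h1, ?_⟩
        rw [rank_prepend_of_ne hwg, hr y (G.nxt z y hz0 h1).1]; exact h2
      · rw [hh] at h1; cases h1; exact absurd ho h2
  · intro z y hz hy
    rcases hmem z hz with rfl | ⟨hz0, hzg⟩
    · have := (G.fresh z hg).2.1
      simp only [View.prepend] at hy; rw [this] at hy; cases hy
    · have := G.prv z y hz0 hy
      rw [hr y this]; exact this
  · intro z hz h1 h2
    rcases hmem z hz with rfl | ⟨hz0, hzg⟩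
    · exact absurd rfl h1
    · by_cases hza : z = a
      · subst hza
        have := h2 rfl g rfl
        simp only [View.prepend] at this; rw [hgo] at this; cases this
      -- When `a` was DONE, even the second node had `prev`; only the former front `a` may lack it,
      -- and that is the case excused above because `g` is not DONE.
      · refine G.prvSome z hz0 (by rw [hh]; simpa using Ne.symm hza) fun _ c hc => ?_
        rw [hh] at hc; cases hc; exact ho
  · intro z y hz hy
    rcases hmem z hz with rfl | ⟨hz0, hzg⟩
    · have := (G.fresh z hg).2.2
      simp only [View.prepend] at hy; rw [this] at hy; cases hy
    · obtain ⟨h1, h2, h3, h4⟩ := G.newPtr z y hz0 hy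
      refine ⟨h1, fun h => hzg (by cases h; rfl), fun h => ?_, fun h => ?_⟩
      · rw [hr z hz0]
        rcases hmem y h with rfl | ⟨hy0, -⟩
        · rw [hrg]; have := hle z; omega
        · rw [hr y hy0]; exact h3 hy0
      · refine h4 ?_
        by_cases hyg : y = g
        · subst hyg; exact hg
        · rwa [rank_prepend_of_ne hyg] at h
  · intro z u hz hzu hiu
    rcases hmem z hz with rfl | ⟨hz0, hzg⟩
    · by_cases huz : u = z
      · subst huz; omega
      · rw [hrg, rank_prepend_of_ne huz] at hzu; have := hle u; omega
    · by_cases hug : u = g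
      · subst hug
        by_cases hzx : z = x
        · subst hzx
          simp only [View.prepend] at *
          rw [hn]
          refine ⟨by simp, fun g' h => ?_⟩
          cases h; simp
        · have h6 : V.rank z < V.rank x := by
            have := hlat z (hiu.symm.trans hi)
            rcases Nat.lt_or_ge (V.rank z) (V.rank x) with h | h
            · exact h
            · exact absurd (G.inj _ _ hz0 (by omega)) hzx
          have := G.newLater z x hz0 h6 (hi.symm.trans hiu)
          exact ⟨this.1, fun g' h => by have := this.2 g' h; rw [hr g' this]; exact this⟩
      · rw [hr z hz0, rank_prepend_of_ne hug] at hzu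
        have := G.newLater z u hz0 hzu hiu
        exact ⟨this.1, fun g' h => by have := this.2 g' h; rw [hr g' this]; exact this⟩
  · intro z hz hw
    by_cases hzg : z = g
    · subst hzg
      have := (G.fresh z hg).2.2
      simp only [View.prepend] at hz; rw [this] at hz; cases hz
    · exact G.newGone z hz (hprot z hw hzg)
  · intro z hz
    refine G.fresh z ?_
    by_cases hzg : z = g
    · subst hzg; exact hg
    · rwa [rank_prepend_of_ne hzg] at hz
  · exact G.annAlloc

theorem Glob.evolves_prepend (G : V.Glob items) (hh : V.head = (some a, some b))
    (ho : V.old a = .mark) (hx : 0 < V.rank x) (hg : V.rank g = 0) (hn : V.new x = .ptr (some g)) :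
    V.Evolves (V.prepend a g) items seen proc fun _ => True where
  item _ _ := rfl
  rank z := by
    by_cases h : z = g
    · subst h
      refine .inr ⟨hg, rfl, ?_, fun y => ?_⟩
      · obtain ⟨e, -, h⟩ := G.itm x hx
        rw [(G.newPtr x z hx hn).1, h]; simp
      · rw [rank_prepend_self]; have := G.rank_le_head (a := a) (by rw [hh]) y; omega
    · exact .inl (rank_prepend_of_ne h)
  head z hz h := by cases h; omega
  old _ _ := .inl rfl
  next z hz h := by cases h; omega
  prev _ h := h
  new _ _ := .inl rfl
  unlinked j l y _ _ _ h h' := by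
    have hyg : y ≠ g := by rintro rfl; exact h' x hx hn
    refine ⟨by rwa [rank_prepend_of_ne hyg], fun z hz => ?_, rfl⟩
    by_cases hzg : z = g
    · subst hzg
      have := (G.fresh z hg).2.2
      simp [View.prepend, this]
    · rw [rank_prepend_of_ne hzg] at hz; exact h' z hz
  prot w hw h := by
    rcases G.prot_of_prepend hx hg hn h with rfl | h
    · omega
    · exact h
  protSeeks j e v h1 h2 h3 h4 h5 := by
    have hvg : v ≠ g := by rintro rfl; have := h5.1; omega
    refine ⟨by rw [rank_prepend_of_ne hvg]; exact h5.1, ?_⟩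
    by_cases hvx : v = x
    · subst hvx
      -- `x` is no longer the newest node with its item, but it is now the one being replaced and
      -- `j` seeks its item.
      exact .inr ⟨g, e, j, rfl, (G.newPtr v g hx hn).2.2.2 hg, h3, h1⟩
    · obtain ⟨h0, h | ⟨a', e', i, h6, h7, h8, h9⟩⟩ := h5
      · refine .inl fun z hz => ?_
        rw [rank_prepend_of_ne hvg]
        by_cases hzg : z = g
        · subst hzg
          have hi := (G.newPtr x z hx hn).1
          have e1 := h x (hi.symm.trans hz)
          have e2 := G.latest_of_new hx hg hn v (hz.symm.trans hi)
          exact absurd (G.inj v x h0 (by omega)) hvx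
        · rw [rank_prepend_of_ne hzg]; exact h z hz
      · rw [hh] at h6; cases h6; rw [ho] at h7; cases h7
  seeks _ _ h := .inl h
  seeksOwn _ _ _ h := h
  seeksAnn _ _ _ := rfl
  ann _ _ _ _ := .inl rfl
  annSome _ _ _ h := .inl h
  priv _ h := .inl h

end prepend

end View

/-! ### The local invariant along the program positions -/

namespace View

variable {V : View Item p} {items : List Item} {seen : Fin p → Addr → Prop}

theorem Glob.exists_latest (G : V.Glob items) {e : Item} (he : e ∈ items) :
    ∃ v, 0 < V.rank v ∧ V.item v = some e ∧ ∀ z, V.item z = V.item v → V.rank z ≤ V.rank v := by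
  obtain ⟨x, hx, hxe⟩ := G.cov e he
  obtain ⟨a, b, h1, -⟩ := G.hd
  have hb : ∀ z, V.rank z ≤ V.rank a := G.rank_le_head (by rw [h1])
  let P : ℕ → Prop := fun n => ∃ z, V.item z = some e ∧ V.rank z = n
  classical
  obtain ⟨v, hv, hr⟩ : P (Nat.findGreatest P (V.rank a)) :=
    Nat.findGreatest_spec (P := P) (hb x) ⟨x, hxe, rfl⟩
  have hmax : ∀ z, V.item z = some e → V.rank z ≤ V.rank v := fun z hz => by
    rw [hr]; exact Nat.le_findGreatest (hb z) ⟨z, hz, rfl⟩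
  exact ⟨v, lt_of_lt_of_le hx (hmax x hxe), hv, fun z hz => hmax z (hz.trans hv)⟩

/-- Nothing with the same item is newer than `v`, or else only the front node is, because `v` is the
occurrence just before it. -/
theorem Glob.eq_of_prot (G : V.Glob items) {x v : Addr} (hv : V.Prot v)
    (hi : V.item x = V.item v) (hr : V.rank v ≤ V.rank x) (hx : 0 < V.rank x)
    (hh : V.head.1 ≠ some x) : x = v := by
  obtain ⟨h0, h | ⟨a, e, i, h1, h2, h3, h4⟩⟩ := hv
  · exact G.inj _ _ hx (le_antisymm (h x hi) hr)
  · rcases G.old a (G.head_mem h1) with h | ⟨-, w, h, ho, -⟩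
    · rw [h2] at h; cases h
    · rw [h2] at h; cases h
      have : V.rank x < V.rank a := by
        refine lt_of_le_of_ne (G.rank_le_head h1 x) fun h => hh ?_
        rw [h1, G.inj x a hx h]
      exact G.inj _ _ hx (le_antisymm (ho.2.2.2 x (hi.trans ho.2.1) this) hr)

/-- For an uninformed searcher, the node found would be the protected one that `trav` promises.
Reading GONE or DONE refutes protection, and so proves that the process has been informed. -/
theorem Glob.not_seeks_of_gone {i : Fin p} {l : Loc Item p} (G : V.Glob items)
    (L : V.Local items seen i l) (hf : l.pc.found) {x : Addr} (hx : l.h = some x)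
    (h : V.Prot x → False) : ¬ V.seeks i l.e := by
  intro hs
  have hxm := L.hMem x hx
  have hxi := L.found hf x hx
  obtain ⟨e, he, he'⟩ := G.itm x hxm.1
  rw [hxi] at he'; cases he'
  obtain ⟨x', v, h1, h2, h3, h4, h5⟩ := L.trav hs he
  rw [hx] at h1; cases h1
  have := G.eq_of_prot h2 (hxi.trans h3.symm) h5 hxm.1 hxm.2
  subst this
  exact h h2

variable {i : Fin p} {l : Loc Item p}

theorem Local.informed (L : V.Local items seen i l) (hq : l.pc.quiet = false)
    (h : (V.ann i).2 = some l.e → False) : (V.ann i).2 = none := by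
  rcases L.announced hq with h' | ⟨x, h', -⟩
  · rw [h'] at h; simp at h
  · rw [h']

/-- The traversal starts at the second node, above every node except the front. If the item is not
at the front, its newest node is therefore ahead, which establishes `trav`. -/
theorem Local.toTestFront {seeks' : Fin p → Item → Prop} (G : V.Glob items)
    (L : V.Local items seen i l) (hpc : l.pc = .getHead)
    (hs : ∀ a, V.head.1 = some a → seeks' i l.e → V.item a ≠ some l.e)
    (hseen : ∀ a, V.head.1 = some a → seen i a) :
    ({ V with seeks := seeks' } : View Item p).Local items seen i
      { l with h1 := V.head.1, h := V.head.2, pc := .testFront } := by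
  obtain ⟨a, b, h1, h2, h3, h4, h5⟩ := G.hd
  have hg := L.gSome (by simp [hpc])
  cases L
  rw [hpc] at *
  constructor
  -- At a fixed position most guards reduce to `false = true`, and most other fields are inherited.
  -- Only the fields that the move makes relevant remain; the same scheme is used for every move
  -- below.
  all_goals first
    | (intro h; cases h; done) | exact fun _ => hg | (rintro (h | h) <;> cases h; done) | assumption
    | skip
  case h1Mem =>
    intro x hx
    exact ⟨G.head_mem hx, hseen x hx⟩
  case hMem =>
    intro x hx; dsimp only at hx ⊢
    rw [h1] at hx ⊢; cases hx
    refine ⟨h2, fun h => ?_⟩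
    cases h; omega
  case testFront => intro _; dsimp only; rw [h1]; simp
  case trav =>
    intro hs' he
    obtain ⟨v, hv1, hv2, hv3⟩ := G.exists_latest he
    have hva : v ≠ a := by
      rintro rfl; exact hs v (by rw [h1]) hs' hv2
    refine ⟨b, v, by dsimp only; rw [h1], ⟨hv1, .inl hv3⟩, hv2, ?_, h5 v hva⟩
    dsimp only; rw [h1]; intro h; cases h; exact hva rfl

theorem Local.toUnannFront1 (L : V.Local items seen i l) (hpc : l.pc = .testFront)
    (h : ∃ a, l.h1 = some a ∧ V.item a = some l.e) :
    V.Local items seen i { l with pc := .unannFront1 } := by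
  have hg := L.gSome (by simp [hpc])
  cases L
  rw [hpc] at *
  constructor
  all_goals first
    | (intro h; cases h; done) | exact fun _ => hg | (rintro (h | h) <;> cases h; done) | assumption
    | skip
  case front => exact fun _ => h

theorem Local.toLoop_of_testFront (L : V.Local items seen i l) (hpc : l.pc = .testFront)
    (h : ∃ a, l.h1 = some a ∧ V.item a ≠ some l.e) :
    V.Local items seen i { l with c := 0, pc := .loop } := by
  have hg := L.gSome (by simp [hpc])
  cases L
  rw [hpc] at *
  constructor
  all_goals first
    | (intro h; cases h; done) | exact fun _ => hg | (rintro (h | h) <;> cases h; done) | assumption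
    | skip
  case searching => exact fun _ => h

theorem Local.toUnannFront2 {r : Result} (L : V.Local items seen i l) (hpc : l.pc = .unannFront1)
    (h : (V.ann i).2 = none) :
    V.Local items seen i
      { l with a := (V.ann i).1, b := (V.ann i).2, res := r, pc := .unannFront2 } := by
  have hg := L.gSome (by simp [hpc])
  cases L
  rw [hpc] at *
  constructor
  all_goals first
    | (intro h; cases h; done) | exact fun _ => hg | (rintro (h | h) <;> cases h; done) | assumption
    | skip
  case withdrawing => exact fun _ => ⟨rfl, h⟩

theorem Local.toReadAnn4 (L : V.Local items seen i l) (hpc : l.pc = .loop) (h : l.h = none) :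
    V.Local items seen i { l with pc := .readAnn4 } := by
  have hg := L.gSome (by simp [hpc])
  cases L
  rw [hpc] at *
  constructor
  all_goals first
    | (intro h; cases h; done) | exact fun _ => hg | (rintro (h | h) <;> cases h; done) | assumption
    | skip
  case readAnn4 => exact fun _ => h

theorem Local.toTestItem (L : V.Local items seen i l) (hpc : l.pc = .loop) (h : l.h ≠ none) :
    V.Local items seen i { l with pc := .testItem } := by
  have hg := L.gSome (by simp [hpc])
  cases L
  rw [hpc] at *
  constructor
  all_goals first
    | (intro h; cases h; done) | exact fun _ => hg | (rintro (h | h) <;> cases h; done) | assumption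
    | skip
  case onNode => exact fun _ => h

theorem Local.toReadAnn1 (L : V.Local items seen i l) (hpc : l.pc = .testItem)
    (h : ∀ x, l.h = some x → V.item x = some l.e) :
    V.Local items seen i { l with pc := .readAnn1 } := by
  have hg := L.gSome (by simp [hpc])
  cases L
  rw [hpc] at *
  constructor
  all_goals first
    | (intro h; cases h; done) | exact fun _ => hg | (rintro (h | h) <;> cases h; done) | assumption
    | skip
  case found => exact fun _ => h

theorem Local.toReadAnn3 {c : ℕ} (L : V.Local items seen i l) (hpc : l.pc = .testItem)
    (h : ∀ x, l.h = some x → V.item x ≠ some l.e) :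
    V.Local items seen i { l with c := c, pc := .readAnn3 } := by
  have hg := L.gSome (by simp [hpc])
  cases L
  rw [hpc] at *
  constructor
  all_goals first
    | (intro h; cases h; done) | exact fun _ => hg | (rintro (h | h) <;> cases h; done) | assumption
    | skip
  case notFound => exact fun _ => h

theorem Local.toNext_of_testItem {c : ℕ} (L : V.Local items seen i l) (hpc : l.pc = .testItem)
    (h : ∀ x, l.h = some x → V.item x ≠ some l.e) :
    V.Local items seen i { l with c := c, pc := .next } := by
  have hg := L.gSome (by simp [hpc])
  cases L
  rw [hpc] at *
  constructor
  all_goals first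
    | (intro h; cases h; done) | exact fun _ => hg | (rintro (h | h) <;> cases h; done) | assumption
    | skip
  case notFound => exact fun _ => h

theorem Local.toUnannOther1 (L : V.Local items seen i l) (hpc : l.pc = .readAnn1)
    (h : (V.ann i).2 = none) :
    V.Local items seen i
      { l with a := (V.ann i).1, b := (V.ann i).2, pc := .unannOther1 } := by
  have hg := L.gSome (by simp [hpc])
  cases L
  rw [hpc] at *
  constructor
  all_goals first
    | (intro h; cases h; done) | exact fun _ => hg | (rintro (h | h) <;> cases h; done) | assumption
    | skip
  case withdrawing => exact fun _ => ⟨rfl, h⟩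

theorem Local.toSetOld (L : V.Local items seen i l) (hpc : l.pc = .readAnn1) :
    V.Local items seen i
      { l with a := (V.ann i).1, b := (V.ann i).2, pc := .setOld } := by
  have hg := L.gSome (by simp [hpc])
  cases L
  rw [hpc] at *
  constructor
  all_goals first
    | (intro h; cases h; done) | exact fun _ => hg | (rintro (h | h) <;> cases h; done) | assumption

theorem Local.toSetNew {g : Addr} (G : V.Glob items) (L : V.Local items seen i l)
    (hpc : l.pc = .setOld) (hx : l.g = some g) :
    ({ V with old := Function.update V.old g (.ptr l.h) } : View Item p).Local items seen i
      { l with pc := .setNew } := by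
  have hg0 := (L.unlinked (by rw [hpc]; rfl) g hx).1
  have hg := L.gSome (by simp [hpc])
  have L0 := L
  cases L
  rw [hpc] at *
  constructor
  all_goals first
    | (intro h; cases h; done) | exact fun _ => hg | (rintro (h | h) <;> cases h; done) | assumption
    | skip
  case setNew =>
    intro _ x hx'
    dsimp only at hx' ⊢
    rw [hx] at hx'; cases hx'
    simp
  case trav =>
    intro hs he
    obtain ⟨x, v, h1, h2, h3⟩ := L0.trav hs he
    exact ⟨x, v, h1, (G.prot_setOld hg0 v).2 h2, h3⟩

theorem Local.toGetNew (L : V.Local items seen i l) (hpc : l.pc = .setNew)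
    (h : ∀ x, l.h = some x → V.new x ≠ .ptr none) :
    V.Local items seen i { l with pc := .getNew } := by
  have hg := L.gSome (by simp [hpc])
  cases L
  rw [hpc] at *
  constructor
  all_goals first
    | (intro h; cases h; done) | exact fun _ => hg | (rintro (h | h) <;> cases h; done) | assumption
    | skip
  case getNew => exact fun _ => h

theorem Local.toGetNew_of_setNew {x : Addr} {g : Ptr} (L : V.Local items seen i l)
    (hpc : l.pc = .setNew) (hx : l.h = some x) (hg0 : g ≠ none) :
    ({ V with new := Function.update V.new x (.ptr g) } : View Item p).Local items seen i
      { l with pc := .getNew } := by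
  have hg := L.gSome (by simp [hpc])
  cases L
  rw [hpc] at *
  constructor
  all_goals first
    | (intro h; cases h; done) | exact fun _ => hg | (rintro (h | h) <;> cases h; done) | assumption
    | skip
  case getNew =>
    intro _ y hy
    dsimp only at hy ⊢
    rw [hx] at hy; cases hy
    simpa using hg0

theorem Local.toReadAnn2 (L : V.Local items seen i l) (hpc : l.pc = .getNew)
    (h : (V.ann i).2 = none) : V.Local items seen i { l with pc := .readAnn2 } := by
  have hg := L.gSome (by simp [hpc])
  cases L
  rw [hpc] at *
  constructor
  all_goals first
    | (intro h; cases h; done) | exact fun _ => hg | (rintro (h | h) <;> cases h; done) | assumption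
    | skip
  case readAnn2 => exact fun _ => h

theorem Local.toOuter_of_getNew {x y : Addr} (G : V.Glob items) (L : V.Local items seen i l)
    (hpc : l.pc = .getNew) (hx : l.h = some x) (hy : V.new x = .ptr (some y)) :
    V.Local items seen i { l with g' := some y, pc := .outer } := by
  have hg := L.gSome (by simp [hpc])
  have L0 := L
  cases L
  rw [hpc] at *
  constructor
  all_goals first
    | (intro h; cases h; done) | exact fun _ => hg | (rintro (h | h) <;> cases h; done) | assumption
    | skip
  case moving =>
    refine fun _ => ⟨x, y, hx, rfl, ?_, .inl hy⟩
    have hm := (L0.hMem x hx).1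
    obtain ⟨e, -, h⟩ := G.itm x hm
    rw [(G.newPtr x y hm hy).1, h]; simp

theorem Local.toUnannPostMTF (L : V.Local items seen i l) (hpc : l.pc = .readAnn2) :
    V.Local items seen i
      { l with a := (V.ann i).1, b := (V.ann i).2, pc := .unannPostMTF } := by
  have hr := L.readAnn2 hpc
  have hg := L.gSome (by simp [hpc])
  cases L
  rw [hpc] at *
  constructor
  all_goals first
    | (intro h; cases h; done) | exact fun _ => hg | (rintro (h | h) <;> cases h; done) | assumption
    | skip
  case withdrawing => exact fun _ => ⟨rfl, hr⟩

theorem Local.toUnannOther2 (L : V.Local items seen i l) (hpc : l.pc = .readAnn3)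
    (h : (V.ann i).2 = none) :
    V.Local items seen i
      { l with a := (V.ann i).1, b := (V.ann i).2, pc := .unannOther2 } := by
  have hg := L.gSome (by simp [hpc])
  cases L
  rw [hpc] at *
  constructor
  all_goals first
    | (intro h; cases h; done) | exact fun _ => hg | (rintro (h | h) <;> cases h; done) | assumption
    | skip
  case withdrawing => exact fun _ => ⟨rfl, h⟩

theorem Local.toNext_of_readAnn3 (L : V.Local items seen i l) (hpc : l.pc = .readAnn3) :
    V.Local items seen i { l with a := (V.ann i).1, b := (V.ann i).2, pc := .next } := by
  have hg := L.gSome (by simp [hpc])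
  cases L
  rw [hpc] at *
  constructor
  all_goals first
    | (intro h; cases h; done) | exact fun _ => hg | (rintro (h | h) <;> cases h; done) | assumption

/-- The current node does not contain the item, so it is not the protected node `v` but strictly
above it, and `noskip` keeps `v` at or below the next node. -/
theorem Local.toLoop_of_next {x : Addr} (G : V.Glob items) (L : V.Local items seen i l)
    (hpc : l.pc = .next) (hx : l.h = some x) :
    V.Local items seen i { l with h := V.next x, pc := .loop } := by
  have hm := L.hMem x hx
  have hn := L.notFound (by rw [hpc]; rfl) x hx
  have hg := L.gSome (by simp [hpc])
  have L0 := L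
  cases L
  rw [hpc] at *
  constructor
  all_goals first
    | (intro h; cases h; done) | exact fun _ => hg | (rintro (h | h) <;> cases h; done) | assumption
    | skip
  case hMem =>
    intro y hy
    have := G.nxt x y hm.1 hy
    refine ⟨this.1, fun h => ?_⟩
    have := G.rank_le_head h x
    omega
  case trav =>
    intro hs he
    obtain ⟨x', v, h1, h2, h3, h4, h5⟩ := L0.trav hs he
    rw [hx] at h1; cases h1
    have hlt : V.rank v < V.rank x := by
      refine lt_of_le_of_ne h5 fun h => hn ?_
      rw [← G.inj v x h2.1 h]; exact h3
    rcases G.noskip x v hm.1 h2 hlt with ⟨y, hy, hy'⟩ | ⟨h, -⟩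
    · exact ⟨y, v, hy, h2, h3, h4, hy'⟩
    · exact absurd h hm.2

theorem Local.toUnannEnd (L : V.Local items seen i l) (hpc : l.pc = .readAnn4)
    (h : (V.ann i).2 = none ∨ l.e ∉ items) :
    V.Local items seen i
      { l with a := (V.ann i).1, b := (V.ann i).2, pc := .unannEnd } := by
  have hg := L.gSome (by simp [hpc])
  cases L
  rw [hpc] at *
  constructor
  all_goals first
    | (intro h; cases h; done) | exact fun _ => hg | (rintro (h | h) <;> cases h; done) | assumption
    | skip
  case unannEnd => exact fun _ => ⟨rfl, h⟩

theorem Local.toReadAnn2_of_outer (L : V.Local items seen i l) (hpc : l.pc = .outer)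
    (h : (V.ann i).2 = none) : V.Local items seen i { l with pc := .readAnn2 } := by
  have hg := L.gSome (by simp [hpc])
  cases L
  rw [hpc] at *
  constructor
  all_goals first
    | (intro h; cases h; done) | exact fun _ => hg | (rintro (h | h) <;> cases h; done) | assumption
    | skip
  case readAnn2 => exact fun _ => h

theorem Local.toGetHead2 (L : V.Local items seen i l) (hpc : l.pc = .outer) :
    V.Local items seen i { l with pc := .getHead2 } := by
  have hg := L.gSome (by simp [hpc])
  cases L
  rw [hpc] at *
  constructor
  all_goals first
    | (intro h; cases h; done) | exact fun _ => hg | (rintro (h | h) <;> cases h; done) | assumption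

theorem Local.toGetOld (G : V.Glob items) (L : V.Local items seen i l) (hpc : l.pc = .getHead2) :
    V.Local items seen i { l with k1 := V.head.1, k2 := V.head.2, pc := .getOld } := by
  have hg := L.gSome (by simp [hpc])
  cases L
  rw [hpc] at *
  constructor
  all_goals first
    | (intro h; cases h; done) | exact fun _ => hg | (rintro (h | h) <;> cases h; done) | assumption
    | skip
  case gotHead =>
    obtain ⟨a, b, h1, h2, h3, h4, h5⟩ := G.hd
    refine fun _ => ⟨a, b, by dsimp only; rw [h1], by dsimp only; rw [h1], h2, h3, fun z hz => ?_⟩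
    exact h5 z (by rintro rfl; omega)

theorem Local.toTestPrepend (L : V.Local items seen i l) (hpc : l.pc = .getOld)
    (h : ∀ x, l.k1 = some x → V.old x = .mark) :
    V.Local items seen i { l with pc := .testPrepend } := by
  have hg := L.gSome (by simp [hpc])
  cases L
  rw [hpc] at *
  constructor
  all_goals first
    | (intro h; cases h; done) | exact fun _ => hg | (rintro (h | h) <;> cases h; done) | assumption
    | skip
  case oldDone => exact fun _ => h

theorem Local.toSetNext {x : Addr} {w : Ptr} (G : V.Glob items) (L : V.Local items seen i l)
    (hpc : l.pc = .getOld) (hx : l.k1 = some x) (hw : V.old x = .ptr w) :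
    V.Local items seen i { l with h' := w, pc := .setNext } := by
  obtain ⟨x', y, h1, h2, h3, h4, h5⟩ := L.gotHead (by rw [hpc]; rfl)
  have hg := L.gSome (by simp [hpc])
  cases L
  rw [hpc] at *
  constructor
  all_goals first
    | (intro h; cases h; done) | exact fun _ => hg | (rintro (h | h) <;> cases h; done) | assumption
    | skip
  case helping =>
    rw [hx] at h1; cases h1
    rcases G.old x (by omega) with h | ⟨-, w', h6, h7, -⟩
    · rw [hw] at h; cases h
    · rw [hw] at h6; cases h6
      exact fun _ => ⟨x, w', hx, rfl, h7, .inr hw⟩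

theorem Local.toPrepend (L : V.Local items seen i l) (hpc : l.pc = .testPrepend)
    (h : V.head.1 = l.k1 → ∀ y, l.g' = some y → V.rank y = 0) :
    V.Local items seen i { l with pc := .prepend } := by
  have ho := L.oldDone (.inl hpc)
  have hg := L.gSome (by simp [hpc])
  cases L
  rw [hpc] at *
  constructor
  all_goals first
    | (intro h; cases h; done) | exact fun _ => hg | (rintro (h | h) <;> cases h; done) | assumption
    | skip
  case oldDone => exact fun _ => ho
  case prepend => exact fun _ => h

theorem Local.toOuter (L : V.Local items seen i l)
    (hpc : l.pc = .testPrepend ∨ l.pc = .prepend ∨ l.pc = .done) :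
    V.Local items seen i { l with pc := .outer } := by
  rcases hpc with hpc | hpc | hpc
  all_goals
    have hg := L.gSome (by simp [hpc])
    cases L
    rw [hpc] at *
    constructor
    all_goals first
      | (intro h; cases h; done) | exact fun _ => hg | (rintro (h | h) <;> cases h; done) | assumption

theorem Local.toSetPrev (L : V.Local items seen i l) (hpc : l.pc = .setNext)
    (h : ∀ x, l.k1 = some x → V.head.1 = some x → V.next x ≠ none) :
    V.Local items seen i { l with pc := .setPrev } := by
  have hg := L.gSome (by simp [hpc])
  cases L
  rw [hpc] at *
  constructor
  all_goals first
    | (intro h; cases h; done) | exact fun _ => hg | (rintro (h | h) <;> cases h; done) | assumption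
    | skip
  case nextSet => exact fun _ => h

theorem Local.toGetItem (L : V.Local items seen i l) (hpc : l.pc = .setPrev)
    (h : ∀ y, l.k2 = some y → V.prev y ≠ none) :
    V.Local items seen i { l with pc := .getItem } := by
  have hg := L.gSome (by simp [hpc])
  cases L
  rw [hpc] at *
  constructor
  all_goals first
    | (intro h; cases h; done) | exact fun _ => hg | (rintro (h | h) <;> cases h; done) | assumption
    | skip
  case prevSet => exact fun _ => h

theorem Local.toReadAnn_of_getItem {e' : Item} (L : V.Local items seen i l) (hpc : l.pc = .getItem)
    (h : ∀ x, l.k1 = some x → V.item x = some e') :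
    V.Local items seen i { l with e' := e', todo := Finset.univ, pc := .readAnn } := by
  have hg := L.gSome (by simp [hpc])
  cases L
  rw [hpc] at *
  constructor
  all_goals first
    | (intro h; cases h; done) | exact fun _ => hg | (rintro (h | h) <;> cases h; done) | assumption
    | skip
  case informing => exact fun _ x hx => ⟨h x hx, fun _ _ _ _ => .inl (Finset.mem_univ _)⟩

theorem Local.toTestInform {j : Fin p} (G : V.Glob items) (L : V.Local items seen i l)
    (hpc : l.pc = .readAnn) (h : (V.ann j).2 = some l.e') :
    V.Local items seen i { l with
      j := some j, todo := l.todo.erase j, a := (V.ann j).1, b := (V.ann j).2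
      pc := .testInform } := by
  have hinf := L.informing (by rw [hpc]; rfl)
  have hg := L.gSome (by simp [hpc])
  cases L
  rw [hpc] at *
  constructor
  all_goals first
    | (intro h; cases h; done) | exact fun _ => hg | (rintro (h | h) <;> cases h; done) | assumption
    | skip
  case informing =>
    intro _ x hx
    obtain ⟨h1, h2⟩ := hinf x hx
    refine ⟨h1, fun h3 h4 j' h5 => ?_⟩
    rcases h2 h3 h4 j' h5 with h6 | ⟨h6, -⟩
    · by_cases hj : j' = j
      · subst hj; exact .inr ⟨by simp, rfl, rfl⟩
      · exact .inl (Finset.mem_erase.2 ⟨hj, h6⟩)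
    · exact absurd rfl h6
  case informingOne => exact fun _ => ⟨j, rfl, h, fun x hx => G.annAlloc j x hx⟩

theorem Local.toReadAnn {j : Fin p} (L : V.Local items seen i l)
    (hpc : l.pc = .readAnn) (h : ¬ V.seeks j l.e') :
    V.Local items seen i { l with
      j := some j, todo := l.todo.erase j, a := (V.ann j).1, b := (V.ann j).2
      pc := .readAnn } := by
  have hinf := L.informing (by rw [hpc]; rfl)
  have hg := L.gSome (by simp [hpc])
  cases L
  rw [hpc] at *
  constructor
  all_goals first
    | (intro h; cases h; done) | exact fun _ => hg | (rintro (h | h) <;> cases h; done) | assumption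
    | skip
  case informing =>
    intro _ x hx
    obtain ⟨h1, h2⟩ := hinf x hx
    refine ⟨h1, fun h3 h4 j' h5 => ?_⟩
    rcases h2 h3 h4 j' h5 with h6 | ⟨h6, -⟩
    · have hj : j' ≠ j := by rintro rfl; exact h h5
      exact .inl (Finset.mem_erase.2 ⟨hj, h6⟩)
    · exact absurd rfl h6

theorem Local.toReadAnn_of_testInform (L : V.Local items seen i l) (hpc : l.pc = .testInform)
    (h : ∀ x, l.k1 = some x → V.old x = .mark) :
    V.Local items seen i { l with pc := .readAnn } := by
  have hinf := L.informing (by rw [hpc]; rfl)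
  have hg := L.gSome (by simp [hpc])
  cases L
  rw [hpc] at *
  constructor
  all_goals first
    | (intro h; cases h; done) | exact fun _ => hg | (rintro (h | h) <;> cases h; done) | assumption
    | skip
  case informing =>
    intro _ x hx
    obtain ⟨h1, h2⟩ := hinf x hx
    exact ⟨h1, fun h3 h4 => absurd (h x hx) h4⟩

theorem Local.toInform (L : V.Local items seen i l) (hpc : l.pc = .testInform)
    (h : ∀ j x, V.ann j = (l.a, l.b) → l.k1 = some x → seen j x) :
    V.Local items seen i { l with pc := .inform } := by
  have hinf := L.informing (by rw [hpc]; rfl)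
  have hg := L.gSome (by simp [hpc])
  cases L
  rw [hpc] at *
  constructor
  all_goals first
    | (intro h; cases h; done) | exact fun _ => hg | (rintro (h | h) <;> cases h; done) | assumption
    | skip
  case informing =>
    intro _ x hx
    obtain ⟨h1, h2⟩ := hinf x hx
    refine ⟨h1, fun h3 h4 j h5 => ?_⟩
    exact (h2 h3 h4 j h5).imp_right fun h => ⟨by simp, h.2⟩
  case inform => exact fun _ j x _ => h j x

theorem Local.toReadAnn_of_inform {j : Fin p} (L : V.Local items seen i l) (hpc : l.pc = .inform)
    (hj : l.j = some j) (h : V.ann j = (l.a, l.b) → ¬ V.seeks j l.e') :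
    V.Local items seen i { l with pc := .readAnn } := by
  have hinf := L.informing (by rw [hpc]; rfl)
  have hg := L.gSome (by simp [hpc])
  cases L
  rw [hpc] at *
  constructor
  all_goals first
    | (intro h; cases h; done) | exact fun _ => hg | (rintro (h | h) <;> cases h; done) | assumption
    | skip
  case informing =>
    intro _ x hx
    obtain ⟨h1, h2⟩ := hinf x hx
    refine ⟨h1, fun h3 h4 j' h5 => ?_⟩
    rcases h2 h3 h4 j' h5 with h6 | ⟨-, h6, h7⟩
    · exact .inl h6
    · rw [hj] at h6; cases h6
      exact absurd h5 (h h7)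

theorem Local.toGetPrev (L : V.Local items seen i l) (hpc : l.pc = .readAnn) (h : l.todo = ∅) :
    V.Local items seen i { l with pc := .getPrev } := by
  have hinf := L.informing (by rw [hpc]; rfl)
  have hg := L.gSome (by simp [hpc])
  cases L
  rw [hpc] at *
  constructor
  all_goals first
    | (intro h; cases h; done) | exact fun _ => hg | (rintro (h | h) <;> cases h; done) | assumption
    | skip
  case allInformed =>
    intro _ x hx hh ho j e he hs
    obtain ⟨h1, h2⟩ := hinf x hx
    rw [h1] at he; cases he
    rcases h2 hh ho j hs with h6 | ⟨h6, -⟩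
    · rw [h] at h6; simp at h6
    · exact h6 rfl

theorem Local.toGetNext {w : Addr} (G : V.Glob items) (L : V.Local items seen i l)
    (hpc : l.pc = .getPrev) (hw : l.h' = some w) :
    V.Local items seen i { l with pred := V.prev w, pc := .getNext } := by
  obtain ⟨x, w', h1, h2, ⟨h3, h4, h5, h6⟩, -⟩ := L.helping (by rw [hpc]; rfl)
  rw [hw] at h2; cases h2
  have hg := L.gSome (by simp [hpc])
  cases L
  rw [hpc] at *
  constructor
  all_goals first
    | (intro h; cases h; done) | exact fun _ => hg | (rintro (h | h) <;> cases h; done) | assumption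
    | skip
  case gotPrev =>
    intro _
    obtain ⟨a, b, g1, g2, g3, g4, g5⟩ := G.hd
    have hwa : w ≠ a := by
      rintro rfl; have := G.rank_le_head (a := w) (by rw [g1]) x; omega
    -- If `w` were the second node, then `x` would be the front; but `x` and `w` share their item,
    -- and the first two nodes do not.
    have hwb : w ≠ b := by
      rintro rfl
      have hxa : x = a := by
        by_contra h; have := g5 x h; omega
      subst hxa; exact g4 h4.symm
    have := G.prvSome w h3 (by rw [g1]; simpa using Ne.symm hwa)
      (by rw [g1]; intro h; cases h; exact absurd rfl hwb)
    obtain ⟨y, hy⟩ := Option.ne_none_iff_exists'.1 this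
    exact ⟨y, hy, G.prv w y h3 hy⟩

theorem Local.toRemove1 {w : Addr} (G : V.Glob items) (L : V.Local items seen i l)
    (hpc : l.pc = .getNext) (hw : l.h' = some w) :
    V.Local items seen i { l with succ := V.next w, pc := .remove1 } := by
  obtain ⟨x, w', h1, h2, ⟨h3, h4, h5, h6⟩, -⟩ := L.helping (by rw [hpc]; rfl)
  rw [hw] at h2; cases h2
  have hg := L.gSome (by simp [hpc])
  cases L
  rw [hpc] at *
  constructor
  all_goals first
    | (intro h; cases h; done) | exact fun _ => hg | (rintro (h | h) <;> cases h; done) | assumption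
    | skip
  case gotNext =>
    intro _ w' hw'
    dsimp only at hw' ⊢
    rw [hw] at hw'; cases hw'
    refine ⟨fun u hu => G.nxt w u h3 hu, fun z hz hr => ?_⟩
    rcases G.noskip w z h3 hz hr with h | ⟨h, -⟩
    · exact h
    · have := G.rank_le_head h x; omega

theorem Local.toRemove2 (L : V.Local items seen i l) (hpc : l.pc = .remove1) :
    V.Local items seen i { l with pc := .remove2 } := by
  have hg := L.gSome (by simp [hpc])
  cases L
  rw [hpc] at *
  constructor
  all_goals first
    | (intro h; cases h; done) | exact fun _ => hg | (rintro (h | h) <;> cases h; done) | assumption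

theorem Local.toGone (L : V.Local items seen i l) (hpc : l.pc = .remove2) :
    V.Local items seen i { l with pc := .gone } := by
  have hg := L.gSome (by simp [hpc])
  cases L
  rw [hpc] at *
  constructor
  all_goals first
    | (intro h; cases h; done) | exact fun _ => hg | (rintro (h | h) <;> cases h; done) | assumption

theorem Local.toDone (L : V.Local items seen i l) (hpc : l.pc = .gone) :
    V.Local items seen i { l with pc := .done } := by
  have hg := L.gSome (by simp [hpc])
  cases L
  rw [hpc] at *
  constructor
  all_goals first
    | (intro h; cases h; done) | exact fun _ => hg | (rintro (h | h) <;> cases h; done) | assumption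

end View

/-! ### The invariant of configurations, and views after updates -/

/-- The invariant of DMTF. -/
structure Inv (s : Config Item p) (ρ : Addr → ℕ) (items : List Item)
    (seen : Fin p → Addr → Prop) : Prop where
  glob : (s.view ρ).Glob items
  loc : ∀ i l, s.proc i = some l → (s.view ρ).Local items seen i l
  idle : ∀ i, s.proc i = none → s.ann i = (none, none)
  own : ∀ i j l l' x, s.proc i = some l → s.proc j = some l' → l.g = some x → l'.g = some x → i = j

section view

variable {s t : Config Item p} {ρ : Addr → ℕ} {x : Addr} {v : Node Item} {i : Fin p}
  {l l' : Loc Item p}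

theorem Config.view_item (h : s.heap x = some v) : (s.view ρ).item x = some v.item := by
  simp [Config.view, h]

theorem Config.view_next (h : s.heap x = some v) : (s.view ρ).next x = v.next := by
  simp [Config.view, h]

theorem Config.view_prev (h : s.heap x = some v) : (s.view ρ).prev x = v.prev := by
  simp [Config.view, h]

theorem Config.view_old (h : s.heap x = some v) : (s.view ρ).old x = v.old := by
  simp [Config.view, h]

theorem Config.view_new (h : s.heap x = some v) : (s.view ρ).new x = v.new := by
  simp [Config.view, h]

theorem Config.exists_of_view_item (h : (s.view ρ).item x ≠ none) : ∃ v, s.heap x = some v := by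
  cases hx : s.heap x with
  | none => simp [Config.view, hx] at h
  | some v => exact ⟨v, rfl⟩

theorem Config.item_setNode {v' : Node Item} (h : s.heap x = some v) (hv : v'.item = v.item)
    (y : Addr) :
    ((s.setNode x v').heap y).map Node.item = (s.heap y).map Node.item := by
  by_cases hy : y = x
  · subst hy; simp [Config.setNode, h, hv]
  · simp [Config.setNode, hy]

theorem Config.view_setNode {v' : Node Item} (h : s.heap x = some v) (hv : v'.item = v.item) :
    (s.setNode x v').view ρ = { s.view ρ with
      next := Function.update (s.view ρ).next x v'.next
      prev := Function.update (s.view ρ).prev x v'.prev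
      old := Function.update (s.view ρ).old x v'.old
      new := Function.update (s.view ρ).new x v'.new } := by
  refine View.ext (funext fun y => ?_) (funext fun y => ?_) (funext fun y => ?_)
    (funext fun y => ?_) (funext fun y => ?_) rfl rfl ?_ rfl rfl
  · exact Config.item_setNode h hv y
  on_goal 5 => simp only [Config.view, Config.item_setNode h hv]; rfl
  all_goals
    by_cases hy : y = x
    · subst hy; simp [Config.view, Config.setNode]
    · simp [Config.view, Config.setNode, hy]

theorem Config.view_setNext {V : View Item p} (hV : s.view ρ = V) {y : Ptr}
    (h : s.heap x = some v) :
    (s.setNode x { v with next := y }).view ρ =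
      { V with next := Function.update V.next x y } := by
  subst hV
  rw [Config.view_setNode (v' := { v with next := y }) h rfl]
  simp only [← Config.view_prev (ρ := ρ) h, ← Config.view_old (ρ := ρ) h,
    ← Config.view_new (ρ := ρ) h, Function.update_eq_self]

theorem Config.view_setPrev {V : View Item p} (hV : s.view ρ = V) {y : Ptr}
    (h : s.heap x = some v) :
    (s.setNode x { v with prev := y }).view ρ =
      { V with prev := Function.update V.prev x y } := by
  subst hV
  rw [Config.view_setNode (v' := { v with prev := y }) h rfl]
  simp only [← Config.view_next (ρ := ρ) h, ← Config.view_old (ρ := ρ) h,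
    ← Config.view_new (ρ := ρ) h, Function.update_eq_self]

theorem Config.view_setOld {V : View Item p} (hV : s.view ρ = V) {y : Link}
    (h : s.heap x = some v) :
    (s.setNode x { v with old := y }).view ρ =
      { V with old := Function.update V.old x y } := by
  subst hV
  rw [Config.view_setNode (v' := { v with old := y }) h rfl]
  simp only [← Config.view_next (ρ := ρ) h, ← Config.view_prev (ρ := ρ) h,
    ← Config.view_new (ρ := ρ) h, Function.update_eq_self]

theorem Config.view_setNew {V : View Item p} (hV : s.view ρ = V) {y : Link}
    (h : s.heap x = some v) :
    (s.setNode x { v with new := y }).view ρ =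
      { V with new := Function.update V.new x y } := by
  subst hV
  rw [Config.view_setNode (v' := { v with new := y }) h rfl]
  simp only [← Config.view_next (ρ := ρ) h, ← Config.view_prev (ρ := ρ) h,
    ← Config.view_old (ρ := ρ) h, Function.update_eq_self]

theorem Config.seeks_setLoc_of_ne {j : Fin p} (hj : j ≠ i) (e : Item) :
    ((t.setLoc i l').view ρ).seeks j e ↔ (t.view ρ).seeks j e := by
  simp only [Config.view, Config.setLoc, Function.update_of_ne hj]

/-- The view depends on a local state only through `e`, `h1` and, in `priv`, the node at position
`announce`; so most local moves leave it unchanged. -/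
theorem Config.view_setLoc (hl : t.proc i = some l) (he : l'.e = l.e) (h1 : l'.h1 = l.h1)
    (hpc : l.pc ≠ .announce) (hpc' : l'.pc ≠ .announce) : (t.setLoc i l').view ρ = t.view ρ := by
  refine View.ext rfl rfl rfl rfl rfl rfl rfl (funext fun j => funext fun e => propext ?_)
    (funext fun x => propext ?_) rfl
  · by_cases hj : j = i
    · subst hj; simp [Config.view, Config.setLoc, hl, he, h1]
    · exact Config.seeks_setLoc_of_ne hj e
  · constructor
    · rintro ⟨j, m, h2, h3⟩
      have hj : j ≠ i := by
        rintro rfl; simp [Config.setLoc] at h2; subst h2; exact hpc' h3.1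
      exact ⟨j, m, by simpa [Config.setLoc, hj] using h2, h3⟩
    · rintro ⟨j, m, h2, h3⟩
      have hj : j ≠ i := by
        rintro rfl; rw [hl] at h2; cases h2; exact hpc h3.1
      exact ⟨j, m, by simpa [Config.setLoc, hj] using h2, h3⟩

end view

theorem View.Evolves.refl {V : View Item p} {items : List Item} {seen : Fin p → Addr → Prop}
    {proc : Fin p → Option (Loc Item p)} {J : Fin p → Prop} : V.Evolves V items seen proc J where
  item _ _ := rfl
  rank _ := .inl rfl
  head _ _ h := h
  old _ _ := .inl rfl
  next _ _ _ h := h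
  prev _ h := h
  new _ _ := .inl rfl
  unlinked _ _ _ _ _ _ h h' := ⟨h, h', rfl⟩
  prot _ _ h := h
  protSeeks _ _ _ _ _ _ _ h := h
  seeks _ _ h := .inl h
  seeksOwn _ _ _ h := h
  seeksAnn _ _ _ := rfl
  ann _ _ _ _ := .inl rfl
  annSome _ _ _ h := .inl h
  priv _ h := .inl h

namespace Inv

variable {s s' t : Config Item p} {ρ ρ' : Addr → ℕ} {items : List Item}
  {seen : Fin p → Addr → Prop} {i : Fin p} {l l' : Loc Item p}

theorem update (I : Inv s ρ items seen) (hproc : ∀ j, j ≠ i → s'.proc j = s.proc j)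
    (hidle : ∀ j, j ≠ i → s.proc j = none → s'.ann j = s.ann j)
    (hidle' : s'.proc i = none → s'.ann i = (none, none))
    (hown : ∀ l', s'.proc i = some l' → ∀ x, l'.g = some x →
      (∃ l, s.proc i = some l ∧ l.g = some x) ∨ s.heap x = none)
    (G : (s'.view ρ').Glob items)
    (E : (s.view ρ).Evolves (s'.view ρ') items seen s.proc fun j => j ≠ i)
    (L : ∀ l', s'.proc i = some l' → (s'.view ρ').Local items seen i l') :
    Inv s' ρ' items seen := by
  refine ⟨G, fun j m hm => ?_, fun j hj => ?_, ?_⟩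
  · by_cases hj : j = i
    · subst hj; exact L m hm
    · have hm' := hm
      rw [hproc j hj] at hm'
      exact (I.loc j m hm').evolve I.glob E hj hm'
  · by_cases hji : j = i
    · subst hji; exact hidle' hj
    · rw [hproc j hji] at hj
      rw [hidle j hji hj]; exact I.idle j hj
  · have key : ∀ j m m' x, j ≠ i → s'.proc i = some m → s'.proc j = some m' → m.g = some x →
        m'.g = some x → False := by
      intro j m m' x hj h1 h2 h3 h4
      rw [hproc j hj] at h2
      rcases hown m h1 x h3 with ⟨l, h5, h6⟩ | h5
      · exact hj (I.own j i m' l x h2 h5 h4 h6)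
      · exact (I.loc j m' h2).gAlloc x h4 (by simp [Config.view, h5])
    intro j k m m' x h1 h2 h3 h4
    by_cases hj : j = i
    · subst hj
      by_contra hk
      exact key k m m' x (Ne.symm hk) h1 h2 h3 h4
    · by_cases hk : k = i
      · subst hk; exact (key j m' m x hj h2 h1 h4 h3).elim
      · rw [hproc j hj] at h1; rw [hproc k hk] at h2
        exact I.own j k m m' x h1 h2 h3 h4

/-- A step that changes the shared memory as from `s` to `t` and the local state of process `i`. -/
theorem update_setLoc (I : Inv s ρ items seen) (hl : s.proc i = some l) (htp : t.proc = s.proc)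
    (hidle : ∀ j, s.proc j = none → t.ann j = s.ann j)
    (he : l'.e = l.e) (hg : l'.g = l.g) (h1 : l'.h1 = l.h1)
    (hpc : l.pc ≠ .announce) (hpc' : l'.pc ≠ .announce)
    (G : (t.view ρ').Glob items)
    (E : (s.view ρ).Evolves (t.view ρ') items seen s.proc fun j => j ≠ i)
    (L : (t.view ρ').Local items seen i l') : Inv (t.setLoc i l') ρ' items seen := by
  have hv : (t.setLoc i l').view ρ' = t.view ρ' :=
    Config.view_setLoc (htp ▸ hl) he h1 hpc hpc'
  refine I.update (fun j hj => ?_) (fun j _ => hidle j) (fun h => ?_) (fun m hm x hx => ?_)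
    (hv ▸ G) (hv ▸ E) (fun m hm => ?_)
  · simp [Config.setLoc, hj, htp]
  · simp [Config.setLoc] at h
  · simp [Config.setLoc] at hm; subst hm
    exact .inl ⟨l, hl, hg ▸ hx⟩
  · simp [Config.setLoc] at hm; subst hm
    exact hv ▸ L

/-- A step that changes the local state of process `i` only. -/
theorem setLoc (I : Inv s ρ items seen) (hl : s.proc i = some l)
    (he : l'.e = l.e) (hg : l'.g = l.g) (h1 : l'.h1 = l.h1)
    (hpc : l.pc ≠ .announce) (hpc' : l'.pc ≠ .announce)
    (L : (s.view ρ).Local items seen i l') : Inv (s.setLoc i l') ρ items seen :=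
  I.update_setLoc hl rfl (fun _ _ => rfl) he hg h1 hpc hpc' I.glob .refl L

/-- For updates that respect even the invariant of the acting process: it is carried over at the old
position first, and then the position changes. Updates that expose the process's own node `g`
violate this and need `update_setLoc`. -/
theorem mem_setLoc (I : Inv s ρ items seen) (hl : s.proc i = some l) (htp : t.proc = s.proc)
    (hidle : ∀ j, s.proc j = none → t.ann j = s.ann j)
    (he : l'.e = l.e) (hg : l'.g = l.g) (h1 : l'.h1 = l.h1)
    (hpc : l.pc ≠ .announce) (hpc' : l'.pc ≠ .announce)
    (G : (t.view ρ').Glob items)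
    (E : (s.view ρ).Evolves (t.view ρ') items seen s.proc fun _ => True)
    (L : (t.view ρ').Local items seen i l → (t.view ρ').Local items seen i l') :
    Inv (t.setLoc i l') ρ' items seen :=
  I.update_setLoc hl htp hidle he hg h1 hpc hpc' G (E.mono fun _ _ => trivial)
    (L ((I.loc i l hl).evolve I.glob E trivial hl))

theorem seeks_of_ann (hl : s.proc i = some l) {a : Addr} (ha : l.h1 = some a)
    (hi : (s.view ρ).item a ≠ some l.e) (h : (s.ann i).2 = some l.e) : (s.view ρ).seeks i l.e :=
  ⟨l, a, hl, rfl, ha, hi, h⟩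

end Inv

/-! ### Steps that change the shared memory or the set of searchers -/

namespace Inv

variable {s : Config Item p} {ρ : Addr → ℕ} {items : List Item}
  {seen : Fin p → Addr → Prop} {i : Fin p} {l l' : Loc Item p} {x : Addr} {v : Node Item}

theorem invoke (I : Inv s ρ items seen) (e : Item) (h : s.proc i = none) :
    Inv (s.setLoc i { pc := .allocate, e := e }) ρ items seen := by
  have hv : (s.setLoc i { pc := .allocate, e := e }).view ρ = s.view ρ := by
    refine View.ext rfl rfl rfl rfl rfl rfl rfl (funext fun j => funext fun e' => propext ?_)
      (funext fun x => propext ?_) rfl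
    · by_cases hj : j = i
      · subst hj; simp [Config.view, Config.setLoc, h]
      · exact Config.seeks_setLoc_of_ne hj e'
    · refine exists_congr fun j => ?_
      by_cases hj : j = i
      · subst hj; simp [Config.setLoc, h]
      · simp [Config.setLoc, hj]
  have hs : ¬ (s.view ρ).seeks i e := by simp [Config.view, h]
  refine I.update (i := i) (fun j hj => by simp [Config.setLoc, hj]) (fun _ _ _ => rfl)
    (fun h => by simp [Config.setLoc] at h) (fun m hm x hx => ?_) (hv ▸ I.glob)
    (hv ▸ View.Evolves.refl) (fun m hm => ?_)
  · simp [Config.setLoc] at hm; subst hm; simp at hx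
  · simp [Config.setLoc] at hm; subst hm
    rw [hv]
    constructor
    all_goals first
      | (intro h; cases h; done) | (rintro (h | h) <;> cases h; done)
      | (intro x hx; cases hx; done) | skip
    case gSome => exact fun h => absurd rfl h
    case quiet => exact fun _ => I.idle i h
    case early => exact fun _ => rfl
    case trav => exact fun h => absurd h hs

theorem ret (I : Inv s ρ items seen) (hl : s.At i l .ret) : Inv (s.setIdle i) ρ items seen := by
  have ha : s.ann i = (none, none) := (I.loc i l hl.1).quiet (by rw [hl.2]; rfl)
  have hv : (s.setIdle i).view ρ = s.view ρ := by
    refine View.ext rfl rfl rfl rfl rfl rfl rfl (funext fun j => funext fun e' => propext ?_)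
      (funext fun x => propext ?_) rfl
    · by_cases hj : j = i
      · subst hj; simp [Config.view, Config.setIdle, ha]
      · simp [Config.view, Config.setIdle, hj]
    · refine exists_congr fun j => ?_
      by_cases hj : j = i
      · subst hj; simp [Config.setIdle, hl.1, hl.2]
      · simp [Config.setIdle, hj]
  refine I.update (i := i) (fun j hj => by simp [Config.setIdle, hj]) (fun _ _ _ => rfl)
    (fun _ => ha) (fun m hm => by simp [Config.setIdle] at hm) (hv ▸ I.glob)
    (hv ▸ View.Evolves.refl) (fun m hm => by simp [Config.setIdle] at hm)

theorem allocate (I : Inv s ρ items seen) (hl : s.At i l .allocate) (hx : s.heap x = none) :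
    Inv ((s.setNode x ⟨l.e, none, none, .ptr none, .ptr none⟩).setLoc i
      { l with g := some x, pc := .announce }) ρ items seen := by
  set s' := (s.setNode x ⟨l.e, none, none, .ptr none, .ptr none⟩).setLoc i
      { l with g := some x, pc := .announce } with hs'
  have L := I.loc i l hl.1
  have hpc := hl.2
  have hxi : (s.view ρ).item x = none := by simp [Config.view, hx]
  have hann : s.ann i = (none, none) := L.quiet (by rw [hpc]; rfl)
  have hproc : ∀ j, j ≠ i → s'.proc j = s.proc j := fun j hj => by
    simp [hs', Config.setLoc, Config.setNode, hj]
  have hproci : s'.proc i = some { l with g := some x, pc := .announce } := by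
    simp [hs', Config.setLoc]
  have hit : ∀ y, (s'.heap y).map Node.item = Function.update (s.view ρ).item x (some l.e) y := by
    intro y
    by_cases hy : y = x
    · subst hy; simp [hs', Config.setLoc, Config.setNode]
    · simp [hs', Config.setLoc, Config.setNode, hy, Config.view]
  have hrk : ρ x = 0 := by
    by_contra h
    obtain ⟨e, -, he⟩ := I.glob.itm x (Nat.pos_of_ne_zero h)
    rw [hxi] at he; cases he
  generalize hV : s.view ρ = V at *
  have hv : s'.view ρ = { V with
      item := Function.update V.item x (some l.e), priv := (s'.view ρ).priv } := by
    subst hV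
    refine View.ext (funext hit) (funext fun y => ?_) (funext fun y => ?_)
      (funext fun y => ?_) (funext fun y => ?_) rfl rfl
      (funext fun j => funext fun e => propext ?_) rfl rfl
    on_goal 5 =>
      by_cases hj : j = i
      · subst hj
        have : s'.ann j = (none, none) := hann
        simp [Config.view, this, hann]
      · simp only [Config.view, hproc j hj]
        refine exists_congr fun m => exists_congr fun a => and_congr_right fun hm =>
          and_congr_right fun _ => and_congr_right fun ha => ?_
        -- A front node remembered by another process has positive rank, whereas the new address has
        -- rank 0; so the new item affects no searcher.
        have hax : a ≠ x := by
          rintro rfl; have := ((I.loc j m hm).h1Mem a ha).1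
          simp [Config.view, hrk] at this
        rw [hit a, Function.update_of_ne hax]; rfl
    all_goals
      by_cases hy : y = x
      · subst hy; simp [Config.view, hs', Config.setLoc, Config.setNode, hx]
      · simp [Config.view, hs', Config.setLoc, Config.setNode, hy]
  have hp : ∀ y, (s'.view ρ).priv y → V.priv y ∨ y = x := by
    subst hV
    rintro y ⟨j, m, h1, h2, h3⟩
    by_cases hj : j = i
    · subst hj; rw [hproci] at h1; cases h1; right; cases h3; rfl
    · rw [hproc j hj] at h1; exact .inl ⟨j, m, h1, h2, h3⟩
  have G := I.glob
  rw [hV] at G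
  have hfresh := G.fresh x (by rw [← hV]; exact hrk)
  refine I.update (i := i) hproc (fun _ _ _ => rfl) (fun h => by rw [hproci] at h; cases h)
    (fun m hm y hy => ?_) ?_ ?_ (fun m hm => ?_)
  · rw [hproci] at hm; cases hm; cases hy; exact .inr hx
  · rw [hv]; exact G.allocate hxi hp
  · rw [hv, hV]; exact G.evolves_allocate hxi hp
  · rw [hproci] at hm; cases hm
    have hearly := L.early (by rw [hpc]; rfl)
    have hmem := L.hMem
    have hns : ¬ V.seeks i l.e := by
      subst hV; simp [Config.view, hann]
    have hold : V.old x = .ptr none := by subst hV; simp [Config.view, hx]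
    have hann' : V.ann i = (none, none) := by subst hV; exact hann
    rw [hv]
    constructor
    all_goals first
      | (intro h; cases h; done) | (rintro (h | h) <;> cases h; done) | skip
    case gItem => intro y hy; cases hy; simp
    case gSome => intro _; simp
    case h1Mem => intro y hy; rw [hearly] at hy; cases hy
    case hMem => exact hmem
    case quiet => exact fun _ => hann'
    case unlinked =>
      intro _ y hy; cases hy
      refine ⟨by subst hV; exact hrk, fun z hz h => ?_⟩
      have := (G.newPtr z x hz h).1
      obtain ⟨e, -, he⟩ := G.itm z hz
      rw [hxi, he] at this; cases this
    case gOld => intro _ y hy; cases hy; exact hold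
    case early => exact fun _ => hearly
    case trav => exact fun h => absurd h hns

theorem announce (I : Inv s ρ items seen) (hl : s.At i l .announce) :
    Inv (({ s with ann := Function.update s.ann i (l.g, some l.e) } : Config Item p).setLoc i
      { l with pc := .getHead }) ρ items seen := by
  set s' := ({ s with ann := Function.update s.ann i (l.g, some l.e) } : Config Item p).setLoc i
      { l with pc := .getHead } with hs'
  have L := I.loc i l hl.1
  have hpc := hl.2
  have hann : s.ann i = (none, none) := L.quiet (by rw [hpc]; rfl)
  have hearly := L.early (by rw [hpc]; rfl)
  have hproc : ∀ j, j ≠ i → s'.proc j = s.proc j := fun j hj => by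
    simp [hs', Config.setLoc, hj]
  have hanne : ∀ j, j ≠ i → s'.ann j = s.ann j := fun j hj => by
    simp [hs', Config.setLoc, hj]
  have hproci : s'.proc i = some { l with pc := .getHead } := by simp [hs', Config.setLoc]
  have hanni : s'.ann i = (l.g, some l.e) := by simp [hs', Config.setLoc]
  obtain ⟨g, hg⟩ := Option.ne_none_iff_exists'.1 (L.gSome (by simp [hpc]))
  have hsk : ∀ j e, (s'.view ρ).seeks j e → (s.view ρ).seeks j e ∧ s'.ann j = s.ann j := by
    rintro j e ⟨m, a, h1, h2, h3, h4, h5⟩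
    by_cases hj : j = i
    · subst hj; rw [hproci] at h1; cases h1
      -- `Head` has not been read yet, so the announcing process does not count as a searcher.
      dsimp only at h3; rw [hearly] at h3; cases h3
    · rw [hproc j hj] at h1; rw [hanne j hj] at h5
      exact ⟨⟨m, a, h1, h2, h3, h4, h5⟩, hanne j hj⟩
  have hp : ∀ y, (s'.view ρ).priv y → (s.view ρ).priv y ∧ y ≠ g := by
    rintro y ⟨j, m, h1, h2, h3⟩
    by_cases hj : j = i
    · subst hj; rw [hproci] at h1; cases h1; cases h2
    · rw [hproc j hj] at h1
      refine ⟨⟨j, m, h1, h2, h3⟩, ?_⟩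
      rintro rfl; exact hj (I.own j i m l y h1 hl.1 h3 hg)
  refine I.update (i := i) hproc (fun j hj _ => hanne j hj)
    (fun h => by rw [hproci] at h; cases h) (fun m hm y hy => ?_) ?_ ?_ (fun m hm => ?_)
  · rw [hproci] at hm; cases hm; exact .inl ⟨l, hl.1, hy⟩
  · refine I.glob.setAnn (ann' := s'.ann) (seeks' := (s'.view ρ).seeks) (priv' := (s'.view ρ).priv)
      (fun j e h => (hsk j e h).1) (fun j y hy => ?_)
    by_cases hj : j = i
    · subst hj; rw [hanni, hg] at hy; cases hy
      exact ⟨L.gAlloc g hg, fun h => (hp g h).2 rfl⟩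
    · rw [hanne j hj] at hy
      have := I.glob.annAlloc j y hy
      exact ⟨this.1, fun h => this.2 (hp y h).1⟩
  · refine View.evolves_setAnn (ann' := s'.ann) (seeks' := (s'.view ρ).seeks)
      (priv' := (s'.view ρ).priv) hsk (fun y hy => (hp y hy).1)
      (fun j m hj _ => .inl (hanne j hj)) (fun j y e h => ?_)
    by_cases hj : j = i
    · subst hj; rw [hanni] at h; cases h
      exact .inr ⟨g, hg, j, l, hl.1, hpc, hg⟩
    · rw [hanne j hj] at h; exact .inl h
  · rw [hproci] at hm; cases hm
    have hmem := L.hMem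
    have hgA := L.gItem
    have hunl := L.unlinked (by rw [hpc]; rfl)
    have hgo := L.gOld (by rw [hpc]; rfl)
    have hns : ¬ (s'.view ρ).seeks i l.e := by
      intro h; have := (hsk i l.e h).2; rw [hann, hanni] at this; simp at this
    constructor
    all_goals first
      | (intro h; cases h; done) | (rintro (h | h) <;> cases h; done) | skip
    case gItem => exact hgA
    case gSome => intro _; dsimp only; rw [hg]; simp
    case h1Mem => intro y hy; rw [hearly] at hy; cases hy
    case hMem => exact hmem
    case announced => exact fun _ => .inl hanni
    case unlinked => exact fun _ => hunl
    case gOld => exact fun _ => hgo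
    case early => exact fun _ => hearly
    case trav => exact fun h => absurd h hns

theorem getHead (I : Inv s ρ items seen) (hl : s.At i l .getHead)
    (hseen : ∀ a, s.head.1 = some a → seen i a) :
    Inv (s.setLoc i { l with h1 := s.head.1, h := s.head.2, pc := .testFront }) ρ items seen := by
  set s' := s.setLoc i { l with h1 := s.head.1, h := s.head.2, pc := .testFront } with hs'
  have L := I.loc i l hl.1
  have hproc : ∀ j, j ≠ i → s'.proc j = s.proc j := fun j hj => by
    simp [hs', Config.setLoc, hj]
  have hproci : s'.proc i = some { l with h1 := s.head.1, h := s.head.2, pc := .testFront } := by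
    simp [hs', Config.setLoc]
  have hother : ∀ j e, j ≠ i → (s'.view ρ).seeks j e → (s.view ρ).seeks j e :=
    fun j e hj h => (Config.seeks_setLoc_of_ne hj e).1 h
  have hself : ∀ e, (s'.view ρ).seeks i e → ∃ a, s.head.1 = some a ∧ (s.view ρ).item a ≠ some e := by
    rintro e ⟨m, a, h1, h2, h3, h4, h5⟩
    rw [hproci] at h1; cases h1
    exact ⟨a, h3, h4⟩
  have hsk : ∀ j e, (s'.view ρ).seeks j e → (s.view ρ).seeks j e ∨
      ∃ a, (s.view ρ).head.1 = some a ∧ (s.view ρ).item a ≠ some e := by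
    intro j e h
    by_cases hj : j = i
    · subst hj; exact .inr (hself e h)
    · exact .inl (hother j e hj h)
  have hp : (s'.view ρ).priv = (s.view ρ).priv := by
    refine funext fun x => propext (exists_congr fun j => ?_)
    by_cases hj : j = i
    · subst hj; rw [hproci, hl.1]; simp [hl.2]
    · rw [hproc j hj]
  have hv : s'.view ρ = (fun V : View Item p => { V with seeks := (s'.view ρ).seeks }) (s.view ρ) :=
    View.ext rfl rfl rfl rfl rfl rfl rfl rfl hp rfl
  refine I.update (i := i) hproc (fun j hj _ => rfl)
    (fun h => by rw [hproci] at h; cases h) (fun m hm y hy => ?_) ?_ ?_ (fun m hm => ?_)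
  · rw [hproci] at hm; cases hm; exact .inl ⟨l, hl.1, hy⟩
  · rw [hv]; exact I.glob.seek hsk
  · rw [hv]; exact I.glob.evolves_seek hsk fun j e hj => hother j e hj
  · rw [hproci] at hm; cases hm
    rw [hv]
    refine L.toTestFront I.glob hl.2 (fun a ha h => ?_) hseen
    obtain ⟨a', h1, h2⟩ := hself _ h
    have ha' : s.head.1 = some a := ha
    rw [ha'] at h1; cases h1; exact h2

/-- Process `i` withdraws its announcement and is about to return `l'.res`. -/
theorem withdraw (I : Inv s ρ items seen) (hl : s.proc i = some l) (hq : l.pc.quiet = false)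
    (he : l'.e = l.e) (hg : l'.g = l.g) (hh1 : l'.h1 = l.h1) (hh : l'.h = l.h)
    (hpc : l'.pc = .ret) (hres : l.e ∈ items →
      ∃ x, l'.res = .pointer (some x) ∧ seen i x ∧ (s.view ρ).item x = some l.e)
    (hres' : l.e ∉ items → l'.res = .notPresent) :
    Inv (({ s with ann := Function.update s.ann i (none, none) } : Config Item p).setLoc i l')
      ρ items seen := by
  have L := I.loc i l hl
  set t : Config Item p := { s with ann := Function.update s.ann i (none, none) } with ht
  have hanne : ∀ j, j ≠ i → t.ann j = s.ann j := fun j hj => by simp [ht, hj]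
  have hanni : t.ann i = (none, none) := by simp [ht]
  have hsk : ∀ j e, (t.view ρ).seeks j e → (s.view ρ).seeks j e ∧ t.ann j = s.ann j := by
    rintro j e ⟨m, a, h1, h2, h3, h4, h5⟩
    by_cases hj : j = i
    · subst hj; rw [hanni] at h5; cases h5
    · rw [hanne j hj] at h5; exact ⟨⟨m, a, h1, h2, h3, h4, h5⟩, hanne j hj⟩
  refine I.update_setLoc (t := t) hl rfl (fun j hj => ?_) he hg hh1 ?_ ?_ ?_ ?_ ?_
  · exact hanne j (by rintro rfl; rw [hl] at hj; cases hj)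
  · intro h; rw [h] at hq; cases hq
  · rw [hpc]; simp
  · refine I.glob.setAnn (ann' := t.ann) (seeks' := (t.view ρ).seeks) (priv' := (s.view ρ).priv)
      (fun j e h => (hsk j e h).1) (fun j y hy => ?_)
    by_cases hj : j = i
    · subst hj; rw [hanni] at hy; cases hy
    · rw [hanne j hj] at hy; exact I.glob.annAlloc j y hy
  · refine View.evolves_setAnn (ann' := t.ann) (seeks' := (t.view ρ).seeks)
      (priv' := (s.view ρ).priv) hsk (fun y hy => hy)
      (fun j m hj _ => .inl (hanne j hj)) (fun j y e h => ?_)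
    by_cases hj : j = i
    · subst hj; rw [hanni] at h; cases h
    · rw [hanne j hj] at h; exact .inl h
  · have hns : ∀ e, ¬ (t.view ρ).seeks i e := by
      rintro e ⟨m, a, h1, h2, h3, h4, h5⟩; rw [hanni] at h5; cases h5
    constructor
    all_goals try rw [hpc]
    all_goals first
      | (intro h; cases h; done) | (rintro (h | h) <;> cases h; done) | skip
    case gItem => rw [hg, he]; exact L.gItem
    case gSome => intro _; rw [hg]; exact L.gSome (by rintro h; rw [h] at hq; cases hq)
    case h1Mem => rw [hh1]; exact L.h1Mem
    case hMem => rw [hh]; exact L.hMem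
    case quiet => exact fun _ => hanni
    case trav => exact fun h => absurd h (hns _)
    case ret => rw [he]; exact fun _ => ⟨hres, hres'⟩

theorem setOld (I : Inv s ρ items seen) (hl : s.At i l .setOld) (hx : s.Pts l.g x v) :
    Inv ((s.casOld x v (.ptr none) (.ptr l.h)).setLoc i { l with pc := .setNew }) ρ items seen := by
  have L := I.loc i l hl.1
  have hu := L.unlinked (by rw [hl.2]; rfl) x hx.1
  have ho := L.gOld (by rw [hl.2]; rfl) x hx.1
  rw [Config.view_old hx.2] at ho
  simp only [Config.casOld, if_pos ho]
  have hv := Config.view_setOld (V := s.view ρ) rfl (y := .ptr l.h) hx.2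
  refine I.update_setLoc (ρ' := ρ) hl.1 rfl (fun j hj => rfl) rfl rfl rfl (by simp [hl.2]) (by simp)
    ?_ ?_ ?_
  · rw [hv]; exact I.glob.setOld hu.1 hu.2
  · rw [hv]; refine I.glob.evolves_setOld hu.1 fun j m hj hm h => hj (I.own j i m l x hm hl.1 h hx.1)
  · rw [hv]; exact L.toSetNew I.glob hl.2 hx.1

theorem setNew (I : Inv s ρ items seen) (hl : s.At i l .setNew) (hx : s.Pts l.h x v) :
    Inv ((s.casNew x v (.ptr none) (.ptr l.g)).setLoc i { l with pc := .getNew }) ρ items seen := by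
  have L := I.loc i l hl.1
  by_cases h : v.new = .ptr none
  · obtain ⟨g, hg⟩ := Option.ne_none_iff_exists'.1 (L.gSome (by simp [hl.2]))
    have hu := L.unlinked (by rw [hl.2]; rfl) g hg
    have ho := L.setNew hl.2 g hg
    rw [hx.1] at ho
    have hm := L.hMem x hx.1
    have hfd := L.found (by rw [hl.2]; rfl) x hx.1
    have hgi : (s.view ρ).item g = some l.e := L.gItem g hg
    simp only [Config.casNew, if_pos h]
    have hv := Config.view_setNew (V := s.view ρ) rfl (y := .ptr l.g) hx.2
    rw [hg] at hv
    have hn : (s.view ρ).new x = .ptr none := by rw [Config.view_new hx.2, h]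
    refine I.update_setLoc (ρ' := ρ) hl.1 rfl (fun j hj => rfl) rfl rfl rfl (by simp [hl.2])
      (by simp) ?_ ?_ ?_
    · rw [hg, hv]; exact I.glob.setNew hm.1 hn hm.2 hu.1 (hgi.trans hfd.symm) ho
    · rw [hg, hv]
      exact View.evolves_setNew hm.1 hn fun j m hj hm h => hj (I.own j i m l g hm hl.1 h hg)
    · rw [Config.view_setNew (V := s.view ρ) rfl hx.2]
      exact L.toGetNew_of_setNew hl.2 hx.1 (by rw [hg]; simp)
  · simp only [Config.casNew, if_neg h]
    refine I.setLoc hl.1 rfl rfl rfl (by simp [hl.2]) (by simp) (L.toGetNew hl.2 fun y hy => ?_)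
    rw [hx.1] at hy; cases hy
    rwa [Config.view_new hx.2]

theorem prepend (I : Inv s ρ items seen) (hl : s.At i l .prepend) :
    ∃ ρ', Inv ((s.casHead (l.k1, l.k2) (l.g', l.k1)).setLoc i { l with pc := .outer }) ρ' items seen
      ∧ ∀ x, 0 < ρ x → ρ' x = ρ x := by
  have L := I.loc i l hl.1
  by_cases h : s.head = (l.k1, l.k2)
  · obtain ⟨x, g, h1, h2, -, h4⟩ := L.moving (by rw [hl.2]; rfl)
    obtain ⟨a, b, h5, h6, -⟩ := L.gotHead (by rw [hl.2]; rfl)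
    have hg : ρ g = 0 := L.prepend hl.2 (congrArg Prod.fst h) g h2
    -- GONE is impossible here: in that case the replacement has positive rank, but `g` has rank 0.
    have hn : (s.view ρ).new x = .ptr (some g) := by
      rcases h4 with h4 | h4
      · exact h4
      · have : 0 < ρ g := h4.2
        omega
    have ho := L.oldDone (.inr hl.2) a h5
    have hm := L.hMem x h1
    simp only [Config.casHead, if_pos h]
    rw [h5, h6] at h
    have hv : ({ s with head := (l.g', l.k1) } : Config Item p).view
        (Function.update ρ g (ρ a + 1)) = (s.view ρ).prepend a g := by rw [h2, h5]; rfl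
    refine ⟨Function.update ρ g (ρ a + 1), ?_, fun y hy => ?_⟩
    · refine I.mem_setLoc (t := { s with head := (l.g', l.k1) }) hl.1 rfl (fun j hj => rfl)
        rfl rfl rfl (by simp [hl.2]) (by simp) ?_ ?_ ?_
      · rw [hv]
        exact I.glob.prepend (V := s.view ρ) h ho hm.1 hg hn
      · rw [hv]
        exact I.glob.evolves_prepend (V := s.view ρ) h ho hm.1 hg hn
      · exact fun L' => L'.toOuter (.inr (.inl hl.2))
    · rw [Function.update_of_ne]; rintro rfl; omega
  · simp only [Config.casHead, if_neg h]
    exact ⟨ρ, I.setLoc hl.1 rfl rfl rfl (by simp [hl.2]) (by simp) (L.toOuter (.inr (.inl hl.2))),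
      fun _ _ => rfl⟩

theorem setNext (I : Inv s ρ items seen) (hl : s.At i l .setNext) (hx : s.Pts l.k1 x v) :
    Inv ((s.casNext x v none l.k2).setLoc i { l with pc := .setPrev }) ρ items seen := by
  have L := I.loc i l hl.1
  obtain ⟨x', y, h1, h2, h3, h4, h5⟩ := L.gotHead (by rw [hl.2]; rfl)
  rw [hx.1] at h1; cases h1
  by_cases h : v.next = none
  · simp only [Config.casNext, if_pos h]
    have hv := Config.view_setNext (V := s.view ρ) rfl (y := l.k2) hx.2
    rw [h2] at hv
    have hs : ∀ w, (s.view ρ).Prot w → (s.view ρ).rank w < (s.view ρ).rank x →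
        ∃ u, some y = some u ∧ (s.view ρ).rank w ≤ (s.view ρ).rank u :=
      fun w _ hr => ⟨y, rfl, h5 w hr⟩
    have hx0 : 0 < (s.view ρ).rank x := by omega
    refine I.mem_setLoc (ρ' := ρ) hl.1 rfl (fun j hj => rfl) rfl rfl rfl (by simp [hl.2]) (by simp)
      ?_ ?_ fun L' => L'.toSetPrev hl.2 fun z hz _ => ?_
    · rw [h2, hv]
      exact I.glob.setNext hx0 (fun u hu => by cases hu; exact ⟨h3, h4⟩) hs
    · rw [h2, hv]; exact I.glob.evolves_setNext hx0 hs
    · rw [hx.1] at hz; cases hz; rw [h2, hv]; simp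
  · simp only [Config.casNext, if_neg h]
    refine I.setLoc hl.1 rfl rfl rfl (by simp [hl.2]) (by simp) (L.toSetPrev hl.2 fun z hz _ => ?_)
    rw [hx.1] at hz; cases hz
    rwa [Config.view_next hx.2]

theorem setPrev (I : Inv s ρ items seen) (hl : s.At i l .setPrev) (hx : s.Pts l.k2 x v) :
    Inv ((s.casPrev x v none l.k1).setLoc i { l with pc := .getItem }) ρ items seen := by
  have L := I.loc i l hl.1
  obtain ⟨y, x', h1, h2, h3, h4, h5⟩ := L.gotHead (by rw [hl.2]; rfl)
  rw [hx.1] at h2; cases h2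
  by_cases h : v.prev = none
  · simp only [Config.casPrev, if_pos h]
    have hv := Config.view_setPrev (V := s.view ρ) rfl (y := l.k1) hx.2
    rw [h1] at hv
    refine I.mem_setLoc (ρ' := ρ) hl.1 rfl (fun j hj => rfl) rfl rfl rfl (by simp [hl.2]) (by simp)
      ?_ ?_ fun L' => L'.toGetItem hl.2 fun z hz => ?_
    · rw [h1, hv]; exact I.glob.setPrev h3 (by omega)
    · rw [h1, hv]; exact View.evolves_setPrev x y
    · rw [hx.1] at hz; cases hz; rw [h1, hv]; simp
  · simp only [Config.casPrev, if_neg h]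
    refine I.setLoc hl.1 rfl rfl rfl (by simp [hl.2]) (by simp) (L.toGetItem hl.2 fun z hz => ?_)
    rw [hx.1] at hz; cases hz
    rwa [Config.view_prev hx.2]

/-- If the CAS succeeds, `j` is still in the operation whose announcement was read, it searches for
the item of `x`, and it was running while `x` was at the front. Hence `x` is a valid answer for it.
-/
theorem inform [DecidableEq Item] {j : Fin p} (I : Inv s ρ items seen) (hl : s.At i l .inform)
    (hj : l.j = some j) :
    Inv ((s.casAnn j (l.a, l.b) (l.k1, none)).setLoc i { l with pc := .readAnn }) ρ items seen := by
  have L := I.loc i l hl.1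
  by_cases h : s.ann j = (l.a, l.b)
  · simp only [Config.casAnn, if_pos h]
    obtain ⟨x, w, h1, -, h3, -⟩ := L.helping (by rw [hl.2]; rfl)
    obtain ⟨j', h4, h5, -⟩ := L.informingOne (by rw [hl.2]; rfl)
    rw [hj] at h4; cases h4
    have hx0 : 0 < (s.view ρ).rank x := by have := h3.2.2.1; omega
    have hxi := (L.informing (by rw [hl.2]; rfl) x h1).1
    have hsn := L.inform hl.2 j x hj h h1
    rw [h5] at h
    obtain ⟨m, hm⟩ : ∃ m, s.proc j = some m := by
      cases hp : s.proc j with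
      | none => rw [I.idle j hp] at h; simp at h
      | some m => exact ⟨m, rfl⟩
    have Lm := I.loc j m hm
    have hmq : m.pc.quiet = false := by
      by_contra hq
      have := Lm.quiet (by simpa using hq)
      have h' : (s.view ρ).ann j = (l.a, some l.e') := h
      rw [this] at h'; simp at h'
    have hme : s.ann j = (m.g, some m.e) := by
      rcases Lm.announced hmq with h' | ⟨y, h', -⟩
      · exact h'
      · have h'' : s.ann j = (some y, none) := h'
        rw [h] at h''; simp at h''
    have hee : m.e = l.e' := by rw [h] at hme; simp at hme; exact hme.2.symm
    set t : Config Item p := { s with ann := Function.update s.ann j (l.k1, none) } with ht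
    have hanne : ∀ k, k ≠ j → t.ann k = s.ann k := fun k hk => by simp [ht, hk]
    have hannj : t.ann j = (some x, none) := by simp [ht, h1]
    have hsk : ∀ k e, (t.view ρ).seeks k e → (s.view ρ).seeks k e ∧ t.ann k = s.ann k := by
      rintro k e ⟨m, a, h1, h2, h3, h4, h5⟩
      by_cases hk : k = j
      · subst hk; rw [hannj] at h5; cases h5
      · rw [hanne k hk] at h5; exact ⟨⟨m, a, h1, h2, h3, h4, h5⟩, hanne k hk⟩
    obtain ⟨e, hei, he⟩ := I.glob.itm x hx0
    rw [hxi] at he; cases he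
    refine I.mem_setLoc (t := t) (ρ' := ρ) hl.1 rfl (fun k hk => ?_) rfl rfl rfl (by simp [hl.2])
      (by simp) ?_ ?_ fun L' => L'.toReadAnn_of_inform hl.2 hj fun h' => ?_
    · exact hanne k (by rintro rfl; rw [hm] at hk; cases hk)
    · refine I.glob.setAnn (ann' := t.ann) (seeks' := (t.view ρ).seeks) (priv' := (s.view ρ).priv)
        (fun k e h => (hsk k e h).1) (fun k y hy => ?_)
      by_cases hk : k = j
      · subst hk; rw [hannj] at hy; cases hy
        refine ⟨by rw [hxi]; simp, ?_⟩
        rintro ⟨k', m', h6, h7, h8⟩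
        have : (s.view ρ).rank x = 0 := ((I.loc k' m' h6).unlinked (by rw [h7]; rfl) x h8).1
        omega
      · rw [hanne k hk] at hy; exact I.glob.annAlloc k y hy
    · refine View.evolves_setAnn (ann' := t.ann) (seeks' := (t.view ρ).seeks)
        (priv' := (s.view ρ).priv) hsk (fun y hy => hy) (fun k m' _ hm' => ?_) (fun k y e h => ?_)
      · by_cases hk : k = j
        · subst hk; rw [hm] at hm'; cases hm'
          exact .inr ⟨hme, hee ▸ hei, x, hannj, hsn, hee ▸ hxi, hx0⟩
        · exact .inl (hanne k hk)
      · by_cases hk : k = j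
        · subst hk; rw [hannj] at h; cases h
        · rw [hanne k hk] at h; exact .inl h
    · have h'' : t.ann j = (l.a, l.b) := h'
      rw [hannj, h5] at h''; simp at h''
  · simp only [Config.casAnn, if_neg h]
    exact I.setLoc hl.1 rfl rfl rfl (by simp [hl.2]) (by simp)
      (L.toReadAnn_of_inform hl.2 hj fun h' => absurd h' h)

/-- All searchers have been informed, or the front has moved on or is DONE; in each case `w` is
unprotected. Below `pred` the redirected pointer then misses `w` at most, even if `pred` itself has
left the list. -/
theorem remove1 (I : Inv s ρ items seen) (hl : s.At i l .remove1) (hx : s.Pts l.pred x v) :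
    Inv ((s.casNext x v l.h' l.succ).setLoc i { l with pc := .remove2 }) ρ items seen := by
  have L := I.loc i l hl.1
  by_cases h : v.next = l.h'
  · simp only [Config.casNext, if_pos h]
    obtain ⟨k, w, h1, h2, h3, -⟩ := L.helping (by rw [hl.2]; rfl)
    obtain ⟨y, h4, h5⟩ := L.gotPrev (by rw [hl.2]; rfl)
    rw [hx.1] at h4; cases h4
    obtain ⟨h6, h7⟩ := L.gotNext (by rw [hl.2]; rfl) w h2
    have hnw : ¬ (s.view ρ).Prot w :=
      I.glob.not_prot h3 fun hh ho => L.allInformed (by rw [hl.2]; rfl) k h1 hh ho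
    have hn : (s.view ρ).next x = some w := by rw [Config.view_next hx.2, h, h2]
    have hwx := I.glob.nxt x w h5 hn
    have hv := Config.view_setNext (V := s.view ρ) rfl (y := l.succ) hx.2
    have hs : ∀ z, (s.view ρ).Prot z → (s.view ρ).rank z < (s.view ρ).rank x →
        ∃ u, l.succ = some u ∧ (s.view ρ).rank z ≤ (s.view ρ).rank u := by
      intro z hz hr
      refine h7 z hz ?_
      have hzw : z ≠ w := by rintro rfl; exact hnw hz
      rcases I.glob.noskip x z h5 hz hr with ⟨u, hu, hu'⟩ | ⟨-, -, hu⟩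
      · rw [hn] at hu; cases hu
        -- `z` is protected and `w` is not, so they differ; thus `z` lies strictly below `w` and is
        -- covered by `succ`.
        exact lt_of_le_of_ne hu' fun h => hzw (I.glob.inj z w hz.1 h)
      · rw [hn] at hu; cases hu
    refine I.mem_setLoc (ρ' := ρ) hl.1 rfl (fun j hj => rfl) rfl rfl rfl (by simp [hl.2]) (by simp)
      ?_ ?_ fun L' => L'.toRemove2 hl.2
    · rw [hv]
      exact I.glob.setNext h5 (fun u hu => ⟨(h6 u hu).1, (h6 u hu).2.trans hwx.2⟩) hs
    · rw [hv]; exact I.glob.evolves_setNext h5 hs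
  · simp only [Config.casNext, if_neg h]
    exact I.setLoc hl.1 rfl rfl rfl (by simp [hl.2]) (by simp) (L.toRemove2 hl.2)

theorem remove2 (I : Inv s ρ items seen) (hl : s.At i l .remove2) (hx : s.Pts l.succ x v) :
    Inv ((s.casPrev x v l.h' l.pred).setLoc i { l with pc := .gone }) ρ items seen := by
  have L := I.loc i l hl.1
  by_cases h : v.prev = l.h'
  · simp only [Config.casPrev, if_pos h]
    obtain ⟨k, w, h1, h2, h3, -⟩ := L.helping (by rw [hl.2]; rfl)
    obtain ⟨y, h4, h5⟩ := L.gotPrev (by rw [hl.2]; rfl)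
    have h6 := ((L.gotNext (by rw [hl.2]; rfl) w h2).1 x hx.1).1
    have hv := Config.view_setPrev (V := s.view ρ) rfl (y := l.pred) hx.2
    rw [h4] at hv
    refine I.mem_setLoc (ρ' := ρ) hl.1 rfl (fun j hj => rfl) rfl rfl rfl (by simp [hl.2]) (by simp)
      ?_ ?_ fun L' => L'.toGone hl.2
    · rw [h4, hv]; exact I.glob.setPrev h6 h5
    · rw [h4, hv]; exact View.evolves_setPrev x y
  · simp only [Config.casPrev, if_neg h]
    exact I.setLoc hl.1 rfl rfl rfl (by simp [hl.2]) (by simp) (L.toGone hl.2)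

theorem gone (I : Inv s ρ items seen) (hl : s.At i l .gone) (hx : s.Pts l.h' x v) :
    Inv ((s.casNew x v (.ptr l.k1) .GONE).setLoc i { l with pc := .done }) ρ items seen := by
  have L := I.loc i l hl.1
  by_cases h : v.new = .ptr l.k1
  · simp only [Config.casNew, if_pos h]
    obtain ⟨k, w, h1, h2, h3, -⟩ := L.helping (by rw [hl.2]; rfl)
    rw [hx.1] at h2; cases h2
    have hnw : ¬ (s.view ρ).Prot x :=
      I.glob.not_prot h3 fun hh ho => L.allInformed (by rw [hl.2]; rfl) k h1 hh ho
    have hv := Config.view_setNew (V := s.view ρ) rfl (y := .mark) hx.2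
    refine I.mem_setLoc (ρ' := ρ) hl.1 rfl (fun j hj => rfl) rfl rfl rfl (by simp [hl.2]) (by simp)
      ?_ ?_ fun L' => L'.toDone hl.2
    · rw [hv]; exact I.glob.setGone h3.1 hnw
    · rw [hv]
      refine View.evolves_setGone (g := k) (by have := h3.2.2.1; omega) ?_
      rw [Config.view_new hx.2, h, h1]
  · simp only [Config.casNew, if_neg h]
    exact I.setLoc hl.1 rfl rfl rfl (by simp [hl.2]) (by simp) (L.toDone hl.2)

theorem done (I : Inv s ρ items seen) (hl : s.At i l .done) (hx : s.Pts l.k1 x v) :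
    Inv ((s.casOld x v (.ptr l.h') .DONE).setLoc i { l with pc := .outer }) ρ items seen := by
  have L := I.loc i l hl.1
  by_cases h : v.old = .ptr l.h'
  · simp only [Config.casOld, if_pos h]
    obtain ⟨k, w, h1, h2, h3, -⟩ := L.helping (by rw [hl.2]; rfl)
    rw [hx.1] at h1; cases h1
    obtain ⟨k', y, h4, h5, h6, h7, h8⟩ := L.gotHead (by rw [hl.2]; rfl)
    rw [hx.1] at h4; cases h4
    have hxo : (s.view ρ).old x ≠ .mark := by rw [Config.view_old hx.2, h]; simp
    have hh : (s.view ρ).head.1 = some x := by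
      rcases I.glob.old x (by omega) with h' | h'
      · exact absurd h' hxo
      · exact h'.1
    have hv := Config.view_setOld (V := s.view ρ) rfl (y := .mark) hx.2
    refine I.mem_setLoc (ρ' := ρ) hl.1 rfl (fun j hj => rfl) rfl rfl rfl (by simp [hl.2]) (by simp)
      ?_ ?_ fun L' => L'.toOuter (.inr (.inr hl.2))
    · rw [hv]
      refine I.glob.setDone hh (L.nextSet (by rw [hl.2]; rfl) x hx.1 hh) fun b hb => ?_
      obtain ⟨a, b', g1, g2, g3, g4, g5⟩ := I.glob.hd
      rw [g1] at hb hh; cases hb; cases hh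
      -- `x` is still at the front and `k2` is next to it in rank, so `k2` is the present second
      -- node and its `prev` is known to be set.
      have : y = b := by
        refine I.glob.inj y b h6 (le_antisymm (g5 y ?_) (h8 b g3))
        rintro rfl; omega
      subst this
      exact L.prevSet (by rw [hl.2]; rfl) y h5
    · rw [hv]
      exact I.glob.evolves_setDone hh fun ho => L.allInformed (by rw [hl.2]; rfl) x hx.1 hh ho
  · simp only [Config.casOld, if_neg h]
    exact I.setLoc hl.1 rfl rfl rfl (by simp [hl.2]) (by simp) (L.toOuter (.inr (.inr hl.2)))

end Inv

/-! ### Every step preserves the invariant -/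

namespace Inv

variable {s s' : Config Item p} {ρ : Addr → ℕ} {items : List Item}
  {seen : Fin p → Addr → Prop} {i : Fin p} {l l' : Loc Item p} {φ : ℕ}

/-- A process that has been informed returns a pointer to a node that was at the front. -/
theorem exists_of_informed (I : Inv s ρ items seen) (hl : s.proc i = some l)
    (hq : l.pc.quiet = false) {a : Ptr} (h : s.ann i = (a, none)) :
    l.e ∈ items ∧ ∃ x, a = some x ∧ seen i x ∧ (s.view ρ).item x = some l.e := by
  rcases (I.loc i l hl).announced hq with h' | ⟨x, h1, h2, h3, h4⟩
  · have : s.ann i = (l.g, some l.e) := h'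
    rw [h] at this; simp at this
  · have : s.ann i = (some x, none) := h1
    rw [h] at this
    obtain ⟨e, he, he'⟩ := I.glob.itm x h4
    rw [h3] at he'; cases he'
    exact ⟨he, x, by simpa using this, h2, h3⟩

/-- The last step of a search by a process that has been informed. -/
theorem withdraw_informed [DecidableEq Item] (I : Inv s ρ items seen) (hl : s.proc i = some l)
    (hq : l.pc.quiet = false) (ha : s.ann i = (l.a, l.b)) (hb : l.b = none) :
    Inv ((s.casAnn i (l.a, l.b) (none, none)).setLoc i
      { l with res := .pointer l.a, pc := .ret }) ρ items seen := by
  simp only [Config.casAnn, if_pos ha]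
  rw [hb] at ha
  obtain ⟨he, x, hx, h1, h2⟩ := I.exists_of_informed hl hq ha
  exact I.withdraw hl hq rfl rfl rfl rfl rfl (fun _ => ⟨x, by rw [hx], h1, h2⟩)
    fun h => absurd he h

theorem not_seeks (I : Inv s ρ items seen) (hl : s.proc i = some l) (hq : l.pc.quiet = false)
    (hs : l.pc.searching) (h : ¬ (s.view ρ).seeks i l.e) : (s.ann i).2 = none := by
  obtain ⟨a, h1, h2⟩ := (I.loc i l hl).searching hs
  exact (I.loc i l hl).informed hq fun h' => h (seeks_of_ann hl h1 h2 h')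

theorem step [DecidableEq Item] (I : Inv s ρ items seen)
    (hseen : ∀ j a, s.proc j ≠ none → s.head.1 = some a → seen j a)
    {lab : Label Item p} (h : Step φ s lab s') :
    ∃ ρ', Inv s' ρ' items seen ∧ ∀ x, 0 < ρ x → ρ' x = ρ x := by
  -- Only prepending changes the ranks.
  suffices h' : Inv s' ρ items seen ∨ _ from h'.elim (fun h => ⟨ρ, h, fun _ _ => rfl⟩) id
  cases h with
  | invoke i e h => exact .inl (I.invoke e h)
  | allocate i l x hl hx => exact .inl (I.allocate hl hx)
  | announce i l hl =>
    have : s.ann i = (none, none) := (I.loc i l hl.1).quiet (by rw [hl.2]; rfl)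
    simp only [Config.casAnn, if_pos this]
    exact .inl (I.announce hl)
  | getHead i l hl => exact .inl (I.getHead hl fun a => hseen i a (by rw [hl.1]; simp))
  | testFront i l x v hl hx =>
    left
    have L := I.loc i l hl.1
    have hi := Config.view_item (ρ := ρ) hx.2
    by_cases h : v.item = l.e
    · rw [if_pos h]
      exact I.setLoc hl.1 rfl rfl rfl (by simp [hl.2]) (by simp)
        (L.toUnannFront1 hl.2 ⟨x, hx.1, by rw [hi, h]⟩)
    · rw [if_neg h]
      exact I.setLoc hl.1 rfl rfl rfl (by simp [hl.2]) (by simp)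
        (L.toLoop_of_testFront hl.2 ⟨x, hx.1, by rw [hi]; simpa using h⟩)
  | unannFront1 i l hl =>
    left
    have L := I.loc i l hl.1
    obtain ⟨a, h1, h2⟩ := L.front (by rw [hl.2]; rfl)
    have h1' := L.h1Mem a h1
    by_cases h : (s.ann i).2 = none
    · have hne : s.ann i ≠ (l.g, some l.e) := by intro h'; rw [h'] at h; simp at h
      simp only [Config.casAnn, if_neg hne, if_pos h]
      exact I.setLoc hl.1 rfl rfl rfl (by simp [hl.2]) (by simp) (L.toUnannFront2 hl.2 h)
    · have heq : s.ann i = (l.g, some l.e) := by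
        rcases L.announced (by rw [hl.2]; rfl) with h' | ⟨y, h', -⟩
        · exact h'
        · have h'' : s.ann i = (some y, none) := h'
          rw [h''] at h; simp at h
      simp only [Config.casAnn, if_pos heq, if_neg h]
      refine I.withdraw hl.1 (by rw [hl.2]; rfl) rfl rfl rfl rfl rfl
        (fun _ => ⟨a, by rw [h1], h1'.2, h2⟩) fun he => ?_
      obtain ⟨e, he1, he2⟩ := I.glob.itm a h1'.1
      rw [h2] at he2; cases he2; exact absurd he1 he
  | unannFront2 i l hl =>
    left
    have L := I.loc i l hl.1
    obtain ⟨a, h1, h2⟩ := L.front (by rw [hl.2]; rfl)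
    have h1' := L.h1Mem a h1
    have ha : s.ann i = (l.a, l.b) := (L.withdrawing (by rw [hl.2]; rfl)).1
    simp only [Config.casAnn, if_pos ha]
    refine I.withdraw hl.1 (by rw [hl.2]; rfl) rfl rfl rfl rfl rfl
      (fun _ => ⟨a, by rw [h1], h1'.2, h2⟩) fun he => ?_
    obtain ⟨e, he1, he2⟩ := I.glob.itm a h1'.1
    rw [h2] at he2; cases he2; exact absurd he1 he
  | loop i l hl =>
    left
    have L := I.loc i l hl.1
    by_cases h : l.h = none
    · rw [if_pos h]
      exact I.setLoc hl.1 rfl rfl rfl (by simp [hl.2]) (by simp) (L.toReadAnn4 hl.2 h)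
    · rw [if_neg h]
      exact I.setLoc hl.1 rfl rfl rfl (by simp [hl.2]) (by simp) (L.toTestItem hl.2 h)
  | testItem i l x v hl hx =>
    left
    have L := I.loc i l hl.1
    have hi := Config.view_item (ρ := ρ) hx.2
    by_cases h : v.item = l.e
    · rw [if_pos h]
      refine I.setLoc hl.1 rfl rfl rfl (by simp [hl.2]) (by simp)
        (L.toReadAnn1 hl.2 fun y hy => ?_)
      rw [hx.1] at hy; cases hy; rw [hi, h]
    · rw [if_neg h]
      have h' : ∀ y, l.h = some y → (s.view ρ).item y ≠ some l.e := by
        intro y hy; rw [hx.1] at hy; cases hy; rw [hi]; simpa using h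
      by_cases hc : (l.c + 1) % φ = 0
      · simp only [if_pos hc]
        exact I.setLoc hl.1 rfl rfl rfl (by simp [hl.2]) (by simp) (L.toReadAnn3 hl.2 h')
      · simp only [if_neg hc]
        exact I.setLoc hl.1 rfl rfl rfl (by simp [hl.2]) (by simp) (L.toNext_of_testItem hl.2 h')
  | readAnn1 i l hl =>
    left
    have L := I.loc i l hl.1
    by_cases h : (s.ann i).2 = none
    · simp only [if_pos h]
      exact I.setLoc hl.1 rfl rfl rfl (by simp [hl.2]) (by simp) (L.toUnannOther1 hl.2 h)
    · simp only [if_neg h]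
      exact I.setLoc hl.1 rfl rfl rfl (by simp [hl.2]) (by simp) (L.toSetOld hl.2)
  | unannOther1 i l hl =>
    obtain ⟨h1, h2⟩ := (I.loc i l hl.1).withdrawing (by rw [hl.2]; rfl)
    exact .inl (I.withdraw_informed hl.1 (by rw [hl.2]; rfl) h1 h2)
  | setOld i l x v hl hx => exact .inl (I.setOld hl hx)
  | setNew i l x v hl hx => exact .inl (I.setNew hl hx)
  | getNewGone i l x v hl hx hv =>
    left
    have L := I.loc i l hl.1
    refine I.setLoc hl.1 rfl rfl rfl (by simp [hl.2]) (by simp) (L.toReadAnn2 hl.2 ?_)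
    refine I.not_seeks hl.1 (by rw [hl.2]; rfl) (by rw [hl.2]; rfl) ?_
    refine I.glob.not_seeks_of_gone L (by rw [hl.2]; rfl) hx.1 (I.glob.newGone x ?_)
    rw [Config.view_new hx.2, hv]
  | getNew i l x v a hl hx hv =>
    left
    have L := I.loc i l hl.1
    have h := L.getNew hl.2 x hx.1
    rw [Config.view_new hx.2, hv] at h
    cases a with
    | none => exact absurd rfl h
    | some y =>
      exact I.setLoc hl.1 rfl rfl rfl (by simp [hl.2]) (by simp)
        (L.toOuter_of_getNew I.glob hl.2 hx.1 (by rw [Config.view_new hx.2, hv]))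
  | readAnn2 i l hl =>
    exact .inl (I.setLoc hl.1 rfl rfl rfl (by simp [hl.2]) (by simp)
      ((I.loc i l hl.1).toUnannPostMTF hl.2))
  | unannPostMTF i l hl =>
    obtain ⟨h1, h2⟩ := (I.loc i l hl.1).withdrawing (by rw [hl.2]; rfl)
    exact .inl (I.withdraw_informed hl.1 (by rw [hl.2]; rfl) h1 h2)
  | readAnn3 i l hl =>
    left
    have L := I.loc i l hl.1
    by_cases h : (s.ann i).2 = none
    · simp only [if_pos h]
      exact I.setLoc hl.1 rfl rfl rfl (by simp [hl.2]) (by simp) (L.toUnannOther2 hl.2 h)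
    · simp only [if_neg h]
      exact I.setLoc hl.1 rfl rfl rfl (by simp [hl.2]) (by simp) (L.toNext_of_readAnn3 hl.2)
  | unannOther2 i l hl =>
    obtain ⟨h1, h2⟩ := (I.loc i l hl.1).withdrawing (by rw [hl.2]; rfl)
    exact .inl (I.withdraw_informed hl.1 (by rw [hl.2]; rfl) h1 h2)
  | next i l x v hl hx =>
    left
    have := (I.loc i l hl.1).toLoop_of_next I.glob hl.2 hx.1
    rw [Config.view_next hx.2] at this
    exact I.setLoc hl.1 rfl rfl rfl (by simp [hl.2]) (by simp) this
  | readAnn4 i l hl =>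
    left
    have L := I.loc i l hl.1
    refine I.setLoc hl.1 rfl rfl rfl (by simp [hl.2]) (by simp) (L.toUnannEnd hl.2 ?_)
    by_cases he : l.e ∈ items
    · left
      refine I.not_seeks hl.1 (by rw [hl.2]; rfl) (by rw [hl.2]; rfl) fun h => ?_
      -- The traversal has ended, while `trav` would give an uninformed searcher a current node.
      obtain ⟨x, v, h1, -⟩ := L.trav h he
      rw [L.readAnn4 hl.2] at h1; cases h1
    · exact .inr he
  | unannEnd i l hl =>
    left
    obtain ⟨h1, h2⟩ := (I.loc i l hl.1).unannEnd hl.2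
    by_cases h : l.b = none
    · simp only [if_pos h]
      exact I.withdraw_informed hl.1 (by rw [hl.2]; rfl) h1 h
    · have h1' : s.ann i = (l.a, l.b) := h1
      simp only [if_neg h, Config.casAnn, if_pos h1']
      have he := h2.resolve_left h
      exact I.withdraw hl.1 (by rw [hl.2]; rfl) rfl rfl rfl rfl rfl (fun h => absurd h he)
        fun _ => rfl
  | ret i l hl => exact .inl (I.ret hl)
  | outer i l x v hl hx =>
    left
    have L := I.loc i l hl.1
    by_cases h : v.old = .DONE
    · simp only [if_pos h]
      refine I.setLoc hl.1 rfl rfl rfl (by simp [hl.2]) (by simp) (L.toReadAnn2_of_outer hl.2 ?_)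
      refine I.not_seeks hl.1 (by rw [hl.2]; rfl) (by rw [hl.2]; rfl) ?_
      obtain ⟨u, y, h1, h2, h3, h4⟩ := L.moving (by rw [hl.2]; rfl)
      rw [hx.1] at h2; cases h2
      have hu := L.hMem u h1
      have hold : (s.view ρ).old x = .mark := by rw [Config.view_old hx.2, h]
      refine I.glob.not_seeks_of_gone L (by rw [hl.2]; rfl) h1 fun hp => ?_
      -- If `u.new` is still `x`, then DONE in `x` shows that `x` was prepended after `u`. So `u` is
      -- not the newest, and it is not being replaced either, since its replacement `x` would then
      -- be the front with `old` not DONE.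
      rcases h4 with h4 | h4
      · obtain ⟨h5, -, h6, h7⟩ := I.glob.newPtr u x hu.1 h4
        have hx0 : 0 < (s.view ρ).rank x := by
          by_contra h8
          rw [h7 (by omega)] at hold; cases hold
        obtain ⟨-, h8 | ⟨a, e, j, h8, h9, -⟩⟩ := hp
        · have := h8 x h5; have := h6 hx0; omega
        · rcases I.glob.old a (I.glob.head_mem h8) with h10 | ⟨-, w, h10, -, h11⟩
          · rw [h9] at h10; cases h10
          · rw [h9] at h10; cases h10
            rw [h4] at h11
            simp at h11; subst h11
            rw [h9] at hold; cases hold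
      · exact I.glob.newGone u h4.1 hp
    · simp only [if_neg h]
      exact I.setLoc hl.1 rfl rfl rfl (by simp [hl.2]) (by simp) (L.toGetHead2 hl.2)
  | getHead2 i l hl =>
    exact .inl (I.setLoc hl.1 rfl rfl rfl (by simp [hl.2]) (by simp)
      ((I.loc i l hl.1).toGetOld I.glob hl.2))
  | getOldDone i l x v hl hx hv =>
    left
    refine I.setLoc hl.1 rfl rfl rfl (by simp [hl.2]) (by simp)
      ((I.loc i l hl.1).toTestPrepend hl.2 fun y hy => ?_)
    rw [hx.1] at hy; cases hy; rw [Config.view_old hx.2, hv]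
  | getOld i l x v a hl hx hv =>
    exact .inl (I.setLoc hl.1 rfl rfl rfl (by simp [hl.2]) (by simp)
      ((I.loc i l hl.1).toSetNext I.glob hl.2 hx.1 (by rw [Config.view_old hx.2, hv])))
  | testPrepend i l x v hl hx =>
    left
    have L := I.loc i l hl.1
    by_cases h : v.old = .DONE
    · simp only [if_pos h]
      exact I.setLoc hl.1 rfl rfl rfl (by simp [hl.2]) (by simp) (L.toOuter (.inl hl.2))
    · simp only [if_neg h]
      refine I.setLoc hl.1 rfl rfl rfl (by simp [hl.2]) (by simp)
        (L.toPrepend hl.2 fun hh y hy => ?_)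
      rw [hx.1] at hy; cases hy
      -- A listed node that is not DONE is at the front. If `Head` has not moved, the front is `k1`,
      -- which is DONE; hence `g'` has never been prepended.
      by_contra h0
      rcases I.glob.old x (Nat.pos_of_ne_zero h0) with h1 | ⟨h1, w, h2, -⟩
      · rw [Config.view_old hx.2] at h1; exact h h1
      · rw [hh] at h1
        rw [L.oldDone (.inl hl.2) x h1] at h2; cases h2
  | prepend i l hl => exact .inr (I.prepend hl)
  | setNext i l x v hl hx => exact .inl (I.setNext hl hx)
  | setPrev i l x v hl hx => exact .inl (I.setPrev hl hx)
  | getItem i l x v hl hx =>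
    left
    refine I.setLoc hl.1 rfl rfl rfl (by simp [hl.2]) (by simp)
      ((I.loc i l hl.1).toReadAnn_of_getItem hl.2 fun y hy => ?_)
    rw [hx.1] at hy; cases hy; rw [Config.view_item hx.2]
  | readAnn i l j hl hj =>
    left
    have L := I.loc i l hl.1
    by_cases h : (s.ann j).2 = some l.e'
    · simp only [if_pos h]
      exact I.setLoc hl.1 rfl rfl rfl (by simp [hl.2]) (by simp) (L.toTestInform I.glob hl.2 h)
    · simp only [if_neg h]
      refine I.setLoc hl.1 rfl rfl rfl (by simp [hl.2]) (by simp) (L.toReadAnn hl.2 ?_)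
      rintro ⟨m, a, -, -, -, -, h'⟩
      exact h h'
  | testInform i l x v hl hx =>
    left
    have L := I.loc i l hl.1
    by_cases h : v.old = .DONE
    · simp only [if_pos h]
      refine I.setLoc hl.1 rfl rfl rfl (by simp [hl.2]) (by simp)
        (L.toReadAnn_of_testInform hl.2 fun y hy => ?_)
      rw [hx.1] at hy; cases hy; rw [Config.view_old hx.2, h]
    · simp only [if_neg h]
      refine I.setLoc hl.1 rfl rfl rfl (by simp [hl.2]) (by simp)
        (L.toInform hl.2 fun j y hj hy => ?_)
      rw [hx.1] at hy; cases hy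
      obtain ⟨_, w, h1, -, h3, -⟩ := L.helping (by rw [hl.2]; rfl)
      rw [hx.1] at h1; cases h1
      obtain ⟨j', -, h5, -⟩ := L.informingOne (by rw [hl.2]; rfl)
      have hj' : s.ann j = (l.a, l.b) := hj
      -- At this moment `x.old` is not DONE, so `x` is at the front; and if `A[j]` still holds the
      -- pair, then `j` is performing an operation.
      refine hseen j x (fun hp => ?_) ?_
      · rw [I.idle j hp, h5] at hj'; simp at hj'
      · rcases I.glob.old x (by have := h3.2.2.1; omega) with h1 | ⟨h1, -⟩
        · rw [Config.view_old hx.2] at h1; exact absurd h1 h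
        · exact h1
  | inform i l j hl hj => exact .inl (I.inform hl hj)
  | informed i l hl hj =>
    exact .inl (I.setLoc hl.1 rfl rfl rfl (by simp [hl.2]) (by simp)
      ((I.loc i l hl.1).toGetPrev hl.2 hj))
  | getPrev i l x v hl hx =>
    left
    have := (I.loc i l hl.1).toGetNext I.glob hl.2 hx.1
    rw [Config.view_prev hx.2] at this
    exact I.setLoc hl.1 rfl rfl rfl (by simp [hl.2]) (by simp) this
  | getNext i l x v hl hx =>
    left
    have := (I.loc i l hl.1).toRemove1 I.glob hl.2 hx.1
    rw [Config.view_next hx.2] at this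
    exact I.setLoc hl.1 rfl rfl rfl (by simp [hl.2]) (by simp) this
  | remove1 i l x v hl hx => exact .inl (I.remove1 hl hx)
  | remove2Null i l hl hx =>
    exact .inl (I.setLoc hl.1 rfl rfl rfl (by simp [hl.2]) (by simp)
      ((I.loc i l hl.1).toGone hl.2))
  | remove2 i l x v hl hx => exact .inl (I.remove2 hl hx)
  | gone i l x v hl hx => exact .inl (I.gone hl hx)
  | done i l x v hl hx => exact .inl (I.done hl hx)

end Inv

/-! ### The initial configuration -/

theorem IsInit.exists_inv {items : List Item} (hnodup : items.Nodup) (hlen : 2 ≤ items.length)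
    {s : Config Item p} (h : IsInit items s) (seen : Fin p → Addr → Prop) :
    ∃ ρ, Inv s ρ items seen := by
  obtain ⟨⟨addrs, hnd, hl, hheap, hnone, hhead⟩, hann, hproc⟩ := h
  -- Ranks decrease along the list, from its length at the front to 1 at the last node.
  let ρ : Addr → ℕ := fun x => if x ∈ addrs then addrs.length - addrs.idxOf x else 0
  have hρ : ∀ t (ht : t < addrs.length), ρ addrs[t] = addrs.length - t := by
    intro t ht
    simp only [ρ, List.getElem_mem, if_true, List.Nodup.idxOf_getElem hnd]
  have hmem : ∀ x, 0 < ρ x → ∃ t, ∃ ht : t < addrs.length, addrs[t] = x := by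
    intro x hx
    by_cases h : x ∈ addrs
    · obtain ⟨t, ht, h⟩ := List.getElem_of_mem h; exact ⟨t, ht, h⟩
    · simp [ρ, h] at hx
  have hnode : ∀ t (ht : t < addrs.length), s.heap addrs[t] = some
      { item := items[t]'(hl ▸ ht), next := addrs[t + 1]?,
        prev := if t = 0 then none else addrs[t - 1]?, old := .DONE, new := .ptr none } :=
    fun t ht => hheap t _ _ (by simp [ht]) (by simp [hl ▸ ht])
  have hout : ∀ x, ρ x = 0 → s.heap x = none := by
    intro x hx
    refine hnone x fun h => ?_
    obtain ⟨t, ht, rfl⟩ := List.getElem_of_mem h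
    rw [hρ t ht] at hx; omega
  have hitem : ∀ t (ht : t < addrs.length),
      (s.view ρ).item addrs[t] = some (items[t]'(hl ▸ ht)) :=
    fun t ht => Config.view_item (hnode t ht)
  have hns : ∀ j e, ¬ (s.view ρ).seeks j e := by
    rintro j e ⟨l, a, h, -⟩; rw [hproc] at h; cases h
  have hnew : ∀ x, (s.view ρ).new x = .ptr none := by
    intro x
    rcases Nat.eq_zero_or_pos (ρ x) with h | h
    · simp [Config.view, hout x h]
    · obtain ⟨t, ht, rfl⟩ := hmem x h
      rw [Config.view_new (hnode t ht)]
  have hold : ∀ x, 0 < ρ x → (s.view ρ).old x = .mark := by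
    intro x h
    obtain ⟨t, ht, rfl⟩ := hmem x h
    rw [Config.view_old (hnode t ht)]
  have h0 : 0 < addrs.length := by omega
  have h1 : 1 < addrs.length := by omega
  have hhd : s.head = (some addrs[0], some addrs[1]) := by
    rw [hhead]; simp [h0, h1]
  refine ⟨ρ, ⟨?_, fun i l h => ?_, fun i _ => hann i, fun i j l l' x h => ?_⟩⟩
  · constructor
    · intro x y hx hxy
      have hxy : ρ x = ρ y := hxy
      have hx : 0 < ρ x := hx
      obtain ⟨t, ht, rfl⟩ := hmem x hx
      obtain ⟨u, hu, rfl⟩ := hmem y (by omega)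
      rw [hρ t ht, hρ u hu] at hxy
      have : t = u := by omega
      subst this; rfl
    · intro x hx
      obtain ⟨t, ht, rfl⟩ := hmem x hx
      exact ⟨_, List.getElem_mem _, hitem t ht⟩
    · intro e he
      obtain ⟨t, ht, rfl⟩ := List.getElem_of_mem he
      have ht' : t < addrs.length := hl ▸ ht
      exact ⟨addrs[t], by show 0 < ρ _; rw [hρ t ht']; omega, hitem t ht'⟩
    · refine ⟨addrs[0], addrs[1], hhd, ?_, ?_, ?_, fun z hz => ?_⟩
      · show 0 < ρ _; rw [hρ]; omega
      · show ρ _ < ρ _; rw [hρ, hρ]; omega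
      · rw [hitem 0 h0, hitem 1 h1]
        simp [hnodup.getElem_inj_iff]
      · show ρ z ≤ ρ _
        rcases Nat.eq_zero_or_pos (ρ z) with h | h
        · omega
        · obtain ⟨t, ht, rfl⟩ := hmem z h
          rw [hρ, hρ]
          have : t ≠ 0 := by rintro rfl; exact hz rfl
          omega
    · exact fun x hx => .inl (hold x hx)
    · intro x y hx hy
      obtain ⟨t, ht, rfl⟩ := hmem x hx
      rw [Config.view_next (hnode t ht)] at hy
      obtain ⟨ht', rfl⟩ := List.getElem?_eq_some_iff.1 hy
      constructor
      · show 0 < ρ _; rw [hρ]; omega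
      · show ρ _ < ρ _; rw [hρ, hρ]; omega
    · intro x w hx hw hr
      left
      obtain ⟨t, ht, rfl⟩ := hmem x hx
      obtain ⟨u, hu, rfl⟩ := hmem w hw.1
      have hr : ρ _ < ρ _ := hr
      rw [hρ, hρ] at hr
      have ht' : t + 1 < addrs.length := by omega
      refine ⟨addrs[t + 1], ?_, ?_⟩
      · rw [Config.view_next (hnode t ht)]; simp [ht']
      · show ρ _ ≤ ρ _; rw [hρ, hρ]; omega
    · intro x y hx hy
      obtain ⟨t, ht, rfl⟩ := hmem x hx
      rw [Config.view_prev (hnode t ht)] at hy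
      dsimp only at hy
      split_ifs at hy
      obtain ⟨ht', rfl⟩ := List.getElem?_eq_some_iff.1 hy
      show 0 < ρ _; rw [hρ]; omega
    · intro x hx hne _
      obtain ⟨t, ht, rfl⟩ := hmem x hx
      have : t ≠ 0 := by
        rintro rfl; apply hne; show s.head.1 = _; rw [hhd]
      rw [Config.view_prev (hnode t ht)]
      have ht' : t - 1 < addrs.length := by omega
      simp [this, ht']
    · intro x g _ h; rw [hnew] at h; cases h
    · intro x z hx hr hi
      exfalso
      obtain ⟨t, ht, rfl⟩ := hmem x hx
      obtain ⟨u, hu, rfl⟩ := hmem z (lt_trans hx hr)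
      rw [hitem t ht, hitem u hu] at hi
      have : u = t := by simpa [hnodup.getElem_inj_iff] using hi
      subst this
      exact lt_irrefl _ hr
    · intro x h; rw [hnew] at h; cases h
    · intro x hx
      have := hout x hx
      exact ⟨by simp [Config.view, this], by simp [Config.view, this], hnew x⟩
    · intro j x hx
      have hx : (s.ann j).1 = some x := hx
      rw [hann] at hx; cases hx
  · rw [hproc] at h; cases h
  · rw [hproc] at h; cases h

/-! ### General facts about steps -/

section step

variable [DecidableEq Item] {s s' : Config Item p} {φ : ℕ} {lab : Label Item p}

/-- A step changes the memory at one address at most, and no item. -/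
theorem Step.heap (h : Step φ s lab s') : ∃ x, (∀ y, y ≠ x → s'.heap y = s.heap y) ∧
    ∀ v, s.heap x = some v → ∃ v', s'.heap x = some v' ∧ v'.item = v.item := by
  have hloc : ∀ {s'' : Config Item p}, s''.heap = s.heap →
      ∃ x, (∀ y, y ≠ x → s''.heap y = s.heap y) ∧
        ∀ v, s.heap x = some v → ∃ v', s''.heap x = some v' ∧ v'.item = v.item :=
    fun h => ⟨0, fun y _ => by rw [h], fun v hv => ⟨v, by rw [h, hv], rfl⟩⟩
  have hset : ∀ {x : Addr} {v v' : Node Item}, (s.heap x = some v → v'.item = v.item) →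
      (s.heap x = some v ∨ s.heap x = none) →
      ∃ z, (∀ y, y ≠ z → Function.update s.heap x (some v') y = s.heap y) ∧
        ∀ u, s.heap z = some u → ∃ v'', Function.update s.heap x (some v') z = some v'' ∧
          v''.item = u.item := by
    intro x v v' h h'
    refine ⟨x, fun y hy => by simp [hy], fun u hu => ⟨v', by simp, ?_⟩⟩
    rcases h' with h' | h'
    · rw [hu] at h'; cases h'; exact h hu
    · rw [hu] at h'; cases h'
  cases h with
  | allocate i l x hl hx =>
    exact hset (v := ⟨l.e, none, none, .ptr none, .ptr none⟩) (fun _ => rfl) (.inr hx)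
  | announce => exact hloc (by simp only [Config.casAnn]; split_ifs <;> rfl)
  | unannFront1 => exact hloc (by simp only [Config.casAnn]; split_ifs <;> rfl)
  | unannFront2 => exact hloc (by simp only [Config.casAnn]; split_ifs <;> rfl)
  | unannOther1 => exact hloc (by simp only [Config.casAnn]; split_ifs <;> rfl)
  | unannOther2 => exact hloc (by simp only [Config.casAnn]; split_ifs <;> rfl)
  | unannPostMTF => exact hloc (by simp only [Config.casAnn]; split_ifs <;> rfl)
  | unannEnd => exact hloc (by simp only [Config.casAnn]; split_ifs <;> rfl)
  | inform => exact hloc (by simp only [Config.casAnn]; split_ifs <;> rfl)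
  | prepend => exact hloc (by simp only [Config.casHead]; split_ifs <;> rfl)
  | setOld i l x v hl hx | done i l x v hl hx =>
    simp only [Config.casOld]; split_ifs
    · exact hset (v := v) (fun _ => rfl) (.inl hx.2)
    · exact hloc rfl
  | setNew i l x v hl hx | gone i l x v hl hx =>
    simp only [Config.casNew]; split_ifs
    · exact hset (v := v) (fun _ => rfl) (.inl hx.2)
    · exact hloc rfl
  | setNext i l x v hl hx | remove1 i l x v hl hx =>
    simp only [Config.casNext]; split_ifs
    · exact hset (v := v) (fun _ => rfl) (.inl hx.2)
    · exact hloc rfl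
  | setPrev i l x v hl hx | remove2 i l x v hl hx =>
    simp only [Config.casPrev]; split_ifs
    · exact hset (v := v) (fun _ => rfl) (.inl hx.2)
    · exact hloc rfl
  | _ => exact hloc rfl

/-- The process that takes a step is the only one whose local state changes. -/
theorem Step.proc_of_ne (h : Step φ s lab s') {i : Fin p} (hi : lab.proc ≠ i) :
    s'.proc i = s.proc i := by
  cases h <;>
    simp only [Label.proc] at hi <;>
    simp only [Config.setLoc, Config.setIdle, Config.casAnn, Config.casHead, Config.casOld,
      Config.casNew, Config.casNext, Config.casPrev, Config.setNode] <;>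
    (try split_ifs) <;> simp [Function.update_of_ne (Ne.symm hi)]

/-- A process performs the same operation until it returns. -/
theorem Step.proc_of_ne_ret (h : Step φ s lab s') {i : Fin p} {l : Loc Item p}
    (hl : s.proc i = some l) (hr : ∀ r, lab ≠ .ret i r) :
    ∃ l', s'.proc i = some l' ∧ l'.e = l.e := by
  by_cases hi : lab.proc = i
  · have key : ∀ {l₁ l₂ : Loc Item p} {q : PC} {s'' : Config Item p}, s.At i l₁ q →
        l₂.e = l₁.e → ∃ l', (s''.setLoc i l₂).proc i = some l' ∧ l'.e = l.e := by
      intro l₁ l₂ q s'' h1 h2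
      have : l₁ = l := Option.some.inj (h1.1.symm.trans hl)
      exact ⟨l₂, by simp [Config.setLoc], by rw [h2, this]⟩
    cases h with
    | invoke i e h => cases hi; cases hl.symm.trans h
    | ret i l => cases hi; exact absurd rfl (hr _)
    | _ => cases hi; exact key (by assumption) (by first | rfl | (split_ifs <;> rfl))
  · exact ⟨l, by rw [h.proc_of_ne hi, hl], rfl⟩

theorem Step.of_inv {i : Fin p} {e : Item} (h : Step φ s (.inv i e) s') :
    s.proc i = none ∧ ∃ l, s'.proc i = some l ∧ l.e = e := by
  cases h with
  | invoke i e h => exact ⟨h, { pc := .allocate, e := e }, by simp [Config.setLoc], rfl⟩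

theorem Step.of_ret {i : Fin p} {r : Result} (h : Step φ s (.ret i r) s') :
    ∃ l, s.At i l .ret ∧ l.res = r := by
  cases h with
  | ret i l hl => exact ⟨l, hl, rfl⟩

end step

/-! ### Each active process has a next step -/

namespace Inv

variable {s : Config Item p} {ρ : Addr → ℕ} {items : List Item}
  {seen : Fin p → Addr → Prop} {i : Fin p} {l : Loc Item p}

/-- A process that is performing an operation has a next step. -/
theorem exists_step [DecidableEq Item] (φ : ℕ) (I : Inv s ρ items seen)
    (hfin : {x | s.heap x ≠ none}.Finite)
    (hl : s.proc i = some l) : ∃ lab s', lab.proc = i ∧ Step φ s lab s' := by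
  have L := I.loc i l hl
  have key : ∀ {lab s'}, Step φ s lab s' → lab.proc = i →
    ∃ lab s', lab.proc = i ∧ Step φ s lab s' := fun h h' => ⟨_, _, h', h⟩
  have mem : ∀ x, 0 < (s.view ρ).rank x → ∃ v, s.heap x = some v := by
    intro x hx
    obtain ⟨e, -, h⟩ := I.glob.itm x hx
    exact Config.exists_of_view_item (by rw [h]; simp)
  have hH : l.pc.onNode → ∃ x v, s.Pts l.h x v := by
    intro h
    obtain ⟨x, hx⟩ := Option.ne_none_iff_exists'.1 (L.onNode h)
    obtain ⟨v, hv⟩ := mem x (L.hMem x hx).1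
    exact ⟨x, v, hx, hv⟩
  have hK : l.pc.gotHead → (∃ x v, s.Pts l.k1 x v) ∧ ∃ x v, s.Pts l.k2 x v := by
    intro h
    obtain ⟨x, y, h1, h2, h3, h4, -⟩ := L.gotHead h
    obtain ⟨v, hv⟩ := mem x (by omega)
    obtain ⟨w, hw⟩ := mem y h3
    exact ⟨⟨x, v, h1, hv⟩, y, w, h2, hw⟩
  have hO : l.pc.helping → ∃ x v, s.Pts l.h' x v := by
    intro h
    obtain ⟨x, w, -, h2, h3, -⟩ := L.helping h
    obtain ⟨v, hv⟩ := mem w h3.1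
    exact ⟨w, v, h2, hv⟩
  have hG : l.pc.moving → ∃ x v, s.Pts l.g' x v := by
    intro h
    obtain ⟨x, y, -, h2, h3, -⟩ := L.moving h
    obtain ⟨v, hv⟩ := Config.exists_of_view_item h3
    exact ⟨y, v, h2, hv⟩
  cases hq : l.pc with
  | allocate =>
    -- Allocation needs an unused address; one exists because only finitely many have been used.
    obtain ⟨x, hx⟩ := hfin.exists_notMem
    exact key (.allocate s i l x ⟨hl, hq⟩ (by simpa using hx)) rfl
  | announce => exact key (.announce s i l ⟨hl, hq⟩) rfl
  | getHead => exact key (.getHead s i l ⟨hl, hq⟩) rfl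
  | testFront =>
    obtain ⟨x, hx⟩ := Option.ne_none_iff_exists'.1 (L.testFront hq)
    obtain ⟨v, hv⟩ := mem x (L.h1Mem x hx).1
    exact key (.testFront s i l x v ⟨hl, hq⟩ ⟨hx, hv⟩) rfl
  | unannFront1 => exact key (.unannFront1 s i l ⟨hl, hq⟩) rfl
  | unannFront2 => exact key (.unannFront2 s i l ⟨hl, hq⟩) rfl
  | loop => exact key (.loop s i l ⟨hl, hq⟩) rfl
  | testItem =>
    obtain ⟨x, v, h⟩ := hH (by rw [hq]; rfl)
    exact key (.testItem s i l x v ⟨hl, hq⟩ h) rfl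
  | readAnn1 => exact key (.readAnn1 s i l ⟨hl, hq⟩) rfl
  | unannOther1 => exact key (.unannOther1 s i l ⟨hl, hq⟩) rfl
  | setOld =>
    obtain ⟨x, hx⟩ := Option.ne_none_iff_exists'.1 (L.gSome (by rw [hq]; simp))
    obtain ⟨v, hv⟩ := Config.exists_of_view_item (L.gAlloc x hx)
    exact key (.setOld s i l x v ⟨hl, hq⟩ ⟨hx, hv⟩) rfl
  | setNew =>
    obtain ⟨x, v, h⟩ := hH (by rw [hq]; rfl)
    exact key (.setNew s i l x v ⟨hl, hq⟩ h) rfl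
  | getNew =>
    obtain ⟨x, v, h⟩ := hH (by rw [hq]; rfl)
    cases hv : v.new with
    | mark => exact key (.getNewGone s i l x v ⟨hl, hq⟩ h hv) rfl
    | ptr a => exact key (.getNew s i l x v a ⟨hl, hq⟩ h hv) rfl
  | readAnn2 => exact key (.readAnn2 s i l ⟨hl, hq⟩) rfl
  | unannPostMTF => exact key (.unannPostMTF s i l ⟨hl, hq⟩) rfl
  | readAnn3 => exact key (.readAnn3 s i l ⟨hl, hq⟩) rfl
  | unannOther2 => exact key (.unannOther2 s i l ⟨hl, hq⟩) rfl
  | next =>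
    obtain ⟨x, v, h⟩ := hH (by rw [hq]; rfl)
    exact key (.next s i l x v ⟨hl, hq⟩ h) rfl
  | readAnn4 => exact key (.readAnn4 s i l ⟨hl, hq⟩) rfl
  | unannEnd => exact key (.unannEnd s i l ⟨hl, hq⟩) rfl
  | ret => exact key (.ret s i l ⟨hl, hq⟩) rfl
  | outer =>
    obtain ⟨x, v, h⟩ := hG (by rw [hq]; rfl)
    exact key (.outer s i l x v ⟨hl, hq⟩ h) rfl
  | getHead2 => exact key (.getHead2 s i l ⟨hl, hq⟩) rfl
  | getOld =>
    obtain ⟨x, v, h⟩ := (hK (by rw [hq]; rfl)).1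
    cases hv : v.old with
    | mark => exact key (.getOldDone s i l x v ⟨hl, hq⟩ h hv) rfl
    | ptr a => exact key (.getOld s i l x v a ⟨hl, hq⟩ h hv) rfl
  | testPrepend =>
    obtain ⟨x, v, h⟩ := hG (by rw [hq]; rfl)
    exact key (.testPrepend s i l x v ⟨hl, hq⟩ h) rfl
  | prepend => exact key (.prepend s i l ⟨hl, hq⟩) rfl
  | setNext =>
    obtain ⟨x, v, h⟩ := (hK (by rw [hq]; rfl)).1
    exact key (.setNext s i l x v ⟨hl, hq⟩ h) rfl
  | setPrev =>
    obtain ⟨x, v, h⟩ := (hK (by rw [hq]; rfl)).2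
    exact key (.setPrev s i l x v ⟨hl, hq⟩ h) rfl
  | getItem =>
    obtain ⟨x, v, h⟩ := (hK (by rw [hq]; rfl)).1
    exact key (.getItem s i l x v ⟨hl, hq⟩ h) rfl
  | readAnn =>
    rcases Finset.eq_empty_or_nonempty l.todo with h | ⟨j, h⟩
    · exact key (.informed s i l ⟨hl, hq⟩ h) rfl
    · exact key (.readAnn s i l j ⟨hl, hq⟩ h) rfl
  | testInform =>
    obtain ⟨x, v, h⟩ := (hK (by rw [hq]; rfl)).1
    exact key (.testInform s i l x v ⟨hl, hq⟩ h) rfl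
  | inform =>
    obtain ⟨j, hj, -⟩ := L.informingOne (by rw [hq]; rfl)
    exact key (.inform s i l j ⟨hl, hq⟩ hj) rfl
  | getPrev =>
    obtain ⟨x, v, h⟩ := hO (by rw [hq]; rfl)
    exact key (.getPrev s i l x v ⟨hl, hq⟩ h) rfl
  | getNext =>
    obtain ⟨x, v, h⟩ := hO (by rw [hq]; rfl)
    exact key (.getNext s i l x v ⟨hl, hq⟩ h) rfl
  | remove1 =>
    obtain ⟨x, hx, h⟩ := L.gotPrev (by rw [hq]; rfl)
    obtain ⟨v, hv⟩ := mem x h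
    exact key (.remove1 s i l x v ⟨hl, hq⟩ ⟨hx, hv⟩) rfl
  | remove2 =>
    cases hx : l.succ with
    | none => exact key (.remove2Null s i l ⟨hl, hq⟩ hx) rfl
    | some x =>
      obtain ⟨_, w, -, hw, -⟩ := L.helping (by rw [hq]; rfl)
      obtain ⟨v, hv⟩ := mem x ((L.gotNext (by rw [hq]; rfl) w hw).1 x hx).1
      exact key (.remove2 s i l x v ⟨hl, hq⟩ ⟨hx, hv⟩) rfl
  | gone =>
    obtain ⟨x, v, h⟩ := hO (by rw [hq]; rfl)
    exact key (.gone s i l x v ⟨hl, hq⟩ h) rfl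
  | done =>
    obtain ⟨x, v, h⟩ := (hK (by rw [hq]; rfl)).1
    exact key (.done s i l x v ⟨hl, hq⟩ h) rfl

end Inv

/-! ### Termination of searches for absent items -/

/-- Positions of a process that does not find the item it searches for. -/
def PC.absent : PC → Bool
  | .allocate | .announce | .getHead | .testFront | .loop | .testItem | .readAnn3 | .next
  | .readAnn4 | .unannEnd | .ret => true
  | _ => false

/-- Number of positions before the start of the traversal. -/
def PC.stage : PC → ℕ
  | .allocate => 3
  | .announce => 2
  | .getHead => 1
  | _ => 0

/-- Bound on the number of steps before the traversal goes on or the search returns. -/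
def PC.weight : PC → ℕ
  | .testFront => 5
  | .loop => 4
  | .testItem | .readAnn4 => 3
  | .readAnn3 | .unannEnd => 2
  | .next | .ret => 1
  | _ => 0

/-- A quantity that decreases with each step of a search for an item that is not in the list. -/
def Loc.measure (ρ : Addr → ℕ) (l : Loc Item p) : ℕ ×ₗ ℕ :=
  -- Going from `next` to `loop` raises the weight by 3 and lowers the rank by at least 1, so any
  -- factor above 3 would do. Reading `Head` may raise the rank, but it lowers the stage.
  toLex (l.pc.stage, 8 * l.h.elim 0 ρ + l.pc.weight)

theorem Loc.measure_lt_iff {ρ ρ' : Addr → ℕ} {l l' : Loc Item p} :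
    l'.measure ρ' < l.measure ρ ↔ l'.pc.stage < l.pc.stage ∨ l'.pc.stage = l.pc.stage ∧
      8 * l'.h.elim 0 ρ' + l'.pc.weight < 8 * l.h.elim 0 ρ + l.pc.weight :=
  Prod.Lex.toLex_lt_toLex

namespace Inv

variable {s s' : Config Item p} {ρ ρ' : Addr → ℕ} {items : List Item}
  {seen seen' : Fin p → Addr → Prop} {i : Fin p} {l l' : Loc Item p} {φ : ℕ}

theorem absent (I : Inv s ρ items seen) (hl : s.proc i = some l) (he : l.e ∉ items) :
    l.pc.absent = true := by
  have L := I.loc i l hl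
  have mem : ∀ x, 0 < (s.view ρ).rank x → (s.view ρ).item x ≠ some l.e := by
    intro x hx h
    obtain ⟨e, h1, h2⟩ := I.glob.itm x hx
    rw [h] at h2; cases h2; exact he h1
  have hf : l.pc.found = false := by
    by_contra h
    rw [Bool.not_eq_false] at h
    obtain ⟨x, hx⟩ := Option.ne_none_iff_exists'.1
      (L.onNode (by revert h; cases l.pc <;> decide))
    exact mem x (L.hMem x hx).1 (L.found h x hx)
  have hh : l.pc.front = false := by
    by_contra h
    rw [Bool.not_eq_false] at h
    obtain ⟨x, hx, h'⟩ := L.front h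
    exact mem x (L.h1Mem x hx).1 h'
  have hw : l.pc.withdrawing = false := by
    by_contra h
    rw [Bool.not_eq_false] at h
    obtain ⟨h1, h2⟩ := L.withdrawing h
    rw [h2] at h1
    exact he (I.exists_of_informed hl (by revert h; cases l.pc <;> decide) h1).1
  have hr : l.pc ≠ .readAnn2 := by
    intro h
    have h1 : (s.ann i).2 = none := L.readAnn2 h
    exact he (I.exists_of_informed (a := (s.ann i).1) hl (by rw [h]; rfl)
      (Prod.ext rfl h1)).1
  revert hf hh hw hr
  cases l.pc <;> simp [PC.found, PC.moving, PC.front, PC.withdrawing, PC.absent]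

theorem measure_eq (I : Inv s ρ items seen) (hρ : ∀ x, 0 < ρ x → ρ' x = ρ x)
    (hl : s.proc i = some l) : l.measure ρ' = l.measure ρ := by
  unfold Loc.measure
  cases h : l.h with
  | none => rfl
  | some x =>
    have : ρ' x = ρ x := hρ x ((I.loc i l hl).hMem x h).1
    simp [this]

theorem measure_lt [DecidableEq Item] (I : Inv s ρ items seen) (I' : Inv s' ρ' items seen')
    (hρ : ∀ x, 0 < ρ x → ρ' x = ρ x) {lab : Label Item p} (h : Step φ s lab s')
    (hi : lab.proc = i) (hl : s.proc i = some l) (he : l.e ∉ items) (hl' : s'.proc i = some l')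
    (he' : l'.e = l.e) : l'.measure ρ' < l.measure ρ := by
  have hA := I.absent hl he
  have hA' := I'.absent hl' (by rw [he']; exact he)
  -- Ranks of listed nodes are fixed, so both states can be measured with the new ranks.
  rw [← I.measure_eq hρ hl, Loc.measure_lt_iff]
  have key : ∀ {l₁ l₂ : Loc Item p} {q : PC} {s'' : Config Item p}, s.At i l₁ q →
      (s''.setLoc i l₂).proc i = some l' → l₁ = l ∧ l₂ = l' ∧ l.pc = q := by
    intro l₁ l₂ q s'' h1 h2
    have h3 : l₁ = l := Option.some.inj (h1.1.symm.trans hl)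
    exact ⟨h3, by simpa [Config.setLoc] using h2, h3 ▸ h1.2⟩
  cases h with
  | invoke i e h => cases hi; cases hl.symm.trans h
  | ret i l => cases hi; simp [Config.setIdle, Label.proc] at hl'
  | allocate i l x hm =>
    cases hi; obtain ⟨rfl, rfl, hq⟩ := key hm hl'; simp [hq, PC.stage]
  | announce i l hm =>
    cases hi; obtain ⟨rfl, rfl, hq⟩ := key hm hl'; simp [hq, PC.stage]
  | getHead i l hm =>
    cases hi; obtain ⟨rfl, rfl, hq⟩ := key hm hl'; simp [hq, PC.stage]
  | testFront i l x v hm =>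
    cases hi; obtain ⟨rfl, rfl, hq⟩ := key hm hl'
    split_ifs at hA' ⊢
    · cases hA'
    · simp [hq, PC.stage, PC.weight]
  | loop i l hm =>
    cases hi; obtain ⟨rfl, rfl, hq⟩ := key hm hl'
    by_cases h : l.h = none <;> simp [hq, h, PC.stage, PC.weight]
  | testItem i l x v hm =>
    cases hi; obtain ⟨rfl, rfl, hq⟩ := key hm hl'
    split_ifs at hA' ⊢
    · cases hA'
    · simp [hq, PC.stage, PC.weight]
    · simp [hq, PC.stage, PC.weight]
  | readAnn3 i l hm =>
    cases hi; obtain ⟨rfl, rfl, hq⟩ := key hm hl'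
    by_cases h : (s.ann i).2 = none
    · simp [h, PC.absent] at hA'
    · simp [hq, h, PC.stage, PC.weight]
  | next i l x v hm hx =>
    cases hi; obtain ⟨rfl, rfl, hq⟩ := key hm hl'
    have hr := ((I.loc _ _ hm.1).hMem x hx.1).1
    have hx' : ρ' x = ρ x := hρ x hr
    refine .inr ⟨by simp [hq, PC.stage], ?_⟩
    simp only [hq, hx.1, hx', Option.elim_some, PC.weight]
    cases hn : v.next with
    | none => have : 0 < ρ x := hr; simp; omega
    | some y =>
      obtain ⟨h1, h2⟩ := I.glob.nxt x y hr (by rw [Config.view_next hx.2, hn])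
      have h3 : ρ' y = ρ y := hρ y h1
      have h4 : ρ y < ρ x := h2
      simp only [Option.elim_some, h3]; omega
  | readAnn4 i l hm =>
    cases hi; obtain ⟨rfl, rfl, hq⟩ := key hm hl'; simp [hq, PC.stage, PC.weight]
  | unannEnd i l hm =>
    cases hi; obtain ⟨rfl, rfl, hq⟩ := key hm hl'; simp [hq, PC.stage, PC.weight]
  | _ =>
    cases hi
    obtain ⟨-, -, hq⟩ := key (by assumption) hl'
    rw [hq] at hA; cases hA

end Inv

/-! ### Executions: invariant, results and return -/

namespace Execution

variable [DecidableEq Item] {φ : ℕ} {items : List Item} {X : Execution p φ items}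
  {k m t : ℕ} {i : Fin p} {e : Item} {r : Result}

/-- Node `a` was at the front of the list at some time during the operation that process `i`
performs in configuration `t`. -/
def Seen (X : Execution p φ items) (t : ℕ) (i : Fin p) (a : Addr) : Prop :=
  ∃ t' ≤ t, (X.cfg t').head.1 = some a ∧
    ∀ u, t' ≤ u → u ≤ t → (X.cfg u).proc i ≠ none

theorem lt_of_succ_le (h : ((t + 1 : ℕ) : ℕ∞) ≤ X.len) : (t : ℕ∞) < X.len :=
  lt_of_lt_of_le (by exact_mod_cast Nat.lt_succ_self t) h

theorem exists_inv (hnodup : items.Nodup) (hlen : 2 ≤ items.length) (X : Execution p φ items) :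
    ∃ ρ : ℕ → Addr → ℕ, (∀ t : ℕ, (t : ℕ∞) ≤ X.len → Inv (X.cfg t) (ρ t) items (X.Seen t)) ∧
      ∀ t : ℕ, (t : ℕ∞) < X.len → ∀ x, 0 < ρ t x → ρ (t + 1) x = ρ t x := by
  -- The hypotheses stand inside the existential, so that a total function can be chosen and
  -- iterated to define the ranks at all times.
  have hstep : ∀ (t : ℕ) (ρ : Addr → ℕ), ∃ ρ' : Addr → ℕ, (t : ℕ∞) < X.len →
      Inv (X.cfg t) ρ items (X.Seen t) → Inv (X.cfg (t + 1)) ρ' items (X.Seen (t + 1)) ∧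
        ∀ x, 0 < ρ x → ρ' x = ρ x := by
    intro t ρ
    by_cases h : (t : ℕ∞) < X.len ∧ Inv (X.cfg t) ρ items (X.Seen t)
    · obtain ⟨ht, I⟩ := h
      obtain ⟨ρ', I', h'⟩ := I.step (fun j a hj ha => ⟨t, le_rfl, ha, fun u h1 h2 => by
        rw [le_antisymm h2 h1]; exact hj⟩) (X.step t ht)
      refine ⟨ρ', fun _ _ => ⟨⟨I'.glob, fun i l hl => (I'.loc i l hl).of_seen ?_, I'.idle,
        I'.own⟩, h'⟩⟩
      rintro j x hj ⟨t', h1, h2, h3⟩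
      refine ⟨t', by omega, h2, fun u hu hu' => ?_⟩
      rcases Nat.lt_or_ge t u with h | h
      · have : u = t + 1 := by omega
        subst this
        rcases hj with rfl | hj
        · rw [hl]; simp
        · intro h
          exact hj (show ((X.cfg (t + 1)).ann j).2 = none by rw [I'.idle j h])
      · exact h3 u hu h
    · exact ⟨ρ, fun h1 h2 => absurd ⟨h1, h2⟩ h⟩
  choose f hf using hstep
  obtain ⟨ρ₀, h₀⟩ := X.init.exists_inv hnodup hlen (X.Seen 0)
  let ρ : ℕ → Addr → ℕ := fun t => Nat.rec ρ₀ f t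
  have hI : ∀ t : ℕ, (t : ℕ∞) ≤ X.len → Inv (X.cfg t) (ρ t) items (X.Seen t) := by
    intro t
    induction t with
    | zero => exact fun _ => h₀
    | succ t ih =>
      intro ht
      exact (hf t (ρ t) (lt_of_succ_le ht) (ih (lt_of_succ_le ht).le)).1
  exact ⟨ρ, hI, fun t ht => (hf t (ρ t) ht (hI t ht.le)).2⟩

theorem finite_heap (X : Execution p φ items) (ht : (t : ℕ∞) ≤ X.len) :
    {x | (X.cfg t).heap x ≠ none}.Finite := by
  induction t with
  | zero =>
    obtain ⟨⟨addrs, -, -, -, h, -⟩, -⟩ := X.init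
    exact (List.finite_toSet addrs).subset fun x hx => by_contra fun h' => hx (h x h')
  | succ t ih =>
    obtain ⟨x, h, -⟩ := (X.step t (lt_of_succ_le ht)).heap
    refine ((ih (lt_of_succ_le ht).le).insert x).subset fun y hy => ?_
    by_cases hyx : y = x
    · exact .inl hyx
    · right
      rw [Set.mem_ofPred_eq, h y hyx] at hy
      exact hy

/-- A pointer to a node that contains `e` remains one. -/
theorem contains_of_le (hm : (m : ℕ∞) ≤ X.len) (htm : t ≤ m) {a : Ptr}
    (h : (X.cfg t).Contains a e) : (X.cfg m).Contains a e := by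
  induction m, htm using Nat.le_induction with
  | base => exact h
  | succ m _ ih =>
    obtain ⟨x, v, ⟨hx, hv⟩, he⟩ := ih (lt_of_succ_le hm).le
    obtain ⟨y, h1, h2⟩ := (X.step m (lt_of_succ_le hm)).heap
    by_cases hxy : x = y
    · subst hxy
      obtain ⟨v', h3, h4⟩ := h2 v hv
      exact ⟨x, v', ⟨hx, h3⟩, h4.trans he⟩
    · exact ⟨x, v, ⟨hx, by rw [h1 x hxy, hv]⟩, he⟩

theorem Invokes.unique {i' : Fin p} {e' : Item} (h : X.Invokes k i e) (h' : X.Invokes k i' e') :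
    i = i' ∧ e = e' := by
  have := h.2.symm.trans h'.2
  simpa using this

theorem Returns.unique {m' : ℕ} {r' : Result} (h : X.Returns k m r) (h' : X.Returns k m' r') :
    m = m' ∧ r = r' := by
  obtain ⟨i, e, h1, h2, -, h3, h4⟩ := h
  obtain ⟨i', e', h1', h2', -, h3', h4'⟩ := h'
  obtain ⟨rfl, rfl⟩ := h1.unique h1'
  have : m = m' := by
    rcases lt_trichotomy m m' with h | h | h
    · exact absurd h3 (h4' m r h2 h)
    · exact h
    · exact absurd h3' (h4 m' r' h2' h)
  subst this
  have := h3.symm.trans h3'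
  exact ⟨rfl, by simpa using this⟩

/-- A process performs the same operation until it returns. -/
theorem Invokes.exists_loc (h : X.Invokes k i e) (hkt : k < t) (ht : (t : ℕ∞) ≤ X.len)
    (hr : ∀ m r, k < m → m < t → X.lab m ≠ .ret i r) :
    ∃ l, (X.cfg t).proc i = some l ∧ l.e = e := by
  induction t, hkt using Nat.le_induction with
  | base =>
    have := X.step k h.1
    rw [h.2] at this
    exact this.of_inv.2
  | succ t hkt ih =>
    obtain ⟨l, h1, h2⟩ := ih (lt_of_succ_le ht).le fun m r h1 h2 => hr m r h1 (by omega)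
    obtain ⟨l', h3, h4⟩ := (X.step t (lt_of_succ_le ht)).proc_of_ne_ret h1
      fun r => hr t r hkt (by omega)
    exact ⟨l', h3, h4.trans h2⟩

/-- The result of a completed operation. -/
theorem Returns.result (hnodup : items.Nodup) (hlen : 2 ≤ items.length)
    (h : X.Invokes k i e) (hr : X.Returns k m r) :
    (e ∈ items → ∃ t, k < t ∧ t ≤ m ∧ r = .pointer (X.cfg t).head.1 ∧
      (X.cfg t).Contains (X.cfg t).head.1 e) ∧ (e ∉ items → r = .notPresent) := by
  obtain ⟨ρ, hI, -⟩ := X.exists_inv hnodup hlen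
  obtain ⟨i', e', h1, h2, h3, h4, h5⟩ := hr
  obtain ⟨rfl, rfl⟩ := h.unique h1
  obtain ⟨l, hl, rfl⟩ := h.exists_loc h2 h3.le h5
  have hs := X.step m h3
  rw [h4] at hs
  obtain ⟨l', hl', rfl⟩ := hs.of_ret
  cases hl'.1.symm.trans hl
  obtain ⟨h6, h7⟩ := ((hI m h3.le).loc i l hl).ret hl'.2
  refine ⟨fun he => ?_, h7⟩
  obtain ⟨x, hx, ⟨t, ht, ht', hp⟩, hi⟩ := h6 he
  -- Process `i` is idle in configuration `k`, but performs an operation at all times from `t` to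
  -- `m`.
  have hkt : k < t := by
    by_contra hkt
    have hs := X.step k h.1
    rw [h.2] at hs
    exact hp k (by omega) h2.le hs.of_inv.1
  refine ⟨t, hkt, ht, by rw [hx, ht'], ?_⟩
  have htl : (t : ℕ∞) ≤ X.len := le_trans (by exact_mod_cast ht) h3.le
  obtain ⟨a, b, hab, hb, hba, -⟩ := (hI t htl).glob.hd
  have hab : (X.cfg t).head = (some a, some b) := hab
  rw [hab] at ht'
  cases ht'
  obtain ⟨e', -, h8⟩ := (hI t htl).glob.itm x (by omega)
  obtain ⟨v, hv⟩ := Config.exists_of_view_item (ρ := ρ t) (s := X.cfg t) (x := x)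
    (by rw [h8]; simp)
  rw [hab]
  have hc : (X.cfg t).Contains (some x) v.item := ⟨x, v, ⟨rfl, hv⟩, rfl⟩
  obtain ⟨y, v', ⟨hy, hv'⟩, he'⟩ := contains_of_le h3.le ht hc
  cases hy
  rw [Config.view_item hv'] at hi
  rw [← he', Option.some.inj hi] at hc
  exact hc

/-- A search for an item that is not in the list returns if its process keeps taking steps. -/
theorem Invokes.exists_returns (hnodup : items.Nodup) (hlen : 2 ≤ items.length)
    (h : X.Invokes k i e) (he : e ∉ items) (hX : X.len = ⊤)
    (hf : ∃ᶠ m in Filter.atTop, (X.lab m).proc = i) : ∃ m r, X.Returns k m r := by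
  classical
  obtain ⟨ρ, hI, hρ⟩ := X.exists_inv hnodup hlen
  have hle : ∀ t : ℕ, (t : ℕ∞) ≤ X.len := fun t => by rw [hX]; exact le_top
  have hlt : ∀ t : ℕ, (t : ℕ∞) < X.len := fun t => by rw [hX]; exact ENat.natCast_lt_top t
  by_cases hret : ∃ m, k < m ∧ ∃ r, X.lab m = .ret i r
  · obtain ⟨h1, r, h2⟩ := Nat.find_spec hret
    exact ⟨Nat.find hret, r, i, e, h, h1, hlt _, h2, fun m' r' h3 h4 h5 =>
      Nat.find_min hret h4 ⟨h3, r', h5⟩⟩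
  exfalso
  push Not at hret
  have hloc : ∀ t, ∃ l : Loc Item p, k < t → (X.cfg t).proc i = some l ∧ l.e = e := by
    intro t
    by_cases ht : k < t
    · obtain ⟨l, hl⟩ := h.exists_loc ht (hle t) fun m r h1 _ => hret m h1 r
      exact ⟨l, fun _ => hl⟩
    · exact ⟨{ pc := .ret, e := e }, fun h => absurd h ht⟩
  choose l hl using hloc
  let μ : ℕ → ℕ ×ₗ ℕ := fun t => (l t).measure (ρ t)
  have hlt' : ∀ t, k < t → (X.lab t).proc = i → μ (t + 1) < μ t := by
    intro t ht hi
    obtain ⟨h1, h2⟩ := hl t ht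
    obtain ⟨h3, h4⟩ := hl (t + 1) (by omega)
    exact (hI t (hle t)).measure_lt (hI (t + 1) (hle _)) (hρ t (hlt t)) (X.step t (hlt t)) hi h1
      (by rw [h2]; exact he) h3 (by rw [h2, h4])
  have hle' : ∀ t, k < t → μ (t + 1) ≤ μ t := by
    intro t ht
    by_cases hi : (X.lab t).proc = i
    · exact (hlt' t ht hi).le
    · have h1 := (hl t ht).1
      have h2 := (hl (t + 1) (by omega)).1
      rw [(X.step t (hlt t)).proc_of_ne hi, h1] at h2
      have h3 : l (t + 1) = l t := (Option.some.inj h2).symm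
      simp only [μ, h3]
      exact ((hI t (hle t)).measure_eq (hρ t (hlt t)) h1).le
  -- Steps of other processes do not change the measure, and each own step lowers it. A later own
  -- step, which exists by `hf`, would go below the minimum.
  obtain ⟨_, ⟨t, ht, rfl⟩, hmin⟩ := wellFounded_lt.has_min {x | ∃ t, k < t ∧ μ t = x}
    ⟨_, k + 1, by simp, rfl⟩
  have hanti : ∀ m, t ≤ m → μ m ≤ μ t := by
    intro m hm
    induction m, hm using Nat.le_induction with
    | base => exact le_rfl
    | succ m hm ih => exact (hle' m (lt_of_lt_of_le ht hm)).trans ih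
  obtain ⟨m, hm, hmi⟩ := Filter.frequently_atTop.1 hf t
  have hkm : k < m := lt_of_lt_of_le ht hm
  exact hmin _ ⟨m + 1, by omega, rfl⟩ ((hlt' m hkm hmi).trans_le (hanti m hm))

end Execution

/-! ### Sequential specification and assembly -/

/-- Moving to the front only permutes the list. Hence the sequential response does not depend on the
earlier operations, and legality puts no constraint on the order of the points. -/
theorem mem_seqRun [DecidableEq Item] (L es : List Item) (e : Item) :
    e ∈ seqRun L es ↔ e ∈ L := by
  induction es generalizing L with
  | nil => rfl
  | cons a es ih =>
    rw [show seqRun L (a :: es) = seqRun (seqState a L) es from rfl, ih, seqState]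
    split_ifs with h
    · by_cases hea : e = a
      · subst hea; simp [h]
      · simp [hea, List.mem_erase_of_ne]
    · rfl

/-- A finite set can be listed in the order of the values of an injective function. -/
theorem exists_sorted_list {α : Type*} [LinearOrder α] {f : ℕ → α} (hf : f.Injective)
    {s : Set ℕ} (hs : s.Finite) :
    ∃ L : List ℕ, L.Pairwise (fun a b => f a < f b) ∧ ∀ a, a ∈ L ↔ a ∈ s := by
  classical
  let g : α → ℕ := Function.invFun f
  have hg : ∀ a, g (f a) = a := Function.leftInverse_invFun hf
  refine ⟨((hs.toFinset.image f).sort).map g, ?_, fun a => ?_⟩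
  · rw [List.pairwise_map]
    refine (Finset.sortedLT_sort _).pairwise.imp_of_mem fun {a b} ha hb h => ?_
    simp only [Finset.mem_sort, Finset.mem_image] at ha hb
    obtain ⟨a, -, rfl⟩ := ha
    obtain ⟨b, -, rfl⟩ := hb
    rwa [hg, hg]
  · simp [hg]

end DMTF

theorem mainTheorem7 {Item : Type*} [DecidableEq Item] (p φ : ℕ) (hφ : 1 ≤ φ)
    (items : List Item) (hnodup : items.Nodup) (hlen : 2 ≤ items.length)
    (X : DMTF.Execution p φ items) :
    -- the execution is linearizable
    (∃ (ops : Set ℕ) (pt : ℕ → ℕ ×ₗ ℕ), X.IsLinearization ops pt ∧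
      ∀ k ∈ ops, ∀ i e, X.Invokes k i e →
        -- an item of the set is at the front when the operation is linearized, and the operation
        -- returns a pointer to the front node
        (e ∈ items →
          (X.cfg (ofLex (pt k)).1).Contains (X.cfg (ofLex (pt k)).1).head.1 e ∧
          ∀ m r, X.Returns k m r → r = .pointer (X.cfg (ofLex (pt k)).1).head.1) ∧
        -- a search for any other item returns NOT PRESENT
        (e ∉ items → ∀ m r, X.Returns k m r → r = .notPresent)) ∧
    -- a search for an item outside the set does return unless its process crashes
    (∀ k i e, X.Invokes k i e → e ∉ items → X.len = ⊤ →
      (∃ᶠ m in Filter.atTop, (X.lab m).proc = i) → ∃ m, X.Returns k m .notPresent) ∧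
    -- a process that is performing an operation always has a next step
    (∀ t : ℕ, (t : ℕ∞) ≤ X.len → ∀ i l, (X.cfg t).proc i = some l →
      ∃ lab s, lab.proc = i ∧ DMTF.Step φ (X.cfg t) lab s) := by
  refine ⟨?_, fun k i e h he hX hf => ?_, fun t ht i l hl => ?_⟩
  -- `T k` is a time during operation `k` when the node that it returns is at the front. For an
  -- absent item any time in the operation will do, and `k + 1` is taken.
  · have hT : ∀ k, ∃ T : ℕ, ∀ m r, X.Returns k m r → k < T ∧ T ≤ m ∧
        ∀ i e, X.Invokes k i e → e ∈ items →
          (X.cfg T).Contains (X.cfg T).head.1 e ∧ r = .pointer (X.cfg T).head.1 := by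
      intro k
      by_cases h : ∃ m r, X.Returns k m r
      · obtain ⟨m, r, hr⟩ := h
        obtain ⟨i, e, h1, h2, -⟩ := id hr
        by_cases he : e ∈ items
        · obtain ⟨T, h3, h4, h5, h6⟩ := (hr.result hnodup hlen h1).1 he
          refine ⟨T, fun m' r' hr' => ?_⟩
          obtain ⟨rfl, rfl⟩ := hr.unique hr'
          refine ⟨h3, h4, fun i' e' h1' _ => ?_⟩
          obtain ⟨-, rfl⟩ := h1.unique h1'
          exact ⟨h6, h5⟩
        · refine ⟨k + 1, fun m' r' hr' => ?_⟩
          obtain ⟨rfl, rfl⟩ := hr.unique hr'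
          refine ⟨by omega, h2, fun i' e' h1' he' => ?_⟩
          obtain ⟨-, rfl⟩ := h1.unique h1'
          exact absurd he' he
      · exact ⟨0, fun m r hr => absurd ⟨m, r, hr⟩ h⟩
    choose T hT using hT
    -- Several operations may share a configuration; the operation number keeps their points
    -- distinct.
    let pt : ℕ → ℕ ×ₗ ℕ := fun k => toLex (T k, k)
    have hpt : pt.Injective := fun a b h => by
      have : (T a, a) = (T b, b) := toLex.injective h
      exact (Prod.mk.inj this).2
    -- Exactly the completed operations are linearized.
    refine ⟨{k | ∃ m r, X.Returns k m r}, pt, ⟨?_, ?_, hpt.injOn, ?_, ?_, ?_, ?_⟩, ?_⟩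
    · rintro k ⟨m, r, i, e, h, -⟩
      exact ⟨i, e, h⟩
    · exact fun k m r h => ⟨m, r, h⟩
    · rintro k ⟨m, r, h⟩
      have h1 := (hT k m r h).2.1
      obtain ⟨i, e, -, -, h2, -⟩ := h
      exact le_trans (by exact_mod_cast h1) h2.le
    · rintro k ⟨m, r, h⟩
      exact (hT k m r h).1
    · exact fun k m r h => (hT k m r h).2.1
    · intro k m i e r h hr
      have hfin : {a | (∃ m r, X.Returns a m r) ∧ pt a < pt k}.Finite := by
        -- An operation linearized earlier was invoked before its own point, hence before time `T
        -- k`.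
        refine (Set.finite_Iic (T k)).subset ?_
        rintro a ⟨⟨m', r', h'⟩, hlt⟩
        have h1 := (hT a m' r' h').1
        have h2 : T a ≤ T k := by
          rcases Prod.Lex.toLex_lt_toLex.1 hlt with h | h
          · exact h.le
          · exact h.1.le
        exact h1.le.trans h2
      obtain ⟨prior, h1, h2⟩ := DMTF.exists_sorted_list hpt hfin
      refine ⟨prior, h1, h2, ?_⟩
      obtain ⟨-, h3, h4⟩ := hT k m r hr
      simp only [DMTF.seqResponse, DMTF.mem_seqRun]
      by_cases he : e ∈ items
      · obtain ⟨h5, rfl⟩ := h4 i e h he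
        obtain ⟨-, -, -, -, hm, -⟩ := hr
        rw [if_pos he]
        exact DMTF.Execution.contains_of_le hm.le h3 h5
      · rw [if_neg he, (hr.result hnodup hlen h).2 he]
        trivial
    · rintro k ⟨m, r, hr⟩ i e h
      refine ⟨fun he => ⟨((hT k m r hr).2.2 i e h he).1, fun m' r' hr' =>
        ((hT k m' r' hr').2.2 i e h he).2⟩, fun he m' r' hr' => (hr'.result hnodup hlen h).2 he⟩
  · obtain ⟨m, r, hr⟩ := h.exists_returns hnodup hlen he hX hf
    have := (hr.result hnodup hlen h).2 he
    exact ⟨m, this ▸ hr⟩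
  · obtain ⟨ρ, hI, -⟩ := X.exists_inv hnodup hlen
    exact (hI t ht).exists_step φ (X.finite_heap ht) hl
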